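/- **Setting.** Fix $m\ge 1$. For each $n\in\mathbb N$ let $n_0,n_1,\dots,n_m$ be integers depending on $n$ with $n_0=n_m=n$ and $n/n_q\to y_q\in(0,\infty)$ for $q=1,\dots,m$. Let $\mathbb F=\mathbb F_n$ map $m$-tuples $(\mathbf Z^{(1)},\dots,\mathbf Z^{(m)})$ of complex matrices of sizes $n_0\times n_1,\dots,n_{m-1}\times n_m$ to complex $n\times n$ matrices, and assume that the entries of $\mathbb F_n$ are three times continuously differentiable functions of the real and imaginary parts of the entries $Z^{(q)}_{jk}$. For every $n$ let $X^{(q)}_{jk},Y^{(q)}_{jk}$ ($1\le q\le m$, $1\le j\le n_{q-1}$, $1\le k\le n_q$) be independent complex random variables on one probability space with $\mathbf E X^{(q)}_{jk}=0$, $\mathbf E|X^{(q)}_{jk}|^2=1$, and such that $(\mathrm{Re}\,Y^{(q)}_{jk},\mathrm{Im}\,Y^{(q)}_{jk})$ is (possibly degenerate) bivariate Gaussian with the same first and second moments (mixed moment included) as $(\mathrm{Re}\,X^{(q)}_{jk},\mathrm{Im}\,X^{(q)}_{jk})$. Put $\mathbf X^{(q)}=(n_q^{-1/2}X^{(q)}_{jk})$,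 $\mathbf Y^{(q)}=(n_q^{-1/2}Y^{(q)}_{jk})$, $\mathbf F_{\mathbf X}=\mathbb F(\mathbf X^{(1)},\dots,\mathbf X^{(m)})$, $\mathbf F_{\mathbf Y}=\mathbb F(\mathbf Y^{(1)},\dots,\mathbf Y^{(m)})$. Let $\mu_{\mathbf X},\mu_{\mathbf Y}$ be the empirical spectral measures of $\mathbf F_{\mathbf X},\mathbf F_{\mathbf Y}$ (mass $1/n$ at each eigenvalue, counted with algebraic multiplicity), and let $s_1(\mathbf A)\ge\dots\ge s_n(\mathbf A)$ denote the singular values of an $n\times n$ matrix $\mathbf A$. **Lindeberg condition.** For every $\tau>0$, $L_n(\tau):=n^{-2}\sum_{q,j,k}\mathbf E|X^{(q)}_{jk}|^2\mathbb I\{|X^{(q)}_{jk}|>\tau\sqrt n\}\to0$ as $n\to\infty$. **Rank condition.** There is a constant $C$, independent of $n$, such that for all $n$ and all tuples $(\mathbf A^{(q)}),(\mathbf B^{(q)})$ one has $\operatorname{rank}(\mathbb F(\mathbf A^{(1)},\dots,\mathbf A^{(m)})-\mathbb F(\mathbf B^{(1)},\dots,\mathbf B^{(m)}))\le C\sum_{q=1}^m\operatorname{rank}(\mathbf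 A^{(q)}-\mathbf B^{(q)})$. **Derivative conditions.** Let $(\tau_n)$ be a sequence with $\tau_n\to0$, $L_n(\tau_n)\tau_n^{-4}\to0$ and $\tau_n\ge n^{-1/3}$ for $n\ge 1$. For $x\in\mathbb C$ put $\hat x=x\,\mathbb I\{|x|\le\tau_n\sqrt n\}$. For $0\le\varphi\le\pi/2$ let $\mathbf Z(\varphi)$ be the tuple of matrices with entries $Z^{(q)}_{jk}=n_q^{-1/2}(\hat X^{(q)}_{jk}\cos\varphi+\hat Y^{(q)}_{jk}\sin\varphi)$. For $\alpha\in\mathbb C$, $\mathrm{Im}\,z>0$ and a tuple $\mathbf Z$ put $$\mathbf V=\begin{bmatrix}\mathbf O&\mathbb F(\mathbf Z)+\alpha\mathbf I\\(\mathbb F(\mathbf Z)+\alpha\mathbf I)^*&\mathbf O\end{bmatrix},\quad \mathbf R=(\mathbf V-z\mathbf I)^{-1},\quad g^{(q)}_{jk}=\operatorname{Tr}\frac{\partial\mathbf V}{\partial\,\mathrm{Re}\,Z^{(q)}_{jk}}\mathbf R^2,\quad \hat g^{(q)}_{jk}=\operatorname{Tr}\frac{\partial\mathbf V}{\partial\,\mathrm{Im}\,Z^{(q)}_{jk}}\mathbf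 R^2 .$$ For a function $G$ of the tuple let $G(\theta)$ be its value at the tuple obtained from $\mathbf Z(\varphi)$ by replacing the one entry $Z^{(q)}_{jk}$ by $\theta Z^{(q)}_{jk}$, where $\theta$ is uniform on $[0,1]$ and independent of all $X$'s and $Y$'s. Let $\|\mathbf E\{G(\theta)\mid X^{(q)}_{jk},Y^{(q)}_{jk}\}\|_\infty$ be the supremum over all $x,y\in\mathbb C$ of the absolute value of $\mathbf E\{G(\theta)\mid X^{(q)}_{jk}=x,\,Y^{(q)}_{jk}=y\}$, that is, of the expectation of $G(\theta)$ with $x,y$ inserted for $X^{(q)}_{jk},Y^{(q)}_{jk}$ (which are independent of everything else). The conditions are: for every $\alpha\in\mathbb C$ and every $z$ with $\mathrm{Im}\,z>0$ there are positive constants $A_0,A_1,A_2$ such that for all $n\ge1$, $0\le\varphi\le\pi/2$ and all $q,j,k$, and both for $g=g^{(q)}_{jk}$ and for $g=\hat g^{(q)}_{jk}$, this norm is at most $A_0$ for $G=g$, at most $A_1$ for $G$ each of the two first-order partial derivatives of $g$ with respect to $\mathrm{Re}\,Z^{(q)}_{jk}$ and $\mathrm{Im}\,Z^{(q)}_{jk}$,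 and at most $A_2$ for $G$ each of the second-order partial derivatives of $g$ with respect to these two variables. **Conditions on singular values** of random $n\times n$ matrices $\mathbf F=\mathbf F_n$: * (C0) There is $p>0$ such that $\frac1n\sum_{k=1}^n s_k^p(\mathbf F)$ is bounded in probability as $n\to\infty$. * (C1) For every $\alpha\in\mathbb C$ there is $Q>0$ with $\lim_{n\to\infty}\Pr\{s_n(\mathbf F-\alpha\mathbf I)\le n^{-Q}\}=0$. * (C2) For every $\alpha\in\mathbb C$ there is $0<\gamma<1$ such that for every real sequence $\delta_n\to0$ and every $\varepsilon>0$, $\lim_{n\to\infty}\Pr\{\frac1n\sum_{\nu_1\le j\le \nu_2}|\log s_j(\mathbf F-\alpha\mathbf I)|>\varepsilon\}=0$, where $\nu_1=[n-n\delta_n]+1$, $\nu_2=[n-n^\gamma]$ and $|\log0|=\infty$. **Theorem 4.1.** Assume the Lindeberg condition, the rank condition and the derivative conditions, and assume that $\mathbf F_{\mathbf X}$ and $\mathbf F_{\mathbf Y}$ both satisfy (C0), (C1) and (C2). Then the empirical eigenvalue distributions of $\mathbf F_{\mathbf X}$ and $\mathbf F_{\mathbf Y}$ have the same limit in probability, in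 the sense that for every bounded continuous $f$ on $\mathbb C$ and every $\varepsilon>0$ $$\lim_{n\to\infty}\Pr\Big\{\Big|\int_{\mathbb C} f\,d\mu_{\mathbf X}-\int_{\mathbb C} f\,d\mu_{\mathbf Y}\Big|>\varepsilon\Big\}=0 .$$ -/

import Mathlib

open MeasureTheory ProbabilityTheory Filter Topology

noncomputable section

namespace RandomMatrixFunctions

/-- Tuples `(Z⁽¹⁾, …, Z⁽ᵐ⁾)` of complex matrices of sizes `d 0 × d 1, …, d (m-1) × d m`;
the matrix `Z⁽ᵠ⁾` of the text is the component with index `q - 1 : Fin m`. -/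
abbrev MatTuple {m : ℕ} (d : Fin (m + 1) → ℕ) : Type :=
  (q : Fin m) → Matrix (Fin (d q.castSucc)) (Fin (d q.succ)) ℂ

/-- Positions `(q, j, k)` of the entries of such a tuple. -/
abbrev Entry {m : ℕ} (d : Fin (m + 1) → ℕ) : Type :=
  (q : Fin m) × (Fin (d q.castSucc) × Fin (d q.succ))

/-- The matrix tuple with prescribed entries. -/
def ofEntries {m : ℕ} {d : Fin (m + 1) → ℕ} (u : Entry d → ℂ) : MatTuple d :=
  fun q => Matrix.of fun j k => u ⟨q, j, k⟩

/-- The normalization: the `(j,k)` entry of the `q`-th matrix is divided by `√n_q`. -/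
def scaled {m : ℕ} {d : Fin (m + 1) → ℕ} (x : Entry d → ℂ) : Entry d → ℂ :=
  fun e => x e / (Real.sqrt (d e.1.succ) : ℂ)

/-- The matrix `𝔽(X⁽¹⁾, …, X⁽ᵐ⁾)`, `X⁽ᵠ⁾ = (X_{jk}⁽ᵠ⁾ / √n_q)`. -/
def valueAt {m n : ℕ} {d : Fin (m + 1) → ℕ} (F : MatTuple d → Matrix (Fin n) (Fin n) ℂ)
    (x : Entry d → ℂ) : Matrix (Fin n) (Fin n) ℂ :=
  F (ofEntries (scaled x))

/-! ### Singular values and eigenvalues -/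

/-- `s_j(A)`, the `j`-th largest singular value, `j = 1, …, n`
(Mathlib numbers the singular values from `0`). -/
def singVal {n : ℕ} (A : Matrix (Fin n) (Fin n) ℂ) (j : ℕ) : ℝ :=
  (Matrix.toEuclideanLin A).singularValues (j - 1)

/-- The empirical spectral measure: mass `1/n` at each eigenvalue, counted with algebraic
multiplicity. -/
def spectralMeasure {n : ℕ} (A : Matrix (Fin n) (Fin n) ℂ) : Measure ℂ :=
  (n : ENNReal)⁻¹ • (A.charpoly.roots.map fun l => Measure.dirac l).sum

variable {Ω : Type*} [MeasurableSpace Ω]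

/-- Condition (C0) for random matrices `M n` of size `n × n`. -/
def CondC0 (P : Measure Ω) (M : (n : ℕ) → Ω → Matrix (Fin n) (Fin n) ℂ) : Prop :=
  ∃ p : ℝ, 0 < p ∧ ∀ ε : ENNReal, 0 < ε → ∃ K : ℝ, ∀ᶠ n : ℕ in atTop,
    P {ω | K < (1 / (n : ℝ)) * ∑ k ∈ Finset.Icc 1 n, singVal (M n ω) k ^ p} ≤ ε

/-- Condition (C1). -/
def CondC1 (P : Measure Ω) (M : (n : ℕ) → Ω → Matrix (Fin n) (Fin n) ℂ) : Prop :=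
  ∀ α : ℂ, ∃ Q : ℝ, 0 < Q ∧
    Tendsto (fun n : ℕ => P {ω | singVal (M n ω - α • 1) n ≤ (n : ℝ) ^ (-Q)}) atTop (𝓝 0)

/-- Condition (C2). Since `|log 0| = ∞`, the event also contains those `ω` for which one of the
singular values in question vanishes. -/
def CondC2 (P : Measure Ω) (M : (n : ℕ) → Ω → Matrix (Fin n) (Fin n) ℂ) : Prop :=
  ∀ α : ℂ, ∃ γ : ℝ, 0 < γ ∧ γ < 1 ∧ ∀ δ : ℕ → ℝ, Tendsto δ atTop (𝓝 0) →
    ∀ ε : ℝ, 0 < ε →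
      Tendsto (fun n : ℕ =>
        P {ω |
          (∃ j ∈ Finset.Icc (⌊(n : ℝ) - n * δ n⌋₊ + 1) ⌊(n : ℝ) - (n : ℝ) ^ γ⌋₊,
            singVal (M n ω - α • 1) j = 0) ∨
          ε < (1 / (n : ℝ)) *
            ∑ j ∈ Finset.Icc (⌊(n : ℝ) - n * δ n⌋₊ + 1) ⌊(n : ℝ) - (n : ℝ) ^ γ⌋₊,
              |Real.log (singVal (M n ω - α • 1) j)|}) atTop (𝓝 0)

/-! ### Lindeberg and rank conditions -/

/-- `L_n(τ) = n⁻² ∑_{q,j,k} E |X_{jk}⁽ᵠ⁾|² 1{|X_{jk}⁽ᵠ⁾| > τ √n}`. -/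
def lindebergSum (P : Measure Ω) {m : ℕ} {d : Fin (m + 1) → ℕ} (n : ℕ)
    (X : Entry d → Ω → ℂ) (τ : ℝ) : ℝ :=
  (1 / (n : ℝ) ^ 2) * ∑ e : Entry d,
    ∫ ω, (if τ * Real.sqrt n < ‖X e ω‖ then ‖X e ω‖ ^ 2 else 0) ∂P

/-- The rank condition; the constant does not depend on `n`. -/
def RankCondition {m : ℕ} (N : ℕ → Fin (m + 1) → ℕ)
    (F : (n : ℕ) → MatTuple (N n) → Matrix (Fin n) (Fin n) ℂ) : Prop :=
  ∃ C : ℝ, ∀ (n : ℕ) (A B : MatTuple (N n)),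
    ((F n A - F n B).rank : ℝ) ≤ C * ∑ q : Fin m, ((A q - B q).rank : ℝ)

/-! ### The resolvent and the functions `g_{jk}⁽ᵠ⁾` -/

/-- `V = [[0, A], [A*, 0]]`. -/
def hermitization {n : ℕ} (A : Matrix (Fin n) (Fin n) ℂ) :
    Matrix (Fin n ⊕ Fin n) (Fin n ⊕ Fin n) ℂ :=
  Matrix.fromBlocks 0 A A.conjTranspose 0

/-- Partial derivative at `u` with respect to the real part (`c = 1`) or the imaginary part
(`c = I`) of the entry at position `e`. -/
def partialDeriv {m : ℕ} {d : Fin (m + 1) → ℕ} (e : Entry d) (c : ℂ)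
    (f : (Entry d → ℂ) → ℂ) (u : Entry d → ℂ) : ℂ :=
  deriv (fun t : ℝ => f (u + Pi.single e ((t : ℂ) * c))) 0

/-- `Tr (∂V/∂Re Z_e) R²` (for `c = 1`) and `Tr (∂V/∂Im Z_e) R²` (for `c = I`) as functions of the
entries of `Z`, where `V` is the hermitization of `𝔽(Z) + B` and `R = (V - z)⁻¹`. -/
def gFun {m n : ℕ} {d : Fin (m + 1) → ℕ} (F : MatTuple d → Matrix (Fin n) (Fin n) ℂ)
    (B : Matrix (Fin n) (Fin n) ℂ) (z : ℂ) (e : Entry d) (c : ℂ) (u : Entry d → ℂ) : ℂ :=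
  ((Matrix.of fun a b =>
      partialDeriv e c (fun w => hermitization (F (ofEntries w) + B) a b) u) *
    ((hermitization (F (ofEntries u) + B) - z • 1)⁻¹) ^ 2).trace

/-- Truncation at level `K`. -/
def trunc (K : ℝ) (x : ℂ) : ℂ :=
  open Classical in if ‖x‖ ≤ K then x else 0

/-- The entries of `Z(φ) = X̂ cos φ + Ŷ sin φ`, with truncation at level `τ √n` and the
normalization `1/√n_q`. -/
def interp {m : ℕ} {d : Fin (m + 1) → ℕ} (n : ℕ) (τ φ : ℝ) (x y : Entry d → ℂ) : Entry d → ℂ :=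
  scaled fun e => trunc (τ * Real.sqrt n) (x e) * (Real.cos φ : ℂ)
    + trunc (τ * Real.sqrt n) (y e) * (Real.sin φ : ℂ)

/-- `E{G(θ) | X_e = x, Y_e = y}`: the entry at position `e` is `θ Z_e(φ)`, computed from the values
`X_e = x`, `Y_e = y`, where `θ` is uniform on `[0,1]`; all the other entries are those of `Z(φ)`.
As `θ`, `(X_e, Y_e)` and the other entries are independent, the conditional expectation is the
expectation with `x`, `y` inserted. -/
def condMean (P : Measure Ω) {m : ℕ} {d : Fin (m + 1) → ℕ} (n : ℕ) (τ φ : ℝ)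
    (X Y : Entry d → Ω → ℂ) (e : Entry d) (G : (Entry d → ℂ) → ℂ) (x y : ℂ) : ℂ :=
  ∫ p : ℝ × Ω,
    G (Function.update (interp n τ φ (fun a => X a p.2) (fun a => Y a p.2)) e
      ((p.1 : ℂ) * interp n τ φ (fun _ : Entry d => x) (fun _ : Entry d => y) e))
    ∂((volume.restrict (Set.Icc (0 : ℝ) 1)).prod P)

/-- The derivative bounds for the shift `B`: for every `z` in the upper half plane there are
constants `A₀, A₁, A₂` bounding, uniformly in `n`, `φ` and the entry `e`, the conditional means
of the two functions `g` and of their partial derivatives of order one and two with respect to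
the real and imaginary part of that same entry, in the supremum norm as functions of the
values `(x, y)` of `(X_e, Y_e)`. -/
def DerivativeBounds (P : Measure Ω) {m : ℕ} (N : ℕ → Fin (m + 1) → ℕ)
    (F : (n : ℕ) → MatTuple (N n) → Matrix (Fin n) (Fin n) ℂ)
    (X Y : (n : ℕ) → Entry (N n) → Ω → ℂ) (τ : ℕ → ℝ)
    (B : (n : ℕ) → Matrix (Fin n) (Fin n) ℂ) : Prop :=
  ∀ z : ℂ, 0 < z.im → ∃ A₀ A₁ A₂ : ℝ, 0 < A₀ ∧ 0 < A₁ ∧ 0 < A₂ ∧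
    ∀ n : ℕ, 1 ≤ n → ∀ φ ∈ Set.Icc (0 : ℝ) (Real.pi / 2), ∀ e : Entry (N n), ∀ x y : ℂ,
      ∀ c₀ ∈ ({1, Complex.I} : Set ℂ),
        ‖condMean P n (τ n) φ (X n) (Y n) e (gFun (F n) (B n) z e c₀) x y‖ ≤ A₀ ∧
        ∀ c₁ ∈ ({1, Complex.I} : Set ℂ),
          ‖condMean P n (τ n) φ (X n) (Y n) e
            (partialDeriv e c₁ (gFun (F n) (B n) z e c₀)) x y‖ ≤ A₁ ∧
          ∀ c₂ ∈ ({1, Complex.I} : Set ℂ),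
            ‖condMean P n (τ n) φ (X n) (Y n) e
              (partialDeriv e c₂ (partialDeriv e c₁ (gFun (F n) (B n) z e c₀))) x y‖ ≤ A₂

end RandomMatrixFunctions

end

noncomputable section

namespace RandomMatrixFunctions

/-! ### Singular values and the Gram matrix -/

/-! The spectra are compared through logarithmic potentials. For a matrix `F` the number n⁻¹
log|det(F - α)| is the mean of log|α - λ| over the eigenvalues, and also the mean of log s_j(F - α)
over the singular values. The second description makes the random potentials comparable; the first
one turns this into a comparison of eigenvalues.

Singular values. For 0 < b ≤ a and s > 0, 2 log s = log a + log(1 + s²/a) - ∫_b^a dw/(s² + w) -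
log(1 + b/s²) (`two_mul_log_det_eq`). By (C0) the term with a is small for large a
(`eventually_prob_upper_le`), by (C1) and (C2) the term with b is small for small b
(`exists_prob_lower_le`). What remains is an integral of n⁻¹ Tr(A*A + w)⁻¹, which up to a factor is
the resolvent trace of the hermitization at z = i√w.

Resolvent traces. These traces agree asymptotically in L¹ (`tendsto_integral_abs_resTr_sub`). A
perturbation of rank r changes them by O(r/n) (`abs_sum_inv_sub_le`). With the rank condition this
has two consequences: truncating the entries at τ√n is harmless, as few entries are affected, and
changing one row matters so little that the variance is O(1/n) (`variance_le_of_block_diff`). The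
expectations for the truncated entries are compared along X̂ cos φ + Ŷ sin φ. The φ-derivative is a
sum over entries of velocity times a first partial derivative g. Expanding g to first order in that
entry, one uses that the velocity has small mean and, because the covariances match, is nearly
uncorrelated with the position; the remainder costs a third moment, small by truncation
(`norm_integral_entry_le`).

Eigenvalues. For continuous f of compact support, the difference of the means of f over circles of
radii R and r, integrated against log|α - l|, gives the convolution of f with a nonnegative kernel
supported in the disc of radius R (`integral_testFn_mul_log`). For small R this is nearly a multiple
of f(l), so means of f over eigenvalues are integrals of potentials. Convergence in probability for
each α passes to the integral after truncating the potentials; the discarded singular part is an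
integrable function with arbitrarily small weight. Finally Jensen's formula on the unit circle
bounds the mean of log⁺|λ| by singular values (`sum_posLog_roots_le`), so (C0) gives the tightness
needed for bounded f. -/

/-- The singular values, numbered from `0`. -/
def sv {n : ℕ} (A : Matrix (Fin n) (Fin n) ℂ) (j : ℕ) : ℝ :=
  (Matrix.toEuclideanLin A).singularValues j

lemma sv_nonneg {n : ℕ} (A : Matrix (Fin n) (Fin n) ℂ) (j : ℕ) : 0 ≤ sv A j :=
  LinearMap.singularValues_nonneg _ _

lemma sv_antitone {n : ℕ} (A : Matrix (Fin n) (Fin n) ℂ) : Antitone (sv A) :=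
  LinearMap.singularValues_antitone _

lemma gram_isHermitian {n : ℕ} (A : Matrix (Fin n) (Fin n) ℂ) :
    (A.conjTranspose * A).IsHermitian := Matrix.isHermitian_conjTranspose_mul_self A

/-- `eigenvalues` depends on the proof of symmetry and through it on the operator, so an equality of
operators is substituted rather than rewritten. -/
lemma eigenvalues_congr {E : Type*} [NormedAddCommGroup E] [InnerProductSpace ℂ E]
    [FiniteDimensional ℂ E] {k : ℕ} (hk : Module.finrank ℂ E = k) {S T : E →ₗ[ℂ] E}
    (hS : S.IsSymmetric) (hT : T.IsSymmetric) (h : S = T) (i : Fin k) :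
    hS.eigenvalues hk i = hT.eigenvalues hk i := by
  subst h; rfl

/-- Both sides list, in the same order, the eigenvalues of one operator: the singular values come
from `adjoint T ∘ₗ T`, and this is the operator of A*A. -/
lemma gram_eigenvalues₀ {n : ℕ} (A : Matrix (Fin n) (Fin n) ℂ)
    (i : Fin (Fintype.card (Fin n))) :
    (gram_isHermitian A).eigenvalues₀ i = sv A i ^ 2 := by
  have h1 := LinearMap.sq_singularValues_fin (Matrix.toEuclideanLin A)
    (finrank_euclideanSpace (𝕜 := ℂ) (ι := Fin n)) i
  have h2 : Matrix.toEuclideanLin (A.conjTranspose * A)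
      = LinearMap.adjoint (Matrix.toEuclideanLin A) ∘ₗ Matrix.toEuclideanLin A := by
    rw [← Matrix.toEuclideanLin_conjTranspose_eq_adjoint, ← Matrix.toLpLin_mul_same]
  exact (eigenvalues_congr _ _ _ h2 i).trans h1.symm

lemma sum_gram_eigenvalues {n : ℕ} {M : Type*} [AddCommMonoid M]
    (A : Matrix (Fin n) (Fin n) ℂ) (φ : ℝ → M) :
    ∑ i, φ ((gram_isHermitian A).eigenvalues i) = ∑ j ∈ Finset.range n, φ (sv A j ^ 2) := by
  have h1 : ∑ i, φ ((gram_isHermitian A).eigenvalues i)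
      = ∑ i, φ ((gram_isHermitian A).eigenvalues₀ i) := by
    -- `eigenvalues` is `eigenvalues₀` up to a bijection of the index types, which a full sum does
    -- not see.
    unfold Matrix.IsHermitian.eigenvalues
    exact Equiv.sum_comp _ (fun i => φ ((gram_isHermitian A).eigenvalues₀ i))
  rw [h1]
  simp_rw [gram_eigenvalues₀]
  rw [← Finset.sum_range (fun j => φ (sv A j ^ 2)), Fintype.card_fin]

lemma prod_gram_eigenvalues {n : ℕ} {M : Type*} [CommMonoid M]
    (A : Matrix (Fin n) (Fin n) ℂ) (φ : ℝ → M) :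
    ∏ i, φ ((gram_isHermitian A).eigenvalues i) = ∏ j ∈ Finset.range n, φ (sv A j ^ 2) :=
  sum_gram_eigenvalues (M := Additive M) A φ

/-- Unitary diagonalization of the shifted Gram matrix. -/
lemma gram_add_smul_eq {n : ℕ} (A : Matrix (Fin n) (Fin n) ℂ) (w : ℂ) :
    A.conjTranspose * A + w • 1 =
      ((gram_isHermitian A).eigenvectorUnitary : Matrix (Fin n) (Fin n) ℂ) *
        Matrix.diagonal (fun i => ((gram_isHermitian A).eigenvalues i : ℂ) + w) *
        star ((gram_isHermitian A).eigenvectorUnitary : Matrix (Fin n) (Fin n) ℂ) := by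
  set U := (gram_isHermitian A).eigenvectorUnitary
  have h := (gram_isHermitian A).spectral_theorem
  rw [Unitary.conjStarAlgAut_apply] at h
  have h2 : Matrix.diagonal (fun i => ((gram_isHermitian A).eigenvalues i : ℂ) + w)
      = Matrix.diagonal (RCLike.ofReal ∘ (gram_isHermitian A).eigenvalues)
        + w • (1 : Matrix (Fin n) (Fin n) ℂ) := by
    ext i j
    by_cases hij : i = j
    · subst hij; simp
    · simp [hij]
  rw [h2, mul_add, add_mul, ← h]
  simp

lemma det_gram_add {n : ℕ} (A : Matrix (Fin n) (Fin n) ℂ) (w : ℂ) :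
    (A.conjTranspose * A + w • 1).det = ∏ j ∈ Finset.range n, ((sv A j ^ 2 : ℝ) + w) := by
  rw [gram_add_smul_eq, Matrix.det_mul_right_comm,
    Unitary.mul_star_self_of_mem (SetLike.coe_mem _), one_mul, Matrix.det_diagonal]
  exact prod_gram_eigenvalues A (fun x => (x : ℂ) + w)

lemma sv_sq_add_ne_zero {n : ℕ} (A : Matrix (Fin n) (Fin n) ℂ) {w : ℝ} (hw : 0 < w) (j : ℕ) :
    ((sv A j ^ 2 : ℝ) : ℂ) + w ≠ 0 := by
  have := sq_nonneg (sv A j)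
  exact_mod_cast (by positivity : (sv A j ^ 2 + w) ≠ 0)

lemma isUnit_gram_add {n : ℕ} (A : Matrix (Fin n) (Fin n) ℂ) {w : ℝ} (hw : 0 < w) :
    IsUnit (A.conjTranspose * A + (w : ℂ) • 1).det := by
  rw [det_gram_add, isUnit_iff_ne_zero, Finset.prod_ne_zero_iff]
  exact fun j _ => sv_sq_add_ne_zero A hw j

lemma trace_gram_add_inv {n : ℕ} (A : Matrix (Fin n) (Fin n) ℂ) {w : ℝ} (hw : 0 < w) :
    ((A.conjTranspose * A + (w : ℂ) • 1)⁻¹).trace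
      = ((∑ j ∈ Finset.range n, (sv A j ^ 2 + w)⁻¹ : ℝ) : ℂ) := by
  have hU := Unitary.coe_star_mul_self (gram_isHermitian A).eigenvectorUnitary
  set U : Matrix (Fin n) (Fin n) ℂ := ((gram_isHermitian A).eigenvectorUnitary).1 with hUdef
  have hne : ∀ i, ((gram_isHermitian A).eigenvalues i : ℂ) + w ≠ 0 := by
    intro i
    have := Matrix.eigenvalues_conjTranspose_mul_self_nonneg A i
    exact_mod_cast (by positivity : ((gram_isHermitian A).eigenvalues i + w) ≠ 0)
  have hinv : (A.conjTranspose * A + (w : ℂ) • 1)⁻¹ = U *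
      Matrix.diagonal (fun i => (((gram_isHermitian A).eigenvalues i : ℂ) + w)⁻¹) * star U := by
    apply Matrix.inv_eq_left_inv
    rw [gram_add_smul_eq]
    rw [← hUdef]
    calc _ = U * (Matrix.diagonal (fun i => (((gram_isHermitian A).eigenvalues i : ℂ) + w)⁻¹) *
          (star U * U) *
          Matrix.diagonal (fun i => ((gram_isHermitian A).eigenvalues i : ℂ) + w)) * star U := by
          simp only [mul_assoc]
      _ = U * star U := by
          rw [hU, mul_one, Matrix.diagonal_mul_diagonal]
          simp [hne]
      _ = 1 := Unitary.coe_mul_star_self (gram_isHermitian A).eigenvectorUnitary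
  rw [hinv, Matrix.trace_mul_cycle, hU, one_mul, Matrix.trace_diagonal,
    sum_gram_eigenvalues A (fun x => ((x : ℂ) + w)⁻¹)]
  push_cast
  rfl

lemma norm_det_sq {n : ℕ} (A : Matrix (Fin n) (Fin n) ℂ) :
    ‖A.det‖ ^ 2 = ∏ j ∈ Finset.range n, sv A j ^ 2 := by
  have h := det_gram_add A 0
  simp only [zero_smul, add_zero, Matrix.det_mul, Matrix.det_conjTranspose] at h
  have h2 : ((‖A.det‖ ^ 2 : ℝ) : ℂ) = ((∏ j ∈ Finset.range n, sv A j ^ 2 : ℝ) : ℂ) := by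
    rw [Complex.ofReal_prod, ← h]
    push_cast
    exact (Complex.conj_mul' A.det).symm
  exact_mod_cast h2

/-! ### Determinants of positive matrices -/

lemma one_le_det_gram_add_one {n : ℕ} (B : Matrix (Fin n) (Fin n) ℂ) :
    1 ≤ ‖(B.conjTranspose * B + 1).det‖ := by
  have h := det_gram_add B 1
  rw [one_smul] at h
  rw [h, norm_prod]
  refine Finset.one_le_prod fun j _ => ?_
  have := sq_nonneg (sv B j)
  rw [← Complex.ofReal_one, ← Complex.ofReal_add, Complex.norm_real, Real.norm_eq_abs]
  exact le_trans (by linarith) (le_abs_self _)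

/-- For invertible S the sum factors as S*(1 + (CS⁻¹)*(CS⁻¹))S, and the middle factor has
determinant at least 1. For singular S the left side vanishes. -/
lemma norm_det_gram_le {n : ℕ} (S C : Matrix (Fin n) (Fin n) ℂ) :
    ‖(S.conjTranspose * S).det‖ ≤ ‖(S.conjTranspose * S + C.conjTranspose * C).det‖ := by
  by_cases hS : IsUnit S.det
  · have h : S.conjTranspose * S + C.conjTranspose * C
        = S.conjTranspose * ((C * S⁻¹).conjTranspose * (C * S⁻¹) + 1) * S := by
      have h1 : S⁻¹ * S = 1 := Matrix.nonsing_inv_mul S hS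
      have h2 : S.conjTranspose * (S⁻¹).conjTranspose = 1 := by
        rw [← Matrix.conjTranspose_mul, h1, Matrix.conjTranspose_one]
      rw [Matrix.conjTranspose_mul]
      calc _ = S.conjTranspose * S + (S.conjTranspose * (S⁻¹).conjTranspose) * C.conjTranspose
            * C * (S⁻¹ * S) := by rw [h1, h2]; simp
        _ = _ := by noncomm_ring
    rw [h, Matrix.det_mul, Matrix.det_mul, Matrix.det_mul, norm_mul, norm_mul, norm_mul]
    have := one_le_det_gram_add_one (C * S⁻¹)
    calc _ = ‖S.conjTranspose.det‖ * 1 * ‖S.det‖ := by ring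
      _ ≤ _ := by gcongr
  · rw [isUnit_iff_ne_zero, not_not] at hS
    simp [Matrix.det_mul, hS]

/-- The square root is taken on the diagonal of the spectral decomposition. This brings a shifted
Gram matrix into the form required by `norm_det_gram_le`. -/
lemma exists_gram_eq {n : ℕ} (B : Matrix (Fin n) (Fin n) ℂ) {a : ℝ} (ha : 0 ≤ a) :
    ∃ S : Matrix (Fin n) (Fin n) ℂ,
      B.conjTranspose * B + (a : ℂ) • 1 = S.conjTranspose * S := by
  set U : Matrix (Fin n) (Fin n) ℂ := ((gram_isHermitian B).eigenvectorUnitary).1 with hUdef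
  refine ⟨Matrix.diagonal (fun i => ((Real.sqrt ((gram_isHermitian B).eigenvalues i + a) : ℝ) : ℂ))
    * star U, ?_⟩
  rw [Matrix.conjTranspose_mul, Matrix.diagonal_conjTranspose, gram_add_smul_eq, ← hUdef,
    Matrix.star_eq_conjTranspose, Matrix.conjTranspose_conjTranspose, mul_assoc, mul_assoc]
  congr 1
  rw [← mul_assoc, Matrix.diagonal_mul_diagonal]
  congr 2
  funext i
  have h0 : 0 ≤ (gram_isHermitian B).eigenvalues i + a :=
    add_nonneg (Matrix.eigenvalues_conjTranspose_mul_self_nonneg B i) ha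
  simp only [Pi.star_apply, RCLike.star_def, Complex.conj_ofReal]
  rw [← Complex.ofReal_mul, Real.mul_self_sqrt h0]
  push_cast; rfl

lemma norm_det_gram_add {n : ℕ} (A : Matrix (Fin n) (Fin n) ℂ) {w : ℝ} (hw : 0 ≤ w) :
    ‖(A.conjTranspose * A + (w : ℂ) • 1).det‖ = ∏ j ∈ Finset.range n, (sv A j ^ 2 + w) := by
  rw [det_gram_add, norm_prod]
  refine Finset.prod_congr rfl fun j _ => ?_
  rw [← Complex.ofReal_add, Complex.norm_real, Real.norm_eq_abs, abs_of_nonneg]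
  positivity

/-- Comparison of the singular values of `A - α` with those of `A`. -/
lemma prod_sv_sub_smul_le {n : ℕ} (A : Matrix (Fin n) (Fin n) ℂ) (α : ℂ) {a : ℝ} (ha : 0 ≤ a) :
    ∏ j ∈ Finset.range n, (sv (A - α • 1) j ^ 2 + a)
      ≤ ∏ j ∈ Finset.range n, (2 * sv A j ^ 2 + (2 * ‖α‖ ^ 2 + a)) := by
  obtain ⟨S, hS⟩ := exists_gram_eq (A - α • 1) ha
  -- Adding the Gram matrix of A + α can only increase the determinant, and by the parallelogram
  -- identity the cross terms cancel: the sum is 2(A*A + |α|² + a/2).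
  have h := norm_det_gram_le S (A + α • 1)
  rw [← hS, norm_det_gram_add _ ha] at h
  refine h.trans_eq ?_
  have h2 : (A - α • 1).conjTranspose * (A - α • 1) + (a : ℂ) • 1
      + (A + α • 1).conjTranspose * (A + α • 1)
      = (2 : ℂ) • (A.conjTranspose * A + ((‖α‖ ^ 2 + a / 2 : ℝ) : ℂ) • 1) := by
    have h3 : α * star α = ((‖α‖ ^ 2 : ℝ) : ℂ) := by
      push_cast; exact Complex.mul_conj' α
    simp only [Matrix.conjTranspose_add, Matrix.conjTranspose_sub, Matrix.conjTranspose_smul,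
      Matrix.conjTranspose_one, sub_mul, mul_sub, add_mul, mul_add, smul_mul_assoc, mul_smul_comm,
      one_mul, mul_one, smul_smul, smul_add]
    rw [Complex.ofReal_add, Complex.ofReal_div, ← h3]
    push_cast
    module
  rw [h2, Matrix.det_smul, norm_mul, norm_det_gram_add _ (by positivity), Fintype.card_fin,
    norm_pow, Complex.norm_ofNat]
  have h4 : (2 : ℝ) ^ n = ∏ _j ∈ Finset.range n, (2 : ℝ) := by simp
  rw [h4, ← Finset.prod_mul_distrib]
  exact Finset.prod_congr rfl fun j _ => by ring

/-! ### The trace of the resolvent of the hermitization -/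

/-- With G = A*A + w and G' = AA* + w one has AG⁻¹ = G'⁻¹A. Since wG⁻¹ = 1 - A*AG⁻¹ and wG'⁻¹ = 1 -
G'⁻¹AA*, cyclicity of the trace finishes, A being square. -/
lemma trace_gram_conjTranspose_add_inv {n : ℕ} (A : Matrix (Fin n) (Fin n) ℂ) {w : ℝ}
    (hw : 0 < w) :
    ((A * A.conjTranspose + (w : ℂ) • 1)⁻¹).trace
      = ((A.conjTranspose * A + (w : ℂ) • 1)⁻¹).trace := by
  have hG := isUnit_gram_add A hw
  have hG' := isUnit_gram_add A.conjTranspose hw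
  rw [Matrix.conjTranspose_conjTranspose] at hG'
  set G := A.conjTranspose * A + (w : ℂ) • 1 with hGd
  set G' := A * A.conjTranspose + (w : ℂ) • 1 with hGd'
  have h1 : A * G = G' * A := by rw [hGd, hGd']; simp [mul_add, add_mul, mul_assoc]
  have h2 : A * G⁻¹ = G'⁻¹ * A := by
    calc A * G⁻¹ = G'⁻¹ * (G' * A) * G⁻¹ := by
          rw [← mul_assoc, Matrix.nonsing_inv_mul _ hG', one_mul]
      _ = G'⁻¹ * A * (G * G⁻¹) := by rw [← h1]; simp only [mul_assoc]
      _ = _ := by rw [Matrix.mul_nonsing_inv _ hG, mul_one]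
  have h3 : (w : ℂ) • G⁻¹ = 1 - A.conjTranspose * A * G⁻¹ := by
    rw [eq_sub_iff_add_eq, ← Matrix.mul_nonsing_inv _ hG]
    conv_rhs => rw [hGd, add_mul, smul_mul_assoc, one_mul]
    rw [add_comm]
  have h4 : (w : ℂ) • G'⁻¹ = 1 - G'⁻¹ * (A * A.conjTranspose) := by
    rw [eq_sub_iff_add_eq, ← Matrix.nonsing_inv_mul _ hG']
    conv_rhs => rw [hGd', mul_add, mul_smul_comm, mul_one, ← hGd']
    rw [add_comm]
  have h5 : (w : ℂ) * G'⁻¹.trace = (w : ℂ) * G⁻¹.trace := by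
    rw [← smul_eq_mul, ← smul_eq_mul, ← Matrix.trace_smul, ← Matrix.trace_smul, h3, h4,
      Matrix.trace_sub, Matrix.trace_sub, mul_assoc, h2, ← mul_assoc,
      Matrix.trace_mul_comm A.conjTranspose]
  exact mul_left_cancel₀ (by exact_mod_cast hw.ne') h5

/-- (V - iv)(V + iv) = V² + v² is block diagonal with two invertible shifted Gram matrices as
blocks. This gives the resolvent explicitly at z = iv, the only points z that the proof uses. -/
lemma hermitization_inv {n : ℕ} (A : Matrix (Fin n) (Fin n) ℂ) {v : ℝ} (hv : 0 < v) :
    (hermitization A - ((v : ℂ) * Complex.I) • 1) *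
      ((hermitization A + ((v : ℂ) * Complex.I) • 1) *
        Matrix.fromBlocks (A * A.conjTranspose + ((v ^ 2 : ℝ) : ℂ) • 1)⁻¹ 0 0
          (A.conjTranspose * A + ((v ^ 2 : ℝ) : ℂ) • 1)⁻¹) = 1 := by
  have hG := isUnit_gram_add A (pow_pos hv 2)
  have hG' := isUnit_gram_add A.conjTranspose (pow_pos hv 2)
  rw [Matrix.conjTranspose_conjTranspose] at hG'
  have h1 : (hermitization A - ((v : ℂ) * Complex.I) • 1) *
      (hermitization A + ((v : ℂ) * Complex.I) • 1)
      = Matrix.fromBlocks (A * A.conjTranspose + ((v ^ 2 : ℝ) : ℂ) • 1) 0 0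
          (A.conjTranspose * A + ((v ^ 2 : ℝ) : ℂ) • 1) := by
    have h2 : (hermitization A - ((v : ℂ) * Complex.I) • 1) *
      (hermitization A + ((v : ℂ) * Complex.I) • 1) = hermitization A * hermitization A
        + ((v ^ 2 : ℝ) : ℂ) • 1 := by
      have : (v * Complex.I) * (v * Complex.I) = -((v ^ 2 : ℝ) : ℂ) := by
        push_cast; linear_combination (v : ℂ) ^ 2 * Complex.I_sq
      rw [← neg_eq_iff_eq_neg] at this
      rw [← this]
      simp only [sub_mul, mul_add, smul_mul_assoc, mul_smul_comm, one_mul, mul_one]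
      module
    rw [h2, hermitization, Matrix.fromBlocks_multiply, ← Matrix.fromBlocks_one,
      Matrix.fromBlocks_smul, Matrix.fromBlocks_add]
    simp
  rw [← mul_assoc, h1, Matrix.fromBlocks_multiply, Matrix.mul_nonsing_inv _ hG,
    Matrix.mul_nonsing_inv _ hG']
  simp

lemma isUnit_hermitization_sub {n : ℕ} (A : Matrix (Fin n) (Fin n) ℂ) {v : ℝ} (hv : 0 < v) :
    IsUnit (hermitization A - ((v : ℂ) * Complex.I) • 1).det :=
  Matrix.isUnit_det_of_right_inverse (hermitization_inv A hv)

lemma trace_hermitization_inv {n : ℕ} (A : Matrix (Fin n) (Fin n) ℂ) {v : ℝ} (hv : 0 < v) :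
    ((hermitization A - ((v : ℂ) * Complex.I) • 1)⁻¹).trace
      = 2 * (v * Complex.I) * ((∑ j ∈ Finset.range n, (sv A j ^ 2 + v ^ 2)⁻¹ : ℝ) : ℂ) := by
  rw [Matrix.inv_eq_right_inv (hermitization_inv A hv), hermitization, ← Matrix.fromBlocks_one,
      Matrix.fromBlocks_smul, Matrix.fromBlocks_add, Matrix.fromBlocks_multiply,
      Matrix.trace, Fintype.sum_sum_type]
  simp only [Matrix.diag_apply, Matrix.fromBlocks_apply₁₁, Matrix.fromBlocks_apply₂₂]
  change Matrix.trace _ + Matrix.trace _ = _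
  simp only [zero_add, smul_mul_assoc, one_mul, mul_zero, add_zero, smul_zero, Matrix.trace_smul,
    trace_gram_conjTranspose_add_inv A (pow_pos hv 2)]
  rw [trace_gram_add_inv A (pow_pos hv 2), smul_eq_mul]
  ring

/-! ### Rank perturbation -/

lemma matrix_rank_neg {k l : ℕ} (A : Matrix (Fin k) (Fin l) ℂ) : (-A).rank = A.rank := by
  unfold Matrix.rank
  have : (-A).mulVecLin = -A.mulVecLin := by ext; simp
  rw [this, LinearMap.range_neg]

lemma matrix_rank_add_le {k l : ℕ} (A B : Matrix (Fin k) (Fin l) ℂ) :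
    (A + B).rank ≤ A.rank + B.rank := by
  unfold Matrix.rank
  rw [Matrix.mulVecLin_add]
  exact (Submodule.finrank_mono (LinearMap.range_add_le _ _)).trans
    (Submodule.finrank_add_le_finrank_add_finrank _ _)

/-- The trace of an operator equals that of its restriction to its range. In an orthonormal basis of
the range there are as many diagonal entries as the rank, each at most K. -/
lemma norm_trace_le_rank_mul {n : ℕ} (D : Matrix (Fin n) (Fin n) ℂ) {K : ℝ}
    (hD : ∀ x, ‖Matrix.toEuclideanLin D x‖ ≤ K * ‖x‖) : ‖D.trace‖ ≤ D.rank * K := by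
  set T := Matrix.toEuclideanLin D with hT
  have h1 : LinearMap.trace ℂ _ T = D.trace := by
    rw [hT, Matrix.toEuclideanLin, Matrix.toLpLin_eq_toLin, Matrix.trace_toLin_eq]
  rw [← h1, ← LinearMap.trace_restrict_eq_of_forall_mem (LinearMap.range T) T
    (fun x => LinearMap.mem_range_self T x)]
  set b := stdOrthonormalBasis ℂ (LinearMap.range T)
  rw [LinearMap.trace_eq_sum_inner _ b]
  refine (norm_sum_le _ _).trans ?_
  have h5 : Module.finrank ℂ (LinearMap.range T) = D.rank := by
    rw [hT, Matrix.toEuclideanLin, Matrix.toLpLin_eq_toLin]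
    exact (Matrix.rank_eq_finrank_range_toLin D _ _).symm
  refine (Finset.sum_le_card_nsmul _ _ K fun i _ => ?_).trans (by simp [h5])
  · refine (norm_inner_le_norm _ _).trans ?_
    have h3 := hD (b i)
    have h4 : ‖(b i : EuclideanSpace ℂ (Fin n))‖ = 1 := b.orthonormal.1 i
    rw [b.orthonormal.1 i, one_mul]
    rw [h4, mul_one] at h3
    exact h3

/-- For y = G⁻¹x coercivity gives Re⟨y, x⟩ = ‖Ay‖² + w‖y‖² ≥ w‖y‖²; then Cauchy–Schwarz. -/
lemma norm_gram_add_inv_apply_le {n : ℕ} (A : Matrix (Fin n) (Fin n) ℂ) {w : ℝ} (hw : 0 < w)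
    (x : EuclideanSpace ℂ (Fin n)) :
    ‖Matrix.toEuclideanLin (A.conjTranspose * A + (w : ℂ) • 1)⁻¹ x‖ ≤ w⁻¹ * ‖x‖ := by
  set G := A.conjTranspose * A + (w : ℂ) • 1 with hG
  set y := Matrix.toEuclideanLin G⁻¹ x with hy
  have h1 : x = LinearMap.adjoint (Matrix.toEuclideanLin A) (Matrix.toEuclideanLin A y)
      + (w : ℂ) • y := by
    have h2 : Matrix.toEuclideanLin G y = x := by
      rw [hy, ← LinearMap.comp_apply, ← Matrix.toLpLin_mul_same,
        Matrix.mul_nonsing_inv _ (isUnit_gram_add A hw), Matrix.toLpLin_one, LinearMap.id_apply]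
    rw [← h2, hG, map_add, map_smul, Matrix.toLpLin_one, Matrix.toLpLin_mul_same,
      Matrix.toEuclideanLin_conjTranspose_eq_adjoint]
    rfl
  have h3 : w * ‖y‖ ^ 2 ≤ ‖y‖ * ‖x‖ := by
    have h4 : RCLike.re (inner ℂ y x) = ‖Matrix.toEuclideanLin A y‖ ^ 2 + w * ‖y‖ ^ 2 := by
      rw [h1, inner_add_right, LinearMap.adjoint_inner_right, inner_smul_right, map_add,
        inner_self_eq_norm_sq, inner_self_eq_norm_sq_to_K]
      simp [← Complex.ofReal_pow, ← Complex.ofReal_mul]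
    have h5 := (RCLike.re_le_norm (inner ℂ y x)).trans (norm_inner_le_norm y x)
    nlinarith [sq_nonneg ‖Matrix.toEuclideanLin A y‖]
  rcases eq_or_ne ‖y‖ 0 with h0 | h0
  · rw [h0]; positivity
  · have h6 : 0 < ‖y‖ := lt_of_le_of_ne (norm_nonneg _) (Ne.symm h0)
    rw [inv_mul_eq_div, le_div_iff₀ hw]
    nlinarith

open scoped ComplexOrder in
/-- The normalized resolvent trace of the Gram matrix changes little under low rank
perturbations. -/
lemma abs_sum_inv_sub_le {n : ℕ} (A B : Matrix (Fin n) (Fin n) ℂ) {w : ℝ} (hw : 0 < w) :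
    |∑ j ∈ Finset.range n, (sv A j ^ 2 + w)⁻¹ - ∑ j ∈ Finset.range n, (sv B j ^ 2 + w)⁻¹|
      ≤ 4 / w * (A - B).rank := by
  set GA := A.conjTranspose * A + (w : ℂ) • 1 with hGA
  set GB := B.conjTranspose * B + (w : ℂ) • 1 with hGB
  have hA : IsUnit GA.det := isUnit_gram_add A hw
  have hB : IsUnit GB.det := isUnit_gram_add B hw
  -- Resolvent identity. The difference of the Gram matrices is written with two factors B - A, so
  -- its rank is at most 2 rank(A - B); the difference of the inverses has norm at most 2/w.
  -- Together this yields the constant 4/w.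
  have h1 : GA⁻¹ - GB⁻¹ = GA⁻¹ * (B.conjTranspose * (B - A)
      + (B - A).conjTranspose * A) * GB⁻¹ := by
    have h2 : B.conjTranspose * (B - A) + (B - A).conjTranspose * A = GB - GA := by
      rw [hGA, hGB, Matrix.conjTranspose_sub]; noncomm_ring
    rw [h2, mul_sub, sub_mul, Matrix.nonsing_inv_mul _ hA, one_mul, mul_assoc,
      Matrix.mul_nonsing_inv _ hB, mul_one]
  have h3 : ((GA⁻¹ - GB⁻¹).rank : ℝ) ≤ 2 * (A - B).rank := by
    have h4 : (B - A).rank = (A - B).rank := by rw [← neg_sub, matrix_rank_neg]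
    have h5 : (GA⁻¹ - GB⁻¹).rank ≤ (B - A).rank + (B - A).rank := by
      rw [h1]
      refine (Matrix.rank_mul_le_left _ _).trans ((Matrix.rank_mul_le_right _ _).trans ?_)
      refine (matrix_rank_add_le _ _).trans (add_le_add (Matrix.rank_mul_le_right _ _) ?_)
      exact (Matrix.rank_mul_le_left _ _).trans (Matrix.rank_conjTranspose _).le
    rw [h4] at h5
    have : ((GA⁻¹ - GB⁻¹).rank : ℝ) ≤ (((A - B).rank + (A - B).rank : ℕ) : ℝ) := by
      exact_mod_cast h5
    push_cast at this
    linarith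
  have h6 : ‖(GA⁻¹ - GB⁻¹).trace‖ ≤ (GA⁻¹ - GB⁻¹).rank * (2 * w⁻¹) := by
    refine norm_trace_le_rank_mul _ fun x => ?_
    rw [map_sub, LinearMap.sub_apply]
    refine (norm_sub_le _ _).trans ?_
    have := norm_gram_add_inv_apply_le A hw x
    have := norm_gram_add_inv_apply_le B hw x
    linarith
  rw [Matrix.trace_sub, trace_gram_add_inv A hw, trace_gram_add_inv B hw, ← Complex.ofReal_sub,
    Complex.norm_real, Real.norm_eq_abs] at h6
  refine h6.trans ?_
  calc _ ≤ 2 * ((A - B).rank : ℝ) * (2 * w⁻¹) := by gcongr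
    _ = _ := by ring

/-! ### Eigenvalues -/

lemma norm_det_sub_smul {n : ℕ} (A : Matrix (Fin n) (Fin n) ℂ) (α : ℂ) :
    ‖(A - α • 1).det‖ = ‖A.charpoly.eval α‖ := by
  rw [Matrix.eval_charpoly, ← neg_sub, Matrix.det_neg, norm_mul]
  simp [Matrix.smul_one_eq_diagonal]

lemma norm_eval_charpoly {n : ℕ} (A : Matrix (Fin n) (Fin n) ℂ) (α : ℂ) :
    ‖A.charpoly.eval α‖ = (A.charpoly.roots.map fun l => ‖α - l‖).prod := by
  have h := (IsAlgClosed.splits A.charpoly).eq_prod_roots_of_monic A.charpoly_monic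
  conv_lhs => rw [h]
  rw [Polynomial.eval_multiset_prod, Multiset.map_map]
  generalize A.charpoly.roots = s
  induction s using Multiset.induction_on with
  | empty => simp
  | cons a s ih => simpa using Or.inl ih

lemma card_roots_charpoly {n : ℕ} (A : Matrix (Fin n) (Fin n) ℂ) :
    A.charpoly.roots.card = n := by
  rw [← (IsAlgClosed.splits A.charpoly).natDegree_eq_card_roots, Matrix.charpoly_natDegree_eq_dim,
    Fintype.card_fin]

lemma integral_spectralMeasure {n : ℕ} (A : Matrix (Fin n) (Fin n) ℂ) (f : ℂ → ℂ) :
    ∫ w, f w ∂(spectralMeasure A) = (n : ℂ)⁻¹ * (A.charpoly.roots.map f).sum := by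
  have key : ∀ s : Multiset ℂ, Integrable f (s.map fun l => Measure.dirac l).sum ∧
      ∫ w, f w ∂(s.map fun l => Measure.dirac l).sum = (s.map f).sum := by
    intro s
    induction s using Multiset.induction_on with
    | empty => simp
    | cons a s ih =>
      have ha : Integrable f (Measure.dirac a) := integrable_dirac (by simp)
      simp only [Multiset.map_cons, Multiset.sum_cons]
      exact ⟨ha.add_measure ih.1, by rw [integral_add_measure ha ih.1, ih.2, integral_dirac]⟩
  -- For n = 0 the weight is ∞ in `ENNReal`, whose `toReal` is 0, in agreement with (0 : ℂ)⁻¹ = 0.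
  rw [spectralMeasure, integral_smul_measure, (key _).2]
  simp

/-- A logarithmic form of Weyl's inequality between eigenvalues and singular values. -/
lemma sum_posLog_roots_le {n : ℕ} (A : Matrix (Fin n) (Fin n) ℂ) :
    (A.charpoly.roots.map fun l => Real.posLog ‖l‖).sum
      ≤ (1 / 2) * ∑ j ∈ Finset.range n, Real.log (2 * sv A j ^ 2 + 3) := by
  -- Jensen's formula: for the monic characteristic polynomial the sum of log⁺|λ| is the average of
  -- log|det(A - α)| over |α| = 1, so a bound for every such α suffices.
  have h := Polynomial.logMahlerMeasure_eq_log_leadingCoeff_add_sum_log_roots A.charpoly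
  rw [A.charpoly_monic.leadingCoeff, norm_one, Real.log_one, zero_add] at h
  rw [← h, Polynomial.logMahlerMeasure]
  refine Real.circleAverage_mono_on_of_le_circle ?_ ?_
  · exact (AnalyticOnNhd.aeval_polynomial analyticOnNhd_id
      A.charpoly).meromorphicOn.circleIntegrable_log_norm
  · intro α hα
    have hα : ‖α‖ = 1 := by simpa using hα
    rw [← norm_det_sub_smul]
    have h0 : 0 ≤ (1 / 2) * ∑ j ∈ Finset.range n, Real.log (2 * sv A j ^ 2 + 3) := by
      refine mul_nonneg (by norm_num) (Finset.sum_nonneg fun j _ => Real.log_nonneg ?_)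
      nlinarith [sq_nonneg (sv A j)]
    -- At a root the logarithm takes the default value 0, so the bound has to be nonnegative.
    rcases eq_or_ne ‖(A - α • 1).det‖ 0 with h1 | h1
    · rw [h1, Real.log_zero]; exact h0
    have h2 : ‖(A - α • 1).det‖ ^ 2 ≤ ∏ j ∈ Finset.range n, (2 * sv A j ^ 2 + 3) := by
      rw [norm_det_sq]
      -- With a = 1 and |α| = 1 the constant 2|α|² + a equals 3.
      calc _ ≤ ∏ j ∈ Finset.range n, (sv (A - α • 1) j ^ 2 + 1) :=
            Finset.prod_le_prod (fun _ _ => sq_nonneg _) fun _ _ => by linarith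
        _ ≤ _ := (prod_sv_sub_smul_le A α zero_le_one).trans_eq (by rw [hα]; norm_num)
    have h3 := Real.log_le_log (by positivity) h2
    rw [Real.log_pow, Real.log_prod] at h3
    · push_cast at h3; linarith
    · intro j _; nlinarith [sq_nonneg (sv A j)]

/-! ### Variance of functions with bounded block differences -/

section Variance

variable {ι κ : Type*} {E : ι → Type*} [∀ i, MeasurableSpace (E i)]

open Classical in
/-- `mixBlocks b B x y` takes the coordinates with block in `B` from `y`, the others from `x`. -/
def mixBlocks (b : ι → κ) (B : Finset κ) (x y : (i : ι) → E i) : (i : ι) → E i :=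
  fun i => if b i ∈ B then y i else x i

lemma measurable_mixBlocks (b : ι → κ) (B : Finset κ) :
    Measurable fun p : ((i : ι) → E i) × ((i : ι) → E i) => mixBlocks b B p.1 p.2 := by
  classical
  refine measurable_pi_lambda _ fun i => ?_
  by_cases h : b i ∈ B
  · simp only [mixBlocks, h, if_true]
    fun_prop
  · simp only [mixBlocks, h, if_false]
    fun_prop

variable [Fintype ι]

/-- Checked on boxes: each coordinate is read from exactly one of the two independent copies, and in
the other copy it is unconstrained, which contributes a factor 1. -/
lemma map_mixBlocks (μ : (i : ι) → Measure (E i)) [∀ i, IsProbabilityMeasure (μ i)]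
    (b : ι → κ) (B : Finset κ) :
    ((Measure.pi μ).prod (Measure.pi μ)).map (fun p => mixBlocks b B p.1 p.2) = Measure.pi μ := by
  classical
  refine (Measure.pi_eq fun s hs => ?_).symm
  rw [Measure.map_apply (measurable_mixBlocks b B) (MeasurableSet.univ_pi hs)]
  have h : (fun p : ((i : ι) → E i) × ((i : ι) → E i) => mixBlocks b B p.1 p.2) ⁻¹'
      (Set.univ.pi s) = (Set.univ.pi fun i => if b i ∈ B then Set.univ else s i) ×ˢ
        (Set.univ.pi fun i => if b i ∈ B then s i else Set.univ) := by
    ext p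
    simp only [Set.mem_preimage, Set.mem_pi, Set.mem_univ, forall_const, Set.mem_prod, mixBlocks,
      ← forall_and]
    refine forall_congr' fun i => ?_
    by_cases h : b i ∈ B <;> simp [h]
  rw [h, Measure.prod_prod, Measure.pi_pi, Measure.pi_pi, ← Finset.prod_mul_distrib]
  refine Finset.prod_congr rfl fun i _ => ?_
  by_cases h : b i ∈ B <;> simp [h]

variable (μ : (i : ι) → Measure (E i)) [∀ i, IsProbabilityMeasure (μ i)]

/-- The average of `f` over the coordinates with block in `B`. -/
def blockMean (b : ι → κ) (B : Finset κ) (f : ((i : ι) → E i) → ℝ) (x : (i : ι) → E i) : ℝ :=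
  ∫ y, f (mixBlocks b B x y) ∂(Measure.pi μ)

lemma measurable_blockMean (b : ι → κ) (B : Finset κ) {f : ((i : ι) → E i) → ℝ}
    (hf : Measurable f) : Measurable (blockMean μ b B f) :=
  (StronglyMeasurable.integral_prod_right (ν := Measure.pi μ)
    (f := fun x y => f (mixBlocks b B x y))
    (hf.comp (measurable_mixBlocks b B)).stronglyMeasurable).measurable

lemma abs_blockMean_le (b : ι → κ) (B : Finset κ) {f : ((i : ι) → E i) → ℝ} {K : ℝ}
    (hK : ∀ x, |f x| ≤ K) (x : (i : ι) → E i) : |blockMean μ b B f x| ≤ K := by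
  have := norm_integral_le_of_norm_le_const (μ := Measure.pi μ)
    (f := fun y => f (mixBlocks b B x y)) (C := K) (ae_of_all _ fun y => hK _)
  simpa [blockMean] using this

lemma integrable_of_bdd {α : Type*} [MeasurableSpace α] {ν : Measure α} [IsFiniteMeasure ν]
    {f : α → ℝ} (hf : Measurable f) {K : ℝ} (hK : ∀ x, |f x| ≤ K) : Integrable f ν :=
  Integrable.of_bound hf.aestronglyMeasurable K (ae_of_all _ hK)

/-- The averaged coordinates do not enter h, so h passes through the average. This is the
characteristic property of conditional expectation, derived from the invariance under mixing and
Fubini. -/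
lemma integral_mul_blockMean (b : ι → κ) (B : Finset κ) {f h : ((i : ι) → E i) → ℝ}
    (hf : Measurable f) (hh : Measurable h) {K L : ℝ} (hK : ∀ x, |f x| ≤ K) (hL : ∀ x, |h x| ≤ L)
    (hB : ∀ x y, h (mixBlocks b B x y) = h x) :
    ∫ x, f x * h x ∂(Measure.pi μ) = ∫ x, blockMean μ b B f x * h x ∂(Measure.pi μ) := by
  have hK0 : ∀ x, |f x * h x| ≤ K * L := fun x => by
    rw [abs_mul]
    exact mul_le_mul (hK x) (hL x) (abs_nonneg _) ((abs_nonneg _).trans (hK x))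
  calc ∫ x, f x * h x ∂(Measure.pi μ)
      = ∫ p, f (mixBlocks b B p.1 p.2) * h (mixBlocks b B p.1 p.2)
          ∂((Measure.pi μ).prod (Measure.pi μ)) := by
        conv_lhs => rw [← map_mixBlocks μ b B]
        exact integral_map (measurable_mixBlocks b B).aemeasurable
          (hf.mul hh).aestronglyMeasurable
    _ = ∫ x, ∫ y, f (mixBlocks b B x y) * h (mixBlocks b B x y) ∂(Measure.pi μ)
          ∂(Measure.pi μ) :=
        integral_prod _ (integrable_of_bdd
          ((hf.mul hh).comp (measurable_mixBlocks b B)) fun p => hK0 _)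
    _ = _ := by
        refine integral_congr_ae (ae_of_all _ fun x => ?_)
        simp only [hB, blockMean]
        exact integral_mul_const _ _

/-- The variance of a function of independent variables is at most the number of blocks times the
square of the maximal change under modification of one block. -/
lemma variance_le_of_block_diff [Fintype κ] (b : ι → κ) {f : ((i : ι) → E i) → ℝ}
    (hf : Measurable f) {K c : ℝ} (hK : ∀ x, |f x| ≤ K)
    (hc : ∀ k x y, (∀ i, b i ≠ k → x i = y i) → |f x - f y| ≤ c) :
    ∫ x, (f x - ∫ y, f y ∂(Measure.pi μ)) ^ 2 ∂(Measure.pi μ) ≤ Fintype.card κ * c ^ 2 := by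
  classical
  have hm := fun B => measurable_blockMean μ b B hf
  have hbd := fun B => abs_blockMean_le μ b B hK
  -- Blocks are averaged out one at a time. The increments are orthogonal and each is at most c in
  -- absolute value, so each block adds at most c². For the set of all blocks the block mean is the
  -- constant ∫ f.
  have key : ∀ B : Finset κ, ∫ x, (f x - blockMean μ b B f x) ^ 2 ∂(Measure.pi μ)
      ≤ B.card * c ^ 2 := by
    intro B
    induction B using Finset.induction_on with
    | empty =>
      have h0 : ∀ x y : (i : ι) → E i, mixBlocks b ∅ x y = x := fun x y => by
        funext i; simp [mixBlocks]
      simp [blockMean, h0]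
    | insert k B hk ih =>
      set g := blockMean μ b B f with hg
      set g' := blockMean μ b (insert k B) f with hg'
      have hgg : ∀ x, |g x - g' x| ≤ c := by
        intro x
        have hi : ∀ C, Integrable (fun y => f (mixBlocks b C x y)) (Measure.pi μ) := fun C =>
          integrable_of_bdd (hf.comp ((measurable_mixBlocks b C).comp measurable_prodMk_left))
            fun y => hK _
        rw [hg, hg', blockMean, blockMean, ← integral_sub (hi _) (hi _)]
        have := norm_integral_le_of_norm_le_const (μ := Measure.pi μ)
          (f := fun y => f (mixBlocks b B x y) - f (mixBlocks b (insert k B) x y)) (C := c)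
          (ae_of_all _ fun y => by
            refine hc k _ _ fun i hi => ?_
            simp [mixBlocks, hi])
        simpa using this
      -- A mean over at least the blocks in B ignores those coordinates. Hence g - g' is an
      -- admissible factor in `integral_mul_blockMean`, which gives the orthogonality.
      have hmix : ∀ C, B ⊆ C → ∀ x y, blockMean μ b C f (mixBlocks b B x y)
          = blockMean μ b C f x := by
        intro C hC x y
        unfold blockMean
        congr 1
        funext z
        congr 1
        funext i
        by_cases h1 : b i ∈ C
        · simp [mixBlocks, h1]
        · have h2 : b i ∉ B := fun h => h1 (hC h)
          simp [mixBlocks, h1, h2]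
      have horth : ∫ x, (f x - g x) * (g x - g' x) ∂(Measure.pi μ) = 0 := by
        have hL : ∀ x, |g x - g' x| ≤ K + K := fun x =>
          (abs_sub _ _).trans (add_le_add (hbd _ x) (hbd _ x))
        have h1 := integral_mul_blockMean μ b B hf ((hm B).sub (hm (insert k B))) hK hL
          (fun x y => by
            simp only [Pi.sub_apply]
            rw [hmix B subset_rfl, hmix _ (Finset.subset_insert k B)])
        have hKL : ∀ {u : ((i : ι) → E i) → ℝ}, (∀ x, |u x| ≤ K) → ∀ x,
            |u x * (g x - g' x)| ≤ K * (K + K) := fun hu x => by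
          rw [abs_mul]
          exact mul_le_mul (hu x) (hL x) (abs_nonneg _) ((abs_nonneg _).trans (hu x))
        simp_rw [sub_mul (f _)]
        have hj1 : Integrable (fun x => f x * (g x - g' x)) (Measure.pi μ) :=
          integrable_of_bdd (hf.mul ((hm _).sub (hm _))) (hKL hK)
        have hj2 : Integrable (fun x => g x * (g x - g' x)) (Measure.pi μ) :=
          integrable_of_bdd ((hm _).mul ((hm _).sub (hm _))) (hKL (hbd B))
        rw [integral_sub hj1 hj2]
        exact sub_eq_zero.2 h1
      have hsq : ∀ {u v : ((i : ι) → E i) → ℝ}, (∀ x, |u x| ≤ K) → (∀ x, |v x| ≤ K) → ∀ x,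
          |(u x - v x) ^ 2| ≤ (K + K) ^ 2 := fun hu hv x => by
        rw [abs_pow]
        exact pow_le_pow_left₀ (abs_nonneg _) ((abs_sub _ _).trans (add_le_add (hu x) (hv x))) 2
      have hi1 : Integrable (fun x => (f x - g x) ^ 2) (Measure.pi μ) :=
        integrable_of_bdd ((hf.sub (hm _)).pow_const 2) (hsq hK (hbd _))
      have hi2 : Integrable (fun x => (g x - g' x) ^ 2) (Measure.pi μ) :=
        integrable_of_bdd (((hm _).sub (hm _)).pow_const 2) (hsq (hbd _) (hbd _))
      have hi3 : Integrable (fun x => 2 * ((f x - g x) * (g x - g' x))) (Measure.pi μ) :=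
        integrable_of_bdd (((hf.sub (hm _)).mul ((hm _).sub (hm _))).const_mul 2)
          (K := 2 * ((K + K) * (K + K))) fun x => by
            rw [abs_mul, abs_mul, abs_two]
            have h1 := (abs_sub (f x) (g x)).trans (add_le_add (hK x) (hbd B x))
            have h2 := (abs_sub (g x) (g' x)).trans (add_le_add (hbd B x) (hbd _ x))
            have := abs_nonneg (f x - g x)
            gcongr
            exact (abs_nonneg _).trans h1
      calc ∫ x, (f x - g' x) ^ 2 ∂(Measure.pi μ)
          = ∫ x, ((f x - g x) ^ 2 + 2 * ((f x - g x) * (g x - g' x)) + (g x - g' x) ^ 2)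
              ∂(Measure.pi μ) := by congr 1; funext x; ring
        _ = ∫ x, (f x - g x) ^ 2 ∂(Measure.pi μ) + ∫ x, (g x - g' x) ^ 2 ∂(Measure.pi μ) := by
            have hi13 : Integrable (fun x => (f x - g x) ^ 2 + 2 * ((f x - g x) * (g x - g' x)))
                (Measure.pi μ) := hi1.add hi3
            rw [integral_add hi13 hi2, integral_add hi1 hi3, integral_const_mul, horth]
            ring
        _ ≤ B.card * c ^ 2 + c ^ 2 := by
            refine add_le_add ih ?_
            have := norm_integral_le_of_norm_le_const (μ := Measure.pi μ)
              (f := fun x => (g x - g' x) ^ 2) (C := c ^ 2) (ae_of_all _ fun x => by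
                rw [norm_pow]
                exact pow_le_pow_left₀ (abs_nonneg _) (hgg x) 2)
            simpa using (le_abs_self _).trans this
        _ = _ := by rw [Finset.card_insert_of_notMem hk]; push_cast; ring
  have h := key Finset.univ
  have h1 : ∀ x y : (i : ι) → E i, mixBlocks b Finset.univ x y = y := fun x y => by
    funext i; simp [mixBlocks]
  simpa [blockMean, h1] using h

end Variance

/-! ### Partial derivatives -/

section Calculus

variable {m : ℕ} {d : Fin (m + 1) → ℕ}

lemma partialDeriv_eq_fderiv {f : (Entry d → ℂ) → ℂ} (hf : Differentiable ℝ f) (e : Entry d)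
    (c : ℂ) (u : Entry d → ℂ) : partialDeriv e c f u = fderiv ℝ f u (Pi.single e c) := by
  have h1 : (fun t : ℝ => f (u + Pi.single e ((t : ℂ) * c)))
      = fun t : ℝ => f (u + t • (Pi.single e c : Entry d → ℂ)) := by
    funext t
    rw [← Pi.single_smul, Complex.real_smul]
  rw [partialDeriv, h1]
  have h2 : HasDerivAt (fun t : ℝ => u + t • (Pi.single e c : Entry d → ℂ)) (Pi.single e c) 0 := by
    simpa using ((hasDerivAt_id (0 : ℝ)).smul_const (Pi.single e c : Entry d → ℂ)).const_add u
  have h3 : HasFDerivAt f (fderiv ℝ f u) (u + (0 : ℝ) • (Pi.single e c : Entry d → ℂ)) := by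
    simpa using (hf u).hasFDerivAt
  exact (h3.comp_hasDerivAt (0 : ℝ) h2).deriv

lemma contDiff_partialDeriv {f : (Entry d → ℂ) → ℂ} {k : ℕ} (hf : ContDiff ℝ (k + 1) f)
    (e : Entry d) (c : ℂ) : ContDiff ℝ k (partialDeriv e c f) := by
  have h : partialDeriv e c f = fun u => fderiv ℝ f u (Pi.single e c) :=
    funext fun u => partialDeriv_eq_fderiv (hf.differentiable (by simp)) e c u
  rw [h]
  exact (hf.fderiv_right le_rfl).clm_apply contDiff_const

/-- The differential is only real linear, so the complex direction w is split into Re w · 1 + Im w ·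
I. -/
lemma fderiv_single {f : (Entry d → ℂ) → ℂ} (hf : Differentiable ℝ f) (e : Entry d)
    (w : ℂ) (u : Entry d → ℂ) : fderiv ℝ f u (Pi.single e w)
      = w.re * partialDeriv e 1 f u + w.im * partialDeriv e Complex.I f u := by
  rw [partialDeriv_eq_fderiv hf, partialDeriv_eq_fderiv hf, ← Complex.real_smul,
    ← Complex.real_smul, ← map_smul, ← map_smul, ← map_add, ← Pi.single_smul, ← Pi.single_smul,
    ← Pi.single_add, Complex.real_smul, Complex.real_smul, mul_one, Complex.re_add_im]

lemma fderiv_eq_sum {f : (Entry d → ℂ) → ℂ} (hf : Differentiable ℝ f)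
    (v : Entry d → ℂ) (u : Entry d → ℂ) : fderiv ℝ f u v
      = ∑ e, ((v e).re * partialDeriv e 1 f u + (v e).im * partialDeriv e Complex.I f u) := by
  conv_lhs => rw [← Finset.univ_sum_single v, map_sum]
  exact Finset.sum_congr rfl fun e _ => fderiv_single hf e (v e) u

lemma update_eq_add_single (e : Entry d) (u : Entry d → ℂ) (w : ℂ) :
    Function.update u e w = Function.update u e 0 + Pi.single e w := by
  funext a
  by_cases h : a = e
  · subst h; simp
  · simp [h]

lemma hasDerivAt_update {f : (Entry d → ℂ) → ℂ} (hf : Differentiable ℝ f) (e : Entry d)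
    (w : ℂ) (u : Entry d → ℂ) (s : ℝ) :
    HasDerivAt (fun s : ℝ => f (Function.update u e ((s : ℂ) * w)))
      (w.re * partialDeriv e 1 f (Function.update u e ((s : ℂ) * w))
        + w.im * partialDeriv e Complex.I f (Function.update u e ((s : ℂ) * w))) s := by
  rw [← fderiv_single hf]
  have h2 : HasDerivAt (fun t : ℝ => Function.update u e ((t : ℂ) * w)) (Pi.single e w) s := by
    have h1 : (fun t : ℝ => Function.update u e ((t : ℂ) * w))
        = fun t : ℝ => Function.update u e 0 + t • (Pi.single e w : Entry d → ℂ) := by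
      funext t
      rw [update_eq_add_single, ← Pi.single_smul, Complex.real_smul]
    rw [h1]
    simpa using ((hasDerivAt_id s).smul_const (Pi.single e w : Entry d → ℂ)).const_add
      (Function.update u e 0)
  exact (hf _).hasFDerivAt.comp_hasDerivAt s h2

lemma continuous_update_mul (e : Entry d) (w : ℂ) (u : Entry d → ℂ) :
    Continuous fun s : ℝ => Function.update u e ((s : ℂ) * w) :=
  continuous_const.update e (Complex.continuous_ofReal.mul continuous_const)

/-- Fundamental theorem of calculus along s ↦ s w in one entry. The integral over s is the origin of
the uniform variable θ in the derivative conditions. -/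
lemma sub_eq_integral_partialDeriv {f : (Entry d → ℂ) → ℂ} (hf : ContDiff ℝ 1 f) (e : Entry d)
    (w : ℂ) (u : Entry d → ℂ) :
    f (Function.update u e w) - f (Function.update u e 0)
      = ∫ s in Set.Icc (0 : ℝ) 1,
        (w.re * partialDeriv e 1 f (Function.update u e ((s : ℂ) * w))
          + w.im * partialDeriv e Complex.I f (Function.update u e ((s : ℂ) * w))) := by
  have hc : ∀ c, Continuous (partialDeriv e c f) := fun c =>
    (contDiff_partialDeriv (k := 0) (by simpa using hf) e c).continuous
  have hcont : Continuous fun s : ℝ =>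
      (w.re * partialDeriv e 1 f (Function.update u e ((s : ℂ) * w))
          + w.im * partialDeriv e Complex.I f (Function.update u e ((s : ℂ) * w))) :=
    (continuous_const.mul ((hc 1).comp (continuous_update_mul e w u))).add
      (continuous_const.mul ((hc Complex.I).comp (continuous_update_mul e w u)))
  have h := intervalIntegral.integral_eq_sub_of_hasDerivAt
    (fun s _ => hasDerivAt_update (hf.differentiable one_ne_zero) e w u s)
    (hcont.intervalIntegrable 0 1)
  rw [integral_Icc_eq_integral_Ioc, ← intervalIntegral.integral_of_le zero_le_one, h]
  simp

end Calculus

/-! ### Averages over bounded random points -/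

section Mean

variable {Ω : Type*} [MeasurableSpace Ω] (P : Measure Ω) [IsProbabilityMeasure P]
  {m : ℕ} {d : Fin (m + 1) → ℕ} (Z : Ω → Entry d → ℂ) (e : Entry d)

/-- Expectation of `G` at the random point `Z` with the entry `e` replaced by `w`. -/
def entryMean (G : (Entry d → ℂ) → ℂ) (w : ℂ) : ℂ :=
  ∫ ω, G (Function.update (Z ω) e w) ∂P

/-- Expectation of `G` at the random point `Z` with the entry `e` replaced by `θ w`, where `θ` is
uniform on the unit interval. -/
def entryUnifMean (G : (Entry d → ℂ) → ℂ) (w : ℂ) : ℂ :=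
  ∫ p : ℝ × Ω, G (Function.update (Z p.2) e ((p.1 : ℂ) * w))
    ∂((volume.restrict (Set.Icc (0 : ℝ) 1)).prod P)

instance isProbabilityMeasure_restrict_Icc :
    IsProbabilityMeasure (volume.restrict (Set.Icc (0 : ℝ) 1)) :=
  ⟨by simp⟩

variable {P Z}

-- All points in question lie in one compact ball. Continuity thus gives boundedness, and
-- integrability needs no growth condition on G.
omit [MeasurableSpace Ω] in
lemma exists_bound_update {R : ℝ} (hR : ∀ ω, ‖Z ω‖ ≤ R) {G : (Entry d → ℂ) → ℂ}
    (hG : Continuous G) (r : ℝ) :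
    ∃ K, ∀ ω, ∀ w : ℂ, ‖w‖ ≤ r → ‖G (Function.update (Z ω) e w)‖ ≤ K := by
  obtain ⟨K, hK⟩ := (isCompact_closedBall (0 : Entry d → ℂ) (max R r)).exists_bound_of_continuousOn
    hG.continuousOn
  refine ⟨K, fun ω w hw => hK _ ?_⟩
  rw [mem_closedBall_zero_iff, pi_norm_le_iff_of_nonneg
    (le_max_of_le_left ((norm_nonneg _).trans (hR ω)))]
  intro a
  by_cases h : a = e
  · subst h; simpa using Or.inr hw
  · simpa [h] using Or.inl ((norm_le_pi_norm (Z ω) a).trans (hR ω))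

lemma measurable_update_pair (hZ : Measurable Z) {f : Ω → ℂ} (hf : Measurable f) :
    Measurable fun ω => Function.update (Z ω) e (f ω) := by
  refine measurable_pi_lambda _ fun a => ?_
  by_cases h : a = e
  · subst h; simpa using hf
  · simp only [Function.update_of_ne h]
    exact (measurable_pi_apply a).comp hZ

lemma integrable_update_prod (hZ : Measurable Z) {R : ℝ} (hR : ∀ ω, ‖Z ω‖ ≤ R)
    {G : (Entry d → ℂ) → ℂ} (hG : Continuous G) (w : ℂ) :
    Integrable (fun p : ℝ × Ω => G (Function.update (Z p.2) e ((p.1 : ℂ) * w)))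
      ((volume.restrict (Set.Icc (0 : ℝ) 1)).prod P) := by
  obtain ⟨K, hK⟩ := exists_bound_update e hR hG ‖w‖
  have hmeas : Measurable fun p : ℝ × Ω => G (Function.update (Z p.2) e ((p.1 : ℂ) * w)) :=
    hG.measurable.comp (measurable_update_pair e (hZ.comp measurable_snd)
      ((Complex.measurable_ofReal.comp measurable_fst).mul_const w))
  refine Integrable.of_bound hmeas.aestronglyMeasurable K ?_
  have h1 : ∀ᵐ p : ℝ × Ω ∂((volume.restrict (Set.Icc (0 : ℝ) 1)).prod P),
      p.1 ∈ Set.Icc (0 : ℝ) 1 :=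
    Measure.quasiMeasurePreserving_fst.ae (ae_restrict_mem measurableSet_Icc)
  filter_upwards [h1] with p hp
  refine hK _ _ ?_
  rw [norm_mul, Complex.norm_real, Real.norm_eq_abs, abs_of_nonneg hp.1]
  exact mul_le_of_le_one_left (norm_nonneg _) hp.2

lemma integrable_update (hZ : Measurable Z) {R : ℝ} (hR : ∀ ω, ‖Z ω‖ ≤ R)
    {G : (Entry d → ℂ) → ℂ} (hG : Continuous G) (w : ℂ) :
    Integrable (fun ω => G (Function.update (Z ω) e w)) P := by
  obtain ⟨K, hK⟩ := exists_bound_update e hR hG ‖w‖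
  exact Integrable.of_bound
    (hG.measurable.comp (measurable_update_pair e hZ measurable_const)).aestronglyMeasurable K
    (ae_of_all _ fun ω => hK ω w le_rfl)

lemma entryUnifMean_eq (hZ : Measurable Z) {R : ℝ} (hR : ∀ ω, ‖Z ω‖ ≤ R)
    {G : (Entry d → ℂ) → ℂ} (hG : Continuous G) (w : ℂ) :
    entryUnifMean P Z e G w = ∫ s in Set.Icc (0 : ℝ) 1, entryMean P Z e G ((s : ℂ) * w) :=
  integral_prod _ (integrable_update_prod e hZ hR hG w)

/-- At w = 0 the parameter θ has no effect. Bounds for θ-averages therefore also bound the Taylor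
coefficients at 0. -/
lemma entryUnifMean_zero (hZ : Measurable Z) {R : ℝ} (hR : ∀ ω, ‖Z ω‖ ≤ R)
    {G : (Entry d → ℂ) → ℂ} (hG : Continuous G) :
    entryUnifMean P Z e G 0 = entryMean P Z e G 0 := by
  rw [entryUnifMean_eq e hZ hR hG]
  simp

/-- Fubini for `sub_eq_integral_partialDeriv`: differences of means need only θ-averages of
derivatives, never pointwise bounds. -/
lemma entryMean_sub (hZ : Measurable Z) {R : ℝ} (hR : ∀ ω, ‖Z ω‖ ≤ R)
    {G : (Entry d → ℂ) → ℂ} (hG : ContDiff ℝ 1 G) (w : ℂ) :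
    entryMean P Z e G w - entryMean P Z e G 0
      = w.re * entryUnifMean P Z e (partialDeriv e 1 G) w
        + w.im * entryUnifMean P Z e (partialDeriv e Complex.I G) w := by
  have hc : ∀ c, Continuous (partialDeriv e c G) := fun c =>
    (contDiff_partialDeriv (k := 0) (by simpa using hG) e c).continuous
  have hi := fun c => integrable_update_prod (P := P) e hZ hR (hc c) w
  rw [entryMean, entryMean, ← integral_sub (integrable_update e hZ hR hG.continuous w)
    (integrable_update e hZ hR hG.continuous 0)]
  simp_rw [sub_eq_integral_partialDeriv hG e w]
  rw [entryUnifMean, entryUnifMean, ← integral_const_mul, ← integral_const_mul,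
    ← integral_add ((hi 1).const_mul _) ((hi Complex.I).const_mul _)]
  exact (integral_prod_symm _ (((hi 1).const_mul _).add ((hi Complex.I).const_mul _))).symm

lemma norm_re_add_im_le {w a b : ℂ} {A : ℝ} (ha : ‖a‖ ≤ A) (hb : ‖b‖ ≤ A) :
    ‖w.re * a + w.im * b‖ ≤ 2 * ‖w‖ * A := by
  have hA : 0 ≤ A := (norm_nonneg _).trans ha
  have h1 := Complex.abs_re_le_norm w
  have h2 := Complex.abs_im_le_norm w
  calc _ ≤ ‖(w.re : ℂ) * a‖ + ‖(w.im : ℂ) * b‖ := norm_add_le _ _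
    _ = |w.re| * ‖a‖ + |w.im| * ‖b‖ := by simp [Complex.norm_real]
    _ ≤ ‖w‖ * A + ‖w‖ * A := by gcongr
    _ = _ := by ring

lemma continuous_entryMean_mul (hZ : Measurable Z) {R : ℝ} (hR : ∀ ω, ‖Z ω‖ ≤ R)
    {G : (Entry d → ℂ) → ℂ} (hG : Continuous G) (w : ℂ) :
    IntegrableOn (fun s : ℝ => entryMean P Z e G ((s : ℂ) * w)) (Set.Icc (0 : ℝ) 1) :=
  (integrable_update_prod e hZ hR hG w).integral_prod_left

/-- Second order Taylor expansion in one entry, with a remainder controlled by averages over a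
uniform parameter. -/
lemma norm_entryMean_taylor_le (hZ : Measurable Z) {R : ℝ} (hR : ∀ ω, ‖Z ω‖ ≤ R)
    {g : (Entry d → ℂ) → ℂ} (hg : ContDiff ℝ 2 g) (w : ℂ) {A : ℝ}
    (hA : ∀ s ∈ Set.Icc (0 : ℝ) 1, ∀ c₁ ∈ ({1, Complex.I} : Set ℂ),
      ∀ c₂ ∈ ({1, Complex.I} : Set ℂ),
      ‖entryUnifMean P Z e (partialDeriv e c₂ (partialDeriv e c₁ g)) ((s : ℂ) * w)‖ ≤ A) :
    ‖entryMean P Z e g w - (entryMean P Z e g 0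
      + w.re * entryMean P Z e (partialDeriv e 1 g) 0
      + w.im * entryMean P Z e (partialDeriv e Complex.I g) 0)‖ ≤ 4 * ‖w‖ ^ 2 * A := by
  have hc1 : ∀ c, ContDiff ℝ 1 (partialDeriv e c g) := fun c => by
    simpa using contDiff_partialDeriv (k := 1) (by simpa [one_add_one_eq_two] using hg) e c
  -- Applying `entryMean_sub` again at the points s w produces θ-averages of second derivatives
  -- there, hence the parameter s in `hA`. Each of the two applications contributes a factor 2 for
  -- the two real directions.
  have hstep : ∀ c ∈ ({1, Complex.I} : Set ℂ),
      ‖entryUnifMean P Z e (partialDeriv e c g) w - entryMean P Z e (partialDeriv e c g) 0‖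
        ≤ 2 * ‖w‖ * A := by
    intro c hc
    have hint := continuous_entryMean_mul (P := P) e hZ hR (hc1 c).continuous w
    have h0 : entryMean P Z e (partialDeriv e c g) 0
        = ∫ s in Set.Icc (0 : ℝ) 1, entryMean P Z e (partialDeriv e c g) 0 := by simp
    rw [entryUnifMean_eq e hZ hR (hc1 c).continuous, h0, ← integral_sub hint (integrable_const _)]
    have := norm_setIntegral_le_of_norm_le_const (μ := volume) (s := Set.Icc (0 : ℝ) 1)
      (f := fun s : ℝ => entryMean P Z e (partialDeriv e c g) ((s : ℂ) * w)
        - entryMean P Z e (partialDeriv e c g) 0) (C := 2 * ‖w‖ * A) (by simp)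
      (fun s hs => by
        rw [entryMean_sub e hZ hR (hc1 c)]
        have hA0 : 0 ≤ A := (norm_nonneg _).trans (hA s hs c hc c hc)
        refine (norm_re_add_im_le (hA s hs c hc 1 (by simp))
          (hA s hs c hc Complex.I (by simp))).trans ?_
        rw [norm_mul, Complex.norm_real, Real.norm_eq_abs, abs_of_nonneg hs.1]
        have : s * ‖w‖ ≤ ‖w‖ := mul_le_of_le_one_left (norm_nonneg _) hs.2
        gcongr)
    simpa using this
  have h1 := entryMean_sub (P := P) e hZ hR (hg.of_le (by norm_num)) w
  have h2 : entryMean P Z e g w - (entryMean P Z e g 0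
      + w.re * entryMean P Z e (partialDeriv e 1 g) 0
      + w.im * entryMean P Z e (partialDeriv e Complex.I g) 0)
      = w.re * (entryUnifMean P Z e (partialDeriv e 1 g) w
          - entryMean P Z e (partialDeriv e 1 g) 0)
        + w.im * (entryUnifMean P Z e (partialDeriv e Complex.I g) w
          - entryMean P Z e (partialDeriv e Complex.I g) 0) := by
    linear_combination h1
  rw [h2]
  exact (norm_re_add_im_le (hstep 1 (by simp)) (hstep Complex.I (by simp))).trans_eq (by ring)

end Mean

/-! ### Truncation and the interpolating points -/

lemma norm_trunc_le_abs (K : ℝ) (x : ℂ) : ‖trunc K x‖ ≤ |K| := by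
  unfold trunc
  split_ifs with h
  · exact h.trans (le_abs_self K)
  · simp

lemma norm_trunc_le_norm (K : ℝ) (x : ℂ) : ‖trunc K x‖ ≤ ‖x‖ := by
  unfold trunc
  split_ifs with h
  · exact le_rfl
  · simp

lemma measurable_trunc (K : ℝ) : Measurable (trunc K) := by
  unfold trunc
  exact Measurable.ite (measurableSet_le measurable_norm measurable_const) measurable_id
    measurable_const

lemma trunc_mul_trunc (K : ℝ) (x : ℂ) {s : ℝ} (hs : s ∈ Set.Icc (0 : ℝ) 1) :
    trunc K ((s : ℂ) * trunc K x) = s * trunc K x := by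
  by_cases h : ‖x‖ ≤ K
  · have h1 : trunc K x = x := by simp [trunc, h]
    have h2 : ‖(s : ℂ) * x‖ ≤ K := by
      rw [norm_mul, Complex.norm_real, Real.norm_eq_abs, abs_of_nonneg hs.1]
      exact (mul_le_of_le_one_left (norm_nonneg _) hs.2).trans h
    rw [h1, trunc, if_pos h2]
  · have h1 : trunc K x = 0 := by simp [trunc, h]
    rw [h1, mul_zero]
    simp [trunc]

section Interp

variable {m : ℕ} {d : Fin (m + 1) → ℕ} (n : ℕ) (τ φ : ℝ)

/-- The normalization factor `1/√n_q`. -/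
def normFactor (e : Entry d) : ℝ := (Real.sqrt (d e.1.succ))⁻¹

lemma normFactor_nonneg (e : Entry d) : 0 ≤ normFactor e := by
  unfold normFactor; positivity

lemma interp_apply (x y : Entry d → ℂ) (e : Entry d) :
    interp n τ φ x y e = (normFactor e : ℂ) * (trunc (τ * Real.sqrt n) (x e) * (Real.cos φ : ℂ)
      + trunc (τ * Real.sqrt n) (y e) * (Real.sin φ : ℂ)) := by
  rw [interp, scaled, normFactor, div_eq_inv_mul, Complex.ofReal_inv]

lemma interp_congr {x y x' y' : Entry d → ℂ} {e : Entry d} (hx : x e = x' e) (hy : y e = y' e) :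
    interp n τ φ x y e = interp n τ φ x' y' e := by
  rw [interp_apply, interp_apply, hx, hy]

lemma norm_interp_apply_le (x y : Entry d → ℂ) (e : Entry d) :
    ‖interp n τ φ x y e‖ ≤ normFactor e *
      (‖trunc (τ * Real.sqrt n) (x e)‖ + ‖trunc (τ * Real.sqrt n) (y e)‖) := by
  rw [interp_apply, norm_mul, Complex.norm_real, Real.norm_eq_abs,
    abs_of_nonneg (normFactor_nonneg e)]
  refine mul_le_mul_of_nonneg_left ((norm_add_le _ _).trans ?_) (normFactor_nonneg e)
  rw [norm_mul, norm_mul, Complex.norm_real, Complex.norm_real]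
  exact add_le_add (mul_le_of_le_one_right (norm_nonneg _) (Real.abs_cos_le_one φ))
    (mul_le_of_le_one_right (norm_nonneg _) (Real.abs_sin_le_one φ))

lemma exists_norm_interp_le (d : Fin (m + 1) → ℕ) :
    ∃ R : ℝ, ∀ φ, ∀ x y : Entry d → ℂ, ‖interp n τ φ x y‖ ≤ R := by
  have h0 : ∀ e : Entry d, 0 ≤ normFactor e * (|τ * Real.sqrt n| + |τ * Real.sqrt n|) := fun e =>
    mul_nonneg (normFactor_nonneg e) (by positivity)
  refine ⟨∑ e : Entry d, normFactor e * (|τ * Real.sqrt n| + |τ * Real.sqrt n|), fun φ x y => ?_⟩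
  rw [pi_norm_le_iff_of_nonneg (Finset.sum_nonneg fun e _ => h0 e)]
  intro e
  refine le_trans ?_ (Finset.single_le_sum (fun e _ => h0 e) (Finset.mem_univ e))
  exact (norm_interp_apply_le n τ φ x y e).trans (mul_le_mul_of_nonneg_left
    (add_le_add (norm_trunc_le_abs _ _) (norm_trunc_le_abs _ _)) (normFactor_nonneg e))

/-- Shrinking a truncated value keeps it below the truncation level, so the shrunken entry arises
from other inserted values. A supremum over all x, y thus covers the intermediate points of the
Taylor remainder. -/
lemma mul_interp_const (e : Entry d) (x y : ℂ) {s : ℝ} (hs : s ∈ Set.Icc (0 : ℝ) 1) :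
    (s : ℂ) * interp n τ φ (fun _ : Entry d => x) (fun _ : Entry d => y) e
      = interp n τ φ (fun _ : Entry d => (s : ℂ) * trunc (τ * Real.sqrt n) x)
        (fun _ : Entry d => (s : ℂ) * trunc (τ * Real.sqrt n) y) e := by
  rw [interp_apply, interp_apply, trunc_mul_trunc _ _ hs, trunc_mul_trunc _ _ hs]
  ring

/-- Differentiating cosine and sine advances the phase by π/2. The velocity belongs to the same
family of points and obeys the same bounds. -/
lemma hasDerivAt_interp (x y : Entry d → ℂ) :
    HasDerivAt (fun φ => interp n τ φ x y) (interp n τ (φ + Real.pi / 2) x y) φ := by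
  rw [hasDerivAt_pi]
  intro e
  simp_rw [interp_apply]
  rw [Real.cos_add_pi_div_two, Real.sin_add_pi_div_two]
  exact ((((Real.hasDerivAt_cos φ).ofReal_comp).const_mul _).add
    (((Real.hasDerivAt_sin φ).ofReal_comp).const_mul _)).const_mul _

lemma measurable_interp {α : Type*} [MeasurableSpace α] {x y : α → Entry d → ℂ}
    (hx : Measurable x) (hy : Measurable y) : Measurable fun a => interp n τ φ (x a) (y a) := by
  refine measurable_pi_lambda _ fun e => ?_
  simp_rw [interp_apply]
  have h1 := (measurable_trunc (τ * Real.sqrt n)).comp ((measurable_pi_apply e).comp hx)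
  have h2 := (measurable_trunc (τ * Real.sqrt n)).comp ((measurable_pi_apply e).comp hy)
  exact ((h1.mul_const _).add (h2.mul_const _)).const_mul _

end Interp

/-! ### Resampling a block of independent variables -/

section Resample

variable {Ω : Type*} [MeasurableSpace Ω] {P : Measure Ω} [IsProbabilityMeasure P]

/-- By independence the joint law is a product measure, which mixing with an independent copy
preserves. The outer variable ω' carries the block B and ω the rest, so the inner integral plays the
part of a conditional expectation. -/
lemma integral_resample {J κ : Type*} [Fintype J] {ξ : J → Ω → ℂ} (hξ : iIndepFun ξ P)
    (hm : ∀ j, Measurable (ξ j)) (b : J → κ) (B : Finset κ) {H : (J → ℂ) → ℂ} (hH : Measurable H)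
    {K : ℝ} (hK : ∀ x, ‖H x‖ ≤ K) :
    Integrable (fun ω' => ∫ ω, H (mixBlocks b B (fun j => ξ j ω) (fun j => ξ j ω')) ∂P) P ∧
    ∫ ω, H (fun j => ξ j ω) ∂P
      = ∫ ω', ∫ ω, H (mixBlocks b B (fun j => ξ j ω) (fun j => ξ j ω')) ∂P ∂P := by
  have hmξ : Measurable fun ω j => ξ j ω := measurable_pi_lambda _ hm
  have : ∀ j, IsProbabilityMeasure (P.map (ξ j)) := fun j =>
    Measure.isProbabilityMeasure_map (hm j).aemeasurable
  have hlaw : P.map (fun ω j => ξ j ω) = Measure.pi fun j => P.map (ξ j) :=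
    hξ.map_fun_eq_pi_map fun j => (hm j).aemeasurable
  have hprod : (P.prod P).map (fun p : Ω × Ω => ((fun j => ξ j p.1), fun j => ξ j p.2))
      = (Measure.pi fun j => P.map (ξ j)).prod (Measure.pi fun j => P.map (ξ j)) := by
    rw [← hlaw]
    exact (Measure.map_prod_map P P hmξ hmξ).symm
  have hmix := (measurable_mixBlocks (E := fun _ : J => ℂ) b B)
  have hmeas2 : Measurable fun p : Ω × Ω => ((fun j => ξ j p.1), fun j => ξ j p.2) :=
    (hmξ.comp measurable_fst).prodMk (hmξ.comp measurable_snd)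
  have hint : Integrable (fun p : Ω × Ω => H (mixBlocks b B (fun j => ξ j p.1)
      (fun j => ξ j p.2))) (P.prod P) :=
    Integrable.of_bound ((hH.comp hmix).comp hmeas2).aestronglyMeasurable K
      (ae_of_all _ fun p => hK _)
  refine ⟨hint.integral_prod_right, ?_⟩
  rw [← integral_prod_symm _ hint]
  have h1 : ∫ p : Ω × Ω, H (mixBlocks b B (fun j => ξ j p.1) (fun j => ξ j p.2)) ∂(P.prod P)
      = ∫ q, H (mixBlocks b B q.1 q.2) ∂((P.prod P).map
        (fun p : Ω × Ω => ((fun j => ξ j p.1), fun j => ξ j p.2))) :=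
    (integral_map hmeas2.aemeasurable (hH.comp hmix).aestronglyMeasurable).symm
  rw [h1, hprod]
  rw [← integral_map (φ := fun q : (J → ℂ) × (J → ℂ) => mixBlocks b B q.1 q.2) hmix.aemeasurable
    hH.aestronglyMeasurable, map_mixBlocks, ← hlaw,
    integral_map hmξ.aemeasurable hH.aestronglyMeasurable]

end Resample

/-! ### Comparison of expectations -/

/-- Real and imaginary part as real linear maps. -/
def rePart (i : Bool) : ℂ →L[ℝ] ℝ := bif i then Complex.reCLM else Complex.imCLM

/-- The directions `1` and `I`. -/
def dir (i : Bool) : ℂ := bif i then 1 else Complex.I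

lemma dir_mem (i : Bool) : dir i ∈ ({1, Complex.I} : Set ℂ) := by cases i <;> simp [dir]

lemma abs_rePart_le (i : Bool) (x : ℂ) : |rePart i x| ≤ ‖x‖ := by
  cases i
  · exact Complex.abs_im_le_norm x
  · exact Complex.abs_re_le_norm x

lemma rePart_ofReal_mul (i : Bool) (r : ℝ) (x : ℂ) : rePart i ((r : ℂ) * x) = r * rePart i x := by
  rw [← Complex.real_smul, map_smul, smul_eq_mul]

section Moments

variable {Ω : Type*} [MeasurableSpace Ω] {P : Measure Ω} [IsProbabilityMeasure P]

/-- Expanding gives sin φ cos φ (E y₁y₂ - E x₁x₂) plus mixed terms that factor by independence.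
Matching covariances make the first part small, small means the others: velocity and position are
nearly uncorrelated. -/
lemma abs_integral_rotated_le {x₁ x₂ y₁ y₂ : Ω → ℝ} {K : ℝ}
    (hx₁ : Measurable x₁) (hx₂ : Measurable x₂) (hy₁ : Measurable y₁) (hy₂ : Measurable y₂)
    (kx₁ : ∀ ω, |x₁ ω| ≤ K) (kx₂ : ∀ ω, |x₂ ω| ≤ K) (ky₁ : ∀ ω, |y₁ ω| ≤ K)
    (ky₂ : ∀ ω, |y₂ ω| ≤ K) (h12 : IndepFun y₁ x₂ P) (h21 : IndepFun x₁ y₂ P) {a b : ℝ}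
    (ax₁ : |∫ ω, x₁ ω ∂P| ≤ a) (ax₂ : |∫ ω, x₂ ω ∂P| ≤ a) (ay₁ : |∫ ω, y₁ ω ∂P| ≤ a)
    (ay₂ : |∫ ω, y₂ ω ∂P| ≤ a) (hb : |∫ ω, y₁ ω * y₂ ω ∂P - ∫ ω, x₁ ω * x₂ ω ∂P| ≤ b)
    (φ : ℝ) :
    |∫ ω, (x₁ ω * (-Real.sin φ) + y₁ ω * Real.cos φ)
      * (x₂ ω * Real.cos φ + y₂ ω * Real.sin φ) ∂P| ≤ b + 2 * a ^ 2 := by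
  have hK : 0 ≤ K := by
    obtain ⟨ω⟩ := nonempty_of_isProbabilityMeasure P
    exact (abs_nonneg _).trans (kx₁ ω)
  have hi : ∀ {u v : Ω → ℝ}, Measurable u → Measurable v → (∀ ω, |u ω| ≤ K) → (∀ ω, |v ω| ≤ K) →
      Integrable (fun ω => u ω * v ω) P := fun hu hv ku kv =>
    integrable_of_bdd (hu.mul hv) (K := K * K) fun ω => by
      rw [abs_mul]; exact mul_le_mul (ku ω) (kv ω) (abs_nonneg _) hK
  set s := Real.sin φ
  set c := Real.cos φ
  have i1 := (hi hx₁ hx₂ kx₁ kx₂).const_mul (-(s * c))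
  have i2 := (hi hy₁ hy₂ ky₁ ky₂).const_mul (s * c)
  have i3 := (hi hy₁ hx₂ ky₁ kx₂).const_mul (c ^ 2)
  have i4 := (hi hx₁ hy₂ kx₁ ky₂).const_mul (-s ^ 2)
  have h3 : ∫ ω, y₁ ω * x₂ ω ∂P = (∫ ω, y₁ ω ∂P) * ∫ ω, x₂ ω ∂P :=
    h12.integral_fun_mul_eq_mul_integral hy₁.aestronglyMeasurable hx₂.aestronglyMeasurable
  have h4 : ∫ ω, x₁ ω * y₂ ω ∂P = (∫ ω, x₁ ω ∂P) * ∫ ω, y₂ ω ∂P :=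
    h21.integral_fun_mul_eq_mul_integral hx₁.aestronglyMeasurable hy₂.aestronglyMeasurable
  have key : ∫ ω, (x₁ ω * (-s) + y₁ ω * c) * (x₂ ω * c + y₂ ω * s) ∂P
      = s * c * (∫ ω, y₁ ω * y₂ ω ∂P - ∫ ω, x₁ ω * x₂ ω ∂P)
        + c ^ 2 * ((∫ ω, y₁ ω ∂P) * ∫ ω, x₂ ω ∂P)
        - s ^ 2 * ((∫ ω, x₁ ω ∂P) * ∫ ω, y₂ ω ∂P) := by
    have e1 : ∀ ω, (x₁ ω * (-s) + y₁ ω * c) * (x₂ ω * c + y₂ ω * s)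
        = ((-(s * c)) * (x₁ ω * x₂ ω) + (s * c) * (y₁ ω * y₂ ω))
          + (c ^ 2 * (y₁ ω * x₂ ω) + (-s ^ 2) * (x₁ ω * y₂ ω)) := fun ω => by ring
    simp_rw [e1]
    have i12 : Integrable (fun ω => (-(s * c)) * (x₁ ω * x₂ ω) + (s * c) * (y₁ ω * y₂ ω)) P :=
      i1.add i2
    have i34 : Integrable (fun ω => c ^ 2 * (y₁ ω * x₂ ω) + (-s ^ 2) * (x₁ ω * y₂ ω)) P :=
      i3.add i4
    rw [integral_add i12 i34, integral_add i1 i2, integral_add i3 i4, integral_const_mul,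
      integral_const_mul, integral_const_mul, integral_const_mul, h3, h4]
    ring
  have hs : |s| ≤ 1 := Real.abs_sin_le_one φ
  have hc : |c| ≤ 1 := Real.abs_cos_le_one φ
  have ha : 0 ≤ a := (abs_nonneg _).trans ax₁
  rw [key]
  refine (abs_sub _ _).trans ((add_le_add (abs_add_le _ _) le_rfl).trans ?_)
  rw [abs_mul, abs_mul, abs_mul, abs_mul, abs_mul, abs_mul, abs_pow, abs_pow]
  have t1 : |s| * |c| * |∫ ω, y₁ ω * y₂ ω ∂P - ∫ ω, x₁ ω * x₂ ω ∂P| ≤ 1 * 1 * b := by gcongr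
  have t2 : |c| ^ 2 * (|∫ ω, y₁ ω ∂P| * |∫ ω, x₂ ω ∂P|) ≤ 1 ^ 2 * (a * a) := by gcongr
  have t3 : |s| ^ 2 * (|∫ ω, x₁ ω ∂P| * |∫ ω, y₂ ω ∂P|) ≤ 1 ^ 2 * (a * a) := by gcongr
  linarith

end Moments

section Swap

variable {Ω : Type*} [MeasurableSpace Ω] {P : Measure Ω} [IsProbabilityMeasure P]
  {m : ℕ} {d : Fin (m + 1) → ℕ} (n : ℕ) (τ : ℝ) {X Y : Entry d → Ω → ℂ}

/-- The block consisting of the two variables at position `e`. -/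
def isAt (e : Entry d) (j : Entry d ⊕ Entry d) : Bool :=
  decide (j = Sum.inl e ∨ j = Sum.inr e)

lemma interp_mixBlocks (φ : ℝ) (e : Entry d) (x y : Entry d ⊕ Entry d → ℂ) :
    interp n τ φ (fun a => mixBlocks (isAt e) {true} x y (Sum.inl a))
      (fun a => mixBlocks (isAt e) {true} x y (Sum.inr a))
    = Function.update (interp n τ φ (fun a => x (Sum.inl a)) (fun a => x (Sum.inr a))) e
      (interp n τ φ (fun _ : Entry d => y (Sum.inl e)) (fun _ : Entry d => y (Sum.inr e)) e) := by
  funext a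
  by_cases h : a = e
  · subst h
    rw [Function.update_self]
    exact interp_congr n τ φ (by simp [mixBlocks, isAt]) (by simp [mixBlocks, isAt])
  · rw [Function.update_of_ne h]
    exact interp_congr n τ φ (by simp [mixBlocks, isAt, h]) (by simp [mixBlocks, isAt, h])

/-- One summand of the derivative of `E Ψ(Z(φ))`. -/
lemma norm_integral_entry_le (hX : ∀ e, Measurable (X e)) (hY : ∀ e, Measurable (Y e))
    (h_indep : iIndepFun (Sum.elim X Y) P) (φ : ℝ) (e : Entry d)
    {g : (Entry d → ℂ) → ℂ} (hg : ContDiff ℝ 2 g) {A₀ A₁ A₂ : ℝ}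
    (h0 : ∀ x y, ‖condMean P n τ φ X Y e g x y‖ ≤ A₀)
    (h1 : ∀ x y, ∀ c₁ ∈ ({1, Complex.I} : Set ℂ),
      ‖condMean P n τ φ X Y e (partialDeriv e c₁ g) x y‖ ≤ A₁)
    (h2 : ∀ x y, ∀ c₁ ∈ ({1, Complex.I} : Set ℂ), ∀ c₂ ∈ ({1, Complex.I} : Set ℂ),
      ‖condMean P n τ φ X Y e (partialDeriv e c₂ (partialDeriv e c₁ g)) x y‖ ≤ A₂)
    {a b t : ℝ}
    (hax : ∀ i, |∫ ω, rePart i (trunc (τ * Real.sqrt n) (X e ω)) ∂P| ≤ a)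
    (hay : ∀ i, |∫ ω, rePart i (trunc (τ * Real.sqrt n) (Y e ω)) ∂P| ≤ a)
    (hb : ∀ i j, |∫ ω, rePart i (trunc (τ * Real.sqrt n) (Y e ω))
        * rePart j (trunc (τ * Real.sqrt n) (Y e ω)) ∂P
      - ∫ ω, rePart i (trunc (τ * Real.sqrt n) (X e ω))
        * rePart j (trunc (τ * Real.sqrt n) (X e ω)) ∂P| ≤ b)
    (ht : ∫ ω, (‖trunc (τ * Real.sqrt n) (X e ω)‖ + ‖trunc (τ * Real.sqrt n) (Y e ω)‖) ^ 3 ∂P ≤ t)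
    (i : Bool) :
    ‖∫ ω, (rePart i (interp n τ (φ + Real.pi / 2) (fun a => X a ω) (fun a => Y a ω) e) : ℂ)
        * g (interp n τ φ (fun a => X a ω) (fun a => Y a ω)) ∂P‖
      ≤ A₀ * (2 * normFactor e * a) + 2 * A₁ * (normFactor e ^ 2 * (b + 2 * a ^ 2))
        + 4 * A₂ * (normFactor e ^ 3 * t) := by
  set κ := normFactor e with hκ
  have hκ0 : 0 ≤ κ := normFactor_nonneg e
  set Z : Ω → Entry d → ℂ := fun ω => interp n τ φ (fun a => X a ω) (fun a => Y a ω) with hZdef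
  have hXm : Measurable fun ω a => X a ω := measurable_pi_lambda _ hX
  have hYm : Measurable fun ω a => Y a ω := measurable_pi_lambda _ hY
  have hZ : Measurable Z := measurable_interp n τ φ hXm hYm
  obtain ⟨R, hR⟩ := exists_norm_interp_le n τ d
  have hZR : ∀ ω, ‖Z ω‖ ≤ R := fun ω => hR _ _ _
  set W : Ω → ℂ := fun ω => interp n τ φ (fun _ : Entry d => X e ω) (fun _ : Entry d => Y e ω) e
  set W' : Ω → ℂ := fun ω =>
    interp n τ (φ + Real.pi / 2) (fun _ : Entry d => X e ω) (fun _ : Entry d => Y e ω) e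
  have hcm : ∀ (G : (Entry d → ℂ) → ℂ) x y, condMean P n τ φ X Y e G x y
      = entryUnifMean P Z e G
        (interp n τ φ (fun _ : Entry d => x) (fun _ : Entry d => y) e) := fun _ _ _ => rfl
  have hc1 : ∀ c, ContDiff ℝ 1 (partialDeriv e c g) := fun c => by
    simpa using contDiff_partialDeriv (k := 1) (by simpa [one_add_one_eq_two] using hg) e c
  -- Inserting x = y = 0 makes the entry 0, so the hypotheses on `condMean` bound the Taylor
  -- coefficients.
  have hzero : interp n τ φ (fun _ : Entry d => (0 : ℂ)) (fun _ : Entry d => (0 : ℂ)) e = 0 := by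
    rw [interp_apply]; simp [trunc]
  have k0 : ‖entryMean P Z e g 0‖ ≤ A₀ := by
    rw [← entryUnifMean_zero e hZ hZR hg.continuous, ← hzero]
    exact h0 0 0
  have k1 : ∀ i, ‖entryMean P Z e (partialDeriv e (dir i) g) 0‖ ≤ A₁ := fun i => by
    rw [← entryUnifMean_zero e hZ hZR (hc1 _).continuous, ← hzero]
    exact h1 0 0 _ (dir_mem i)
  have hA2 : 0 ≤ A₂ := (norm_nonneg _).trans (h2 0 0 1 (by simp) 1 (by simp))
  have hA1 : 0 ≤ A₁ := (norm_nonneg _).trans (h1 0 0 1 (by simp))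
  have hA0 : 0 ≤ A₀ := (norm_nonneg _).trans (h0 0 0)
  have taylor : ∀ ω, ‖entryMean P Z e g (W ω) - (entryMean P Z e g 0
      + (rePart true (W ω) : ℂ) * entryMean P Z e (partialDeriv e (dir true) g) 0
      + (rePart false (W ω) : ℂ) * entryMean P Z e (partialDeriv e (dir false) g) 0)‖
      ≤ 4 * ‖W ω‖ ^ 2 * A₂ := by
    intro ω
    refine norm_entryMean_taylor_le e hZ hZR hg (W ω) fun s hs c₁ hc₁ c₂ hc₂ => ?_
    rw [mul_interp_const n τ φ e _ _ hs]
    exact h2 _ _ c₁ hc₁ c₂ hc₂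
  -- resampling the entry `e`
  have hξm : ∀ j, Measurable ((Sum.elim X Y) j) := by
    rintro (j | j)
    · exact hX j
    · exact hY j
  obtain ⟨Kg, hKg⟩ := (isCompact_closedBall (0 : Entry d → ℂ) R).exists_bound_of_continuousOn
    hg.continuous.continuousOn
  have hWR : ∀ ψ (x y : Entry d → ℂ), ‖interp n τ ψ x y e‖ ≤ R := fun ψ x y =>
    (norm_le_pi_norm _ e).trans (hR ψ x y)
  have hinl : Measurable fun (ξ : Entry d ⊕ Entry d → ℂ) (a : Entry d) => ξ (Sum.inl a) :=
    measurable_pi_lambda _ fun a => measurable_pi_apply _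
  have hinr : Measurable fun (ξ : Entry d ⊕ Entry d → ℂ) (a : Entry d) => ξ (Sum.inr a) :=
    measurable_pi_lambda _ fun a => measurable_pi_apply _
  obtain ⟨hri, hre⟩ := integral_resample h_indep hξm (isAt e) {true}
    (H := fun ξ => (rePart i (interp n τ (φ + Real.pi / 2) (fun a => ξ (Sum.inl a))
        (fun a => ξ (Sum.inr a)) e) : ℂ)
      * g (interp n τ φ (fun a => ξ (Sum.inl a)) (fun a => ξ (Sum.inr a))))
    ((Complex.measurable_ofReal.comp ((rePart i).continuous.measurable.comp
      ((measurable_pi_apply e).comp (measurable_interp n τ _ hinl hinr)))).mul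
      (hg.continuous.measurable.comp (measurable_interp n τ φ hinl hinr)))
    (K := R * Kg) (fun ξ => by
      rw [norm_mul, Complex.norm_real]
      exact mul_le_mul ((abs_rePart_le i _).trans (hWR _ _ _))
        (hKg _ (mem_closedBall_zero_iff.2 (hR _ _ _))) (norm_nonneg _)
        ((norm_nonneg _).trans (hWR φ 0 0)))
  -- The velocity involves only the resampled variables, so it leaves the inner integral; what
  -- remains is the mean of g with the position W(ω') inserted.
  have hinner : ∀ ω', ∫ ω, (fun ξ : Entry d ⊕ Entry d → ℂ =>
      (rePart i (interp n τ (φ + Real.pi / 2) (fun a => ξ (Sum.inl a))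
        (fun a => ξ (Sum.inr a)) e) : ℂ)
      * g (interp n τ φ (fun a => ξ (Sum.inl a)) (fun a => ξ (Sum.inr a))))
      (mixBlocks (isAt e) {true} (fun j => Sum.elim X Y j ω) (fun j => Sum.elim X Y j ω')) ∂P
      = (rePart i (W' ω') : ℂ) * entryMean P Z e g (W ω') := by
    intro ω'
    simp only [interp_mixBlocks, Function.update_self]
    rw [integral_const_mul]
    rfl
  simp only [hinner] at hri hre
  simp only [Sum.elim_inl, Sum.elim_inr] at hre
  change ‖∫ ω, (rePart i (interp n τ (φ + Real.pi / 2) (fun a => X a ω) (fun a => Y a ω) e) : ℂ)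
        * g (interp n τ φ (fun a => X a ω) (fun a => Y a ω)) ∂P‖ ≤ _
  rw [hre]
  -- the moments of the entry
  have hXYm : ∀ ψ, Measurable fun ω =>
      interp n τ ψ (fun _ : Entry d => X e ω) (fun _ : Entry d => Y e ω) e := fun ψ =>
    (measurable_pi_apply e).comp (measurable_interp n τ ψ
      (measurable_pi_lambda _ fun _ => hX e) (measurable_pi_lambda _ fun _ => hY e))
  have hpm : Measurable fun ω => rePart i (W' ω) :=
    (rePart i).continuous.measurable.comp (hXYm _)
  have hqm : ∀ j, Measurable fun ω => rePart j (W ω) := fun j =>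
    (rePart j).continuous.measurable.comp (hXYm _)
  have hpR : ∀ ω, |rePart i (W' ω)| ≤ R := fun ω => (abs_rePart_le i _).trans (hWR _ _ _)
  have hqR : ∀ j ω, |rePart j (W ω)| ≤ R := fun j ω => (abs_rePart_le j _).trans (hWR _ _ _)
  have hp_int : Integrable (fun ω => rePart i (W' ω)) P := integrable_of_bdd hpm hpR
  have hpq_int : ∀ j, Integrable (fun ω => rePart i (W' ω) * rePart j (W ω)) P := fun j =>
    integrable_of_bdd (hpm.mul (hqm j)) (K := R * R) fun ω => by
      rw [abs_mul]
      exact mul_le_mul (hpR ω) (hqR j ω) (abs_nonneg _) ((abs_nonneg _).trans (hpR ω))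
  set x' : Ω → ℂ := fun ω => trunc (τ * Real.sqrt n) (X e ω) with hx'
  set y' : Ω → ℂ := fun ω => trunc (τ * Real.sqrt n) (Y e ω) with hy'
  have hx'm : Measurable x' := (measurable_trunc _).comp (hX e)
  have hy'm : Measurable y' := (measurable_trunc _).comp (hY e)
  have hrm : ∀ j {u : Ω → ℂ}, Measurable u → Measurable fun ω => rePart j (u ω) := fun j _ hu =>
    (rePart j).continuous.measurable.comp hu
  have hx'K : ∀ j ω, |rePart j (x' ω)| ≤ |τ * Real.sqrt n| := fun j ω =>
    (abs_rePart_le j _).trans (norm_trunc_le_abs _ _)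
  have hy'K : ∀ j ω, |rePart j (y' ω)| ≤ |τ * Real.sqrt n| := fun j ω =>
    (abs_rePart_le j _).trans (norm_trunc_le_abs _ _)
  have hWeq : ∀ j ω, rePart j (W ω)
      = κ * (rePart j (x' ω) * Real.cos φ + rePart j (y' ω) * Real.sin φ) := fun j ω => by
    simp only [W]
    rw [interp_apply, rePart_ofReal_mul, map_add, mul_comm _ (Real.cos φ : ℂ),
      mul_comm _ (Real.sin φ : ℂ), rePart_ofReal_mul, rePart_ofReal_mul]
    ring
  have hW'eq : ∀ j ω, rePart j (W' ω)
      = κ * (rePart j (x' ω) * (-Real.sin φ) + rePart j (y' ω) * Real.cos φ) := fun j ω => by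
    simp only [W']
    rw [interp_apply, Real.cos_add_pi_div_two, Real.sin_add_pi_div_two, rePart_ofReal_mul, map_add,
      mul_comm _ ((-Real.sin φ : ℝ) : ℂ), mul_comm _ (Real.cos φ : ℂ), rePart_ofReal_mul,
      rePart_ofReal_mul]
    ring
  have hmean : |∫ ω, rePart i (W' ω) ∂P| ≤ 2 * κ * a := by
    simp_rw [hW'eq]
    rw [integral_const_mul, integral_add, integral_mul_const, integral_mul_const, abs_mul,
      abs_of_nonneg hκ0]
    · have ha : 0 ≤ a := (abs_nonneg _).trans (hax i)
      have := Real.abs_sin_le_one φ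
      have := Real.abs_cos_le_one φ
      calc _ ≤ κ * (|∫ ω, rePart i (x' ω) ∂P| * |-Real.sin φ|
            + |∫ ω, rePart i (y' ω) ∂P| * |Real.cos φ|) := by
            refine mul_le_mul_of_nonneg_left ((abs_add_le _ _).trans_eq ?_) hκ0
            rw [abs_mul, abs_mul]
        _ ≤ κ * (a * 1 + a * 1) := by
            rw [abs_neg]
            have := hax i
            have := hay i
            gcongr
        _ = _ := by ring
    · exact (integrable_of_bdd (hrm i hx'm) (hx'K i)).mul_const _
    · exact (integrable_of_bdd (hrm i hy'm) (hy'K i)).mul_const _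
  have hindXY : IndepFun (X e) (Y e) P := by
    simpa using h_indep.indepFun (i := Sum.inl e) (j := Sum.inr e) (by simp)
  have hfm : ∀ j, Measurable fun x => rePart j (trunc (τ * Real.sqrt n) x) := fun j =>
    (rePart j).continuous.measurable.comp (measurable_trunc _)
  have hind : ∀ j k, IndepFun (fun ω => rePart j (x' ω)) (fun ω => rePart k (y' ω)) P :=
    fun j k => hindXY.comp (hfm j) (hfm k)
  have hsecond : ∀ j, |∫ ω, rePart i (W' ω) * rePart j (W ω) ∂P| ≤ κ ^ 2 * (b + 2 * a ^ 2) := by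
    intro j
    have e1 : ∀ ω, rePart i (W' ω) * rePart j (W ω) = κ ^ 2 *
      ((rePart i (x' ω) * (-Real.sin φ) + rePart i (y' ω) * Real.cos φ)
        * (rePart j (x' ω) * Real.cos φ + rePart j (y' ω) * Real.sin φ)) := fun ω => by
      rw [hWeq, hW'eq]; ring
    simp_rw [e1]
    rw [integral_const_mul, abs_mul, abs_of_nonneg (by positivity)]
    refine mul_le_mul_of_nonneg_left ?_ (by positivity)
    exact abs_integral_rotated_le (hrm i hx'm) (hrm j hx'm) (hrm i hy'm) (hrm j hy'm)
      (hx'K i) (hx'K j) (hy'K i) (hy'K j) (hind j i).symm (hind i j) (hax i) (hax j) (hay i)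
      (hay j) (hb i j) φ
  -- the Taylor polynomial
  set c0 := entryMean P Z e g 0
  set c1 := entryMean P Z e (partialDeriv e (dir true) g) 0
  set c2 := entryMean P Z e (partialDeriv e (dir false) g) 0
  have hpoly_int : Integrable (fun ω => (rePart i (W' ω) : ℂ) * (c0 + (rePart true (W ω) : ℂ) * c1
      + (rePart false (W ω) : ℂ) * c2)) P := by
    have := ((hp_int.ofReal (𝕜 := ℂ)).mul_const c0).add
      ((((hpq_int true).ofReal (𝕜 := ℂ)).mul_const c1).add
        (((hpq_int false).ofReal (𝕜 := ℂ)).mul_const c2))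
    refine this.congr (ae_of_all _ fun ω => ?_)
    simp only [Pi.add_apply, RCLike.ofReal_mul]
    simp only [Complex.coe_algebraMap]
    ring
  have hpoly : ∫ ω, (rePart i (W' ω) : ℂ) * (c0 + (rePart true (W ω) : ℂ) * c1
      + (rePart false (W ω) : ℂ) * c2) ∂P
      = ((∫ ω, rePart i (W' ω) ∂P : ℝ) : ℂ) * c0
        + (((∫ ω, rePart i (W' ω) * rePart true (W ω) ∂P : ℝ) : ℂ) * c1
          + ((∫ ω, rePart i (W' ω) * rePart false (W ω) ∂P : ℝ) : ℂ) * c2) := by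
    have j0 : Integrable (fun ω => ((rePart i (W' ω) : ℝ) : ℂ) * c0) P :=
      hp_int.ofReal.mul_const c0
    have j1 : Integrable (fun ω => ((rePart i (W' ω) * rePart true (W ω) : ℝ) : ℂ) * c1) P :=
      (hpq_int true).ofReal.mul_const c1
    have j2 : Integrable (fun ω => ((rePart i (W' ω) * rePart false (W ω) : ℝ) : ℂ) * c2) P :=
      (hpq_int false).ofReal.mul_const c2
    have j12 : Integrable (fun ω => ((rePart i (W' ω) * rePart true (W ω) : ℝ) : ℂ) * c1
      + ((rePart i (W' ω) * rePart false (W ω) : ℝ) : ℂ) * c2) P := j1.add j2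
    rw [← integral_complex_ofReal, ← integral_complex_ofReal, ← integral_complex_ofReal,
      ← integral_mul_const, ← integral_mul_const, ← integral_mul_const, ← integral_add j1 j2,
      ← integral_add j0 j12]
    congr 1
    funext ω
    push_cast
    ring
  have hrem : ‖∫ ω, (rePart i (W' ω) : ℂ) * entryMean P Z e g (W ω)
      - (rePart i (W' ω) : ℂ) * (c0 + (rePart true (W ω) : ℂ) * c1
      + (rePart false (W ω) : ℂ) * c2) ∂P‖ ≤ 4 * A₂ * (κ ^ 3 * t) := by
    have hsum_int : Integrable (fun ω => (‖x' ω‖ + ‖y' ω‖) ^ 3) P := by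
      refine integrable_of_bdd ((hx'm.norm.add hy'm.norm).pow_const 3)
        (K := (|τ * Real.sqrt n| + |τ * Real.sqrt n|) ^ 3) fun ω => ?_
      rw [abs_of_nonneg (by positivity)]
      exact pow_le_pow_left₀ (by positivity) (add_le_add (norm_trunc_le_abs _ _)
        (norm_trunc_le_abs _ _)) 3
    have hbound := norm_integral_le_of_norm_le
      (μ := P) (f := fun ω => (rePart i (W' ω) : ℂ) * entryMean P Z e g (W ω)
      - (rePart i (W' ω) : ℂ) * (c0 + (rePart true (W ω) : ℂ) * c1
      + (rePart false (W ω) : ℂ) * c2)) (hsum_int.const_mul (4 * A₂ * κ ^ 3))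
      (ae_of_all _ fun ω => by
        rw [← mul_sub, norm_mul, Complex.norm_real, Real.norm_eq_abs]
        have hw := norm_interp_apply_le n τ φ (fun _ : Entry d => X e ω)
          (fun _ : Entry d => Y e ω) e
        have hw' := norm_interp_apply_le n τ (φ + Real.pi / 2) (fun _ : Entry d => X e ω)
          (fun _ : Entry d => Y e ω) e
        calc _ ≤ (κ * (‖x' ω‖ + ‖y' ω‖)) * (4 * (κ * (‖x' ω‖ + ‖y' ω‖)) ^ 2 * A₂) := by
              refine mul_le_mul ((abs_rePart_le i _).trans hw') ((taylor ω).trans ?_)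
                (norm_nonneg _) (by positivity)
              gcongr
          _ = _ := by ring)
    refine hbound.trans ?_
    rw [integral_const_mul]
    calc _ ≤ 4 * A₂ * κ ^ 3 * t := by gcongr
      _ = _ := by ring
  -- The constant term meets the small mean of the velocity, the linear terms its small covariance
  -- with the position, and the remainder a third absolute moment.
  have hsplit : ∫ ω, (rePart i (W' ω) : ℂ) * entryMean P Z e g (W ω) ∂P
      = ∫ ω, (rePart i (W' ω) : ℂ) * (c0 + (rePart true (W ω) : ℂ) * c1
          + (rePart false (W ω) : ℂ) * c2) ∂P
        + ∫ ω, (rePart i (W' ω) : ℂ) * entryMean P Z e g (W ω)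
      - (rePart i (W' ω) : ℂ) * (c0 + (rePart true (W ω) : ℂ) * c1
      + (rePart false (W ω) : ℂ) * c2) ∂P := by
    rw [integral_sub hri hpoly_int]; ring
  rw [hsplit, hpoly]
  have hab : 0 ≤ κ ^ 2 * (b + 2 * a ^ 2) := (abs_nonneg _).trans (hsecond true)
  have n0 : ‖((∫ ω, rePart i (W' ω) ∂P : ℝ) : ℂ) * c0‖ ≤ A₀ * (2 * κ * a) := by
    rw [norm_mul, Complex.norm_real, Real.norm_eq_abs, mul_comm A₀]
    exact mul_le_mul hmean k0 (norm_nonneg _) ((abs_nonneg _).trans hmean)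
  have n1 : ‖((∫ ω, rePart i (W' ω) * rePart true (W ω) ∂P : ℝ) : ℂ) * c1‖
      ≤ κ ^ 2 * (b + 2 * a ^ 2) * A₁ := by
    rw [norm_mul, Complex.norm_real, Real.norm_eq_abs]
    exact mul_le_mul (hsecond true) (k1 true) (norm_nonneg _) hab
  have n2 : ‖((∫ ω, rePart i (W' ω) * rePart false (W ω) ∂P : ℝ) : ℂ) * c2‖
      ≤ κ ^ 2 * (b + 2 * a ^ 2) * A₁ := by
    rw [norm_mul, Complex.norm_real, Real.norm_eq_abs]
    exact mul_le_mul (hsecond false) (k1 false) (norm_nonneg _) hab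
  refine (norm_add_le _ _).trans (add_le_add ?_ hrem)
  refine (norm_add_le _ _).trans ?_
  have := norm_add_le (((∫ ω, rePart i (W' ω) * rePart true (W ω) ∂P : ℝ) : ℂ) * c1)
    (((∫ ω, rePart i (W' ω) * rePart false (W ω) ∂P : ℝ) : ℂ) * c2)
  linarith

end Swap

/-! ### Summation over all entries along the interpolation path -/

section SwapSum

variable {Ω : Type*} [MeasurableSpace Ω] {P : Measure Ω} [IsProbabilityMeasure P]
  {m : ℕ} {d : Fin (m + 1) → ℕ} (n : ℕ) (τ : ℝ) {X Y : Entry d → Ω → ℂ}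

/-- Lindeberg's replacement of the `X`s by the `Y`s along the interpolation. -/
lemma norm_integral_interp_sub_le (hX : ∀ e, Measurable (X e)) (hY : ∀ e, Measurable (Y e))
    (h_indep : iIndepFun (Sum.elim X Y) P)
    {Ψ : (Entry d → ℂ) → ℂ} (hΨ : ContDiff ℝ 3 Ψ) {A₀ A₁ A₂ : ℝ}
    (hA : ∀ φ ∈ Set.Icc (0 : ℝ) (Real.pi / 2), ∀ e : Entry d, ∀ x y : ℂ,
      ∀ c₀ ∈ ({1, Complex.I} : Set ℂ),
        ‖condMean P n τ φ X Y e (partialDeriv e c₀ Ψ) x y‖ ≤ A₀ ∧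
        ∀ c₁ ∈ ({1, Complex.I} : Set ℂ),
          ‖condMean P n τ φ X Y e (partialDeriv e c₁ (partialDeriv e c₀ Ψ)) x y‖ ≤ A₁ ∧
          ∀ c₂ ∈ ({1, Complex.I} : Set ℂ),
            ‖condMean P n τ φ X Y e (partialDeriv e c₂ (partialDeriv e c₁
              (partialDeriv e c₀ Ψ))) x y‖ ≤ A₂)
    {a b t : Entry d → ℝ}
    (hax : ∀ e i, |∫ ω, rePart i (trunc (τ * Real.sqrt n) (X e ω)) ∂P| ≤ a e)
    (hay : ∀ e i, |∫ ω, rePart i (trunc (τ * Real.sqrt n) (Y e ω)) ∂P| ≤ a e)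
    (hb : ∀ e i j, |∫ ω, rePart i (trunc (τ * Real.sqrt n) (Y e ω))
        * rePart j (trunc (τ * Real.sqrt n) (Y e ω)) ∂P
      - ∫ ω, rePart i (trunc (τ * Real.sqrt n) (X e ω))
        * rePart j (trunc (τ * Real.sqrt n) (X e ω)) ∂P| ≤ b e)
    (ht : ∀ e, ∫ ω, (‖trunc (τ * Real.sqrt n) (X e ω)‖
      + ‖trunc (τ * Real.sqrt n) (Y e ω)‖) ^ 3 ∂P ≤ t e) :
    ‖∫ ω, Ψ (interp n τ (Real.pi / 2) (fun a => X a ω) (fun a => Y a ω)) ∂P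
      - ∫ ω, Ψ (interp n τ 0 (fun a => X a ω) (fun a => Y a ω)) ∂P‖
      ≤ (∑ e, 2 * (A₀ * (2 * normFactor e * a e)
        + 2 * A₁ * (normFactor e ^ 2 * (b e + 2 * a e ^ 2))
        + 4 * A₂ * (normFactor e ^ 3 * t e))) * (Real.pi / 2) := by
  have hΨd : Differentiable ℝ Ψ := hΨ.differentiable (by norm_num)
  set Z : ℝ → Ω → Entry d → ℂ := fun φ ω => interp n τ φ (fun a => X a ω) (fun a => Y a ω)
    with hZdef
  have hXm : Measurable fun ω a => X a ω := measurable_pi_lambda _ hX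
  have hYm : Measurable fun ω a => Y a ω := measurable_pi_lambda _ hY
  have hZ : ∀ φ, Measurable (Z φ) := fun φ => measurable_interp n τ φ hXm hYm
  obtain ⟨R, hR⟩ := exists_norm_interp_le n τ d
  have hZR : ∀ φ ω, ‖Z φ ω‖ ≤ R := fun φ ω => hR _ _ _
  have hR0 : 0 ≤ R := (norm_nonneg _).trans (hR 0 0 0)
  obtain ⟨K₀, hK₀⟩ := (isCompact_closedBall (0 : Entry d → ℂ) R).exists_bound_of_continuousOn
    hΨ.continuous.continuousOn
  obtain ⟨K₁, hK₁⟩ := (isCompact_closedBall (0 : Entry d → ℂ) R).exists_bound_of_continuousOn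
    (hΨ.continuous_fderiv (by norm_num)).continuousOn
  have hg : ∀ e c, ContDiff ℝ 2 (partialDeriv e c Ψ) := fun e c =>
    contDiff_partialDeriv (k := 2) (by
      have : ((2 : ℕ) : WithTop ℕ∞) + 1 = 3 := by norm_num
      rw [this]; exact hΨ) e c
  have hpath : ∀ φ ω, HasDerivAt (fun φ => Ψ (Z φ ω))
      (fderiv ℝ Ψ (Z φ ω) (Z (φ + Real.pi / 2) ω)) φ := fun φ ω =>
    (hΨd _).hasFDerivAt.comp_hasDerivAt φ (hasDerivAt_interp n τ φ _ _)
  have hderivmeas : ∀ φ, Measurable fun ω => fderiv ℝ Ψ (Z φ ω) (Z (φ + Real.pi / 2) ω) :=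
    fun φ => by
      simp_rw [fderiv_eq_sum hΨd]
      refine Finset.measurable_sum _ fun e _ => ?_
      have h1 := fun c => (hg e c).continuous.measurable.comp (hZ φ)
      have h2 := (measurable_pi_apply e).comp (hZ (φ + Real.pi / 2))
      exact ((Complex.measurable_ofReal.comp (Complex.measurable_re.comp h2)).mul (h1 _)).add
        ((Complex.measurable_ofReal.comp (Complex.measurable_im.comp h2)).mul (h1 _))
  -- Positions and velocities stay in the ball of radius R, so `K₁ * R` dominates the derivative for
  -- all φ and ω.
  have hderiv : ∀ φ, HasDerivAt (fun φ => ∫ ω, Ψ (Z φ ω) ∂P)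
      (∫ ω, fderiv ℝ Ψ (Z φ ω) (Z (φ + Real.pi / 2) ω) ∂P) φ := by
    intro φ
    refine (hasDerivAt_integral_of_dominated_loc_of_deriv_le (bound := fun _ => K₁ * R)
      (F := fun φ ω => Ψ (Z φ ω))
      (F' := fun φ ω => fderiv ℝ Ψ (Z φ ω) (Z (φ + Real.pi / 2) ω)) (s := Set.univ)
      Filter.univ_mem ?_ ?_ ?_ ?_ (integrable_const _) ?_).2
    · exact Eventually.of_forall fun ψ =>
        (hΨ.continuous.measurable.comp (hZ ψ)).aestronglyMeasurable
    · exact Integrable.of_bound (hΨ.continuous.measurable.comp (hZ φ)).aestronglyMeasurable K₀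
        (ae_of_all _ fun ω => hK₀ _ (mem_closedBall_zero_iff.2 (hZR φ ω)))
    · exact (hderivmeas φ).aestronglyMeasurable
    · refine ae_of_all _ fun ω ψ _ => ?_
      exact (ContinuousLinearMap.le_opNorm _ _).trans (mul_le_mul
        (hK₁ _ (mem_closedBall_zero_iff.2 (hZR ψ ω))) (hZR _ ω) (norm_nonneg _)
        ((norm_nonneg _).trans (hK₁ _ (mem_closedBall_zero_iff.2 (hZR ψ ω)))))
    · exact ae_of_all _ fun ω ψ _ => hpath ψ ω
  have hbound : ∀ φ ∈ Set.Icc (0 : ℝ) (Real.pi / 2),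
      ‖∫ ω, fderiv ℝ Ψ (Z φ ω) (Z (φ + Real.pi / 2) ω) ∂P‖
      ≤ ∑ e, 2 * (A₀ * (2 * normFactor e * a e)
        + 2 * A₁ * (normFactor e ^ 2 * (b e + 2 * a e ^ 2))
        + 4 * A₂ * (normFactor e ^ 3 * t e)) := by
    intro φ hφ
    have hint : ∀ e i, Integrable (fun ω => (rePart i (Z (φ + Real.pi / 2) ω e) : ℂ)
        * partialDeriv e (dir i) Ψ (Z φ ω)) P := by
      intro e i
      obtain ⟨K, hK⟩ := (isCompact_closedBall (0 : Entry d → ℂ) R).exists_bound_of_continuousOn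
        (hg e (dir i)).continuous.continuousOn
      refine Integrable.of_bound ((Complex.measurable_ofReal.comp
        ((rePart i).continuous.measurable.comp ((measurable_pi_apply e).comp (hZ _)))).mul
        ((hg e _).continuous.measurable.comp (hZ φ))).aestronglyMeasurable (R * K)
        (ae_of_all _ fun ω => ?_)
      rw [norm_mul, Complex.norm_real]
      exact mul_le_mul ((abs_rePart_le i _).trans ((norm_le_pi_norm _ e).trans (hZR _ ω)))
        (hK _ (mem_closedBall_zero_iff.2 (hZR φ ω))) (norm_nonneg _) hR0
    have e1 : ∀ ω, fderiv ℝ Ψ (Z φ ω) (Z (φ + Real.pi / 2) ω)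
        = ∑ e, ((rePart true (Z (φ + Real.pi / 2) ω e) : ℂ)
            * partialDeriv e (dir true) Ψ (Z φ ω)
          + (rePart false (Z (φ + Real.pi / 2) ω e) : ℂ)
            * partialDeriv e (dir false) Ψ (Z φ ω)) := fun ω => fderiv_eq_sum hΨd _ _
    simp_rw [e1]
    have hint2 : ∀ e, Integrable (fun ω => (rePart true (Z (φ + Real.pi / 2) ω e) : ℂ)
        * partialDeriv e (dir true) Ψ (Z φ ω) + (rePart false (Z (φ + Real.pi / 2) ω e) : ℂ)
        * partialDeriv e (dir false) Ψ (Z φ ω)) P := fun e => (hint e true).add (hint e false)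
    rw [integral_finsetSum _ fun e _ => hint2 e]
    refine (norm_sum_le _ _).trans (Finset.sum_le_sum fun e _ => ?_)
    rw [integral_add (hint e true) (hint e false)]
    refine (norm_add_le _ _).trans ?_
    have key := fun i => norm_integral_entry_le n τ hX hY h_indep φ e (hg e (dir i))
      (fun x y => (hA φ hφ e x y _ (dir_mem i)).1)
      (fun x y c₁ h₁ => ((hA φ hφ e x y _ (dir_mem i)).2 c₁ h₁).1)
      (fun x y c₁ h₁ c₂ h₂ => ((hA φ hφ e x y _ (dir_mem i)).2 c₁ h₁).2 c₂ h₂)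
      (hax e) (hay e) (hb e) (ht e) i
    have k1 := key true
    have k2 := key false
    rw [two_mul]
    exact add_le_add k1 k2
  have h := norm_image_sub_le_of_norm_deriv_le_segment' (a := (0 : ℝ)) (b := Real.pi / 2)
    (fun φ _ => (hderiv φ).hasDerivWithinAt)
    (fun φ hφ => hbound φ ⟨hφ.1, hφ.2.le⟩) (Real.pi / 2) ⟨by positivity, le_rfl⟩
  simpa using h

end SwapSum

/-! ### Smoothness of the resolvent trace -/

section Resolvent

variable {m n : ℕ} {d : Fin (m + 1) → ℕ}

lemma contDiff_det {E ι : Type*} [NormedAddCommGroup E] [NormedSpace ℝ E] [Fintype ι]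
    [DecidableEq ι] {k : WithTop ℕ∞} {M : E → Matrix ι ι ℂ}
    (hM : ∀ a b, ContDiff ℝ k fun u => M u a b) : ContDiff ℝ k fun u => (M u).det := by
  simp_rw [Matrix.det_apply']
  exact ContDiff.sum fun σ _ => contDiff_const.mul (contDiff_prod fun i _ => hM _ _)

/-- Cramer's rule: the entries of the inverse are cofactors over a nonvanishing determinant. -/
lemma contDiff_inv_apply {E ι : Type*} [NormedAddCommGroup E] [NormedSpace ℝ E] [Fintype ι]
    [DecidableEq ι] {k : WithTop ℕ∞} {M : E → Matrix ι ι ℂ}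
    (hM : ∀ a b, ContDiff ℝ k fun u => M u a b) (hu : ∀ u, IsUnit (M u).det) (a b : ι) :
    ContDiff ℝ k fun u => (M u)⁻¹ a b := by
  simp_rw [Matrix.inv_def, Ring.inverse_eq_inv', Matrix.smul_apply, smul_eq_mul,
    Matrix.adjugate_apply]
  refine ((contDiff_det hM).inv fun u => (hu u).ne_zero).mul (contDiff_det fun i j => ?_)
  by_cases h : i = b
  · subst h; simpa using contDiff_const
  · simpa [Matrix.updateRow_ne h] using hM i j

/-- Differentiating M M⁻¹ = 1 forces R' = -M⁻¹M'M⁻¹, and the trace is cyclic. -/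
lemma hasDerivAt_trace_inv {ι : Type*} [Fintype ι] [DecidableEq ι] {M : ℝ → Matrix ι ι ℂ}
    {M' R' : Matrix ι ι ℂ} {t : ℝ} (hM : ∀ a b, HasDerivAt (fun s => M s a b) (M' a b) t)
    (hR : ∀ a b, HasDerivAt (fun s => (M s)⁻¹ a b) (R' a b) t) (hu : ∀ s, IsUnit (M s).det) :
    HasDerivAt (fun s => ((M s)⁻¹).trace) (-(M' * ((M t)⁻¹) ^ 2).trace) t := by
  have h1 : HasDerivAt (fun s => ((M s)⁻¹).trace) R'.trace t := by
    simp only [Matrix.trace, Matrix.diag_apply]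
    exact HasDerivAt.fun_sum fun a _ => hR a a
  have h2 : M' * (M t)⁻¹ + M t * R' = 0 := by
    ext a b
    have h3 : HasDerivAt (fun s => (M s * (M s)⁻¹) a b)
        ((M' * (M t)⁻¹ + M t * R') a b) t := by
      simp only [Matrix.mul_apply, Matrix.add_apply, ← Finset.sum_add_distrib]
      exact HasDerivAt.fun_sum fun k _ => (hM a k).mul (hR k b)
    have h4 : (fun s => (M s * (M s)⁻¹) a b) = fun _ => (1 : Matrix ι ι ℂ) a b := by
      funext s; rw [Matrix.mul_nonsing_inv _ (hu s)]
    rw [h4] at h3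
    simpa using h3.unique (hasDerivAt_const t _)
  have h5 : R' = -((M t)⁻¹ * (M' * (M t)⁻¹)) := by
    have h6 : M t * R' = -(M' * (M t)⁻¹) := by rw [eq_neg_iff_add_eq_zero, add_comm]; exact h2
    calc R' = (M t)⁻¹ * (M t * R') := by
          rw [← mul_assoc, Matrix.nonsing_inv_mul _ (hu t), one_mul]
      _ = _ := by rw [h6, mul_neg]
  rw [h5, Matrix.trace_neg, Matrix.trace_mul_comm, mul_assoc, ← pow_two] at h1
  exact h1

variable (F : MatTuple d → Matrix (Fin n) (Fin n) ℂ) (B : Matrix (Fin n) (Fin n) ℂ)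

/-- Minus the trace of the resolvent of the hermitization of `F(Z) + B`. -/
def negResTrace (z : ℂ) (u : Entry d → ℂ) : ℂ :=
  -((hermitization (F (ofEntries u) + B) - z • 1)⁻¹).trace

variable {F}

lemma contDiff_hermitization_apply {k : WithTop ℕ∞}
    (hF : ∀ a b, ContDiff ℝ k fun u : Entry d → ℂ => F (ofEntries u) a b)
    (a b : Fin n ⊕ Fin n) :
    ContDiff ℝ k fun u : Entry d → ℂ => hermitization (F (ofEntries u) + B) a b := by
  have h : ∀ i j, ContDiff ℝ k fun u : Entry d → ℂ => (F (ofEntries u) + B) i j := fun i j =>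
    (hF i j).add contDiff_const
  rcases a with a | a <;> rcases b with b | b
  · simpa [hermitization] using contDiff_const
  · simpa [hermitization] using h a b
  · simp only [hermitization, Matrix.fromBlocks_apply₂₁, Matrix.conjTranspose_apply]
    exact (Complex.conjCLE : ℂ →L[ℝ] ℂ).contDiff.comp (h b a)
  · simpa [hermitization] using contDiff_const

lemma contDiff_resolvent_apply {k : WithTop ℕ∞}
    (hF : ∀ a b, ContDiff ℝ k fun u : Entry d → ℂ => F (ofEntries u) a b) {v : ℝ} (hv : 0 < v)
    (a b : Fin n ⊕ Fin n) :
    ContDiff ℝ k fun u : Entry d → ℂ =>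
      (hermitization (F (ofEntries u) + B) - ((v : ℂ) * Complex.I) • 1)⁻¹ a b := by
  refine contDiff_inv_apply (fun i j => ?_) (fun u => isUnit_hermitization_sub _ hv) a b
  simp only [Matrix.sub_apply]
  exact (contDiff_hermitization_apply B hF i j).sub contDiff_const

lemma contDiff_negResTrace {k : WithTop ℕ∞}
    (hF : ∀ a b, ContDiff ℝ k fun u : Entry d → ℂ => F (ofEntries u) a b) {v : ℝ} (hv : 0 < v) :
    ContDiff ℝ k (negResTrace F B ((v : ℂ) * Complex.I)) := by
  unfold negResTrace
  simp only [Matrix.trace, Matrix.diag_apply]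
  exact (ContDiff.sum fun a _ => contDiff_resolvent_apply B hF hv a a).neg

/-- Since d Tr R = -Tr(dV R²), the sign in `negResTrace` makes g its first partial derivative. The
derivative conditions thus bound averaged derivatives of orders one to three of a single scalar
function. -/
lemma gFun_eq_partialDeriv
    (hF : ∀ a b, ContDiff ℝ 3 fun u : Entry d → ℂ => F (ofEntries u) a b) {v : ℝ} (hv : 0 < v)
    (e : Entry d) (c : ℂ) :
    gFun F B ((v : ℂ) * Complex.I) e c
      = partialDeriv e c (negResTrace F B ((v : ℂ) * Complex.I)) := by
  funext u
  have hcurve : Differentiable ℝ fun t : ℝ => u + (Pi.single e ((t : ℂ) * c) : Entry d → ℂ) := by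
    have h1 : (fun t : ℝ => u + (Pi.single e ((t : ℂ) * c) : Entry d → ℂ))
        = fun t : ℝ => u + t • (Pi.single e c : Entry d → ℂ) := by
      funext t
      rw [← Pi.single_smul, Complex.real_smul]
    rw [h1]
    fun_prop
  have hV : ∀ a b, HasDerivAt (fun t : ℝ => (hermitization (F (ofEntries
      (u + (Pi.single e ((t : ℂ) * c) : Entry d → ℂ))) + B) - ((v : ℂ) * Complex.I) • 1) a b)
      (partialDeriv e c (fun w => hermitization (F (ofEntries w) + B) a b) u) 0 := by
    intro a b
    simp only [Matrix.sub_apply]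
    exact (((contDiff_hermitization_apply B hF a b).differentiable (by norm_num)).comp
      hcurve 0).hasDerivAt.sub_const _
  have hR : ∀ a b, HasDerivAt (fun t : ℝ => (hermitization (F (ofEntries
      (u + (Pi.single e ((t : ℂ) * c) : Entry d → ℂ))) + B) - ((v : ℂ) * Complex.I) • 1)⁻¹ a b)
      (deriv (fun t : ℝ => (hermitization (F (ofEntries
      (u + (Pi.single e ((t : ℂ) * c) : Entry d → ℂ))) + B)
        - ((v : ℂ) * Complex.I) • 1)⁻¹ a b) 0) 0 :=
    fun a b => (((contDiff_resolvent_apply B hF hv a b).differentiable (by norm_num)).comp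
      hcurve 0).hasDerivAt
  have h := (hasDerivAt_trace_inv (M' := Matrix.of fun a b =>
    partialDeriv e c (fun w => hermitization (F (ofEntries w) + B) a b) u)
    (R' := Matrix.of fun a b => deriv (fun t : ℝ => (hermitization (F (ofEntries
      (u + (Pi.single e ((t : ℂ) * c) : Entry d → ℂ))) + B)
        - ((v : ℂ) * Complex.I) • 1)⁻¹ a b) 0)
    hV hR (fun s => isUnit_hermitization_sub _ hv)).neg.deriv
  have h0 : u + (Pi.single e (((0 : ℝ) : ℂ) * c) : Entry d → ℂ) = u := by simp
  rw [neg_neg, h0] at h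
  exact h.symm

end Resolvent

/-! ### Truncated moments -/

section TruncatedMoments

variable {Ω : Type*} [MeasurableSpace Ω] {P : Measure Ω}

/-- The truncated second moment `E |X|² 1{|X| > K}`. -/
def tailMoment (P : Measure Ω) (X : Ω → ℂ) (K : ℝ) : ℝ :=
  ∫ ω, (if K < ‖X ω‖ then ‖X ω‖ ^ 2 else 0) ∂P

variable {X : Ω → ℂ} {K : ℝ}

lemma measurable_tail (hX : Measurable X) (K : ℝ) :
    Measurable fun ω => if K < ‖X ω‖ then ‖X ω‖ ^ 2 else 0 :=
  Measurable.ite (measurableSet_lt measurable_const hX.norm) (hX.norm.pow_const 2)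
    measurable_const

lemma integrable_tail (hX : Measurable X) (h2 : Integrable (fun ω => ‖X ω‖ ^ 2) P) (K : ℝ) :
    Integrable (fun ω => if K < ‖X ω‖ then ‖X ω‖ ^ 2 else 0) P := by
  refine h2.mono (measurable_tail hX K).aestronglyMeasurable (ae_of_all _ fun ω => ?_)
  split_ifs <;> simp

lemma tailMoment_nonneg : 0 ≤ tailMoment P X K :=
  integral_nonneg fun ω => by
    simp only [Pi.zero_apply]
    split_ifs <;> positivity

lemma tailMoment_le (hX : Measurable X) (h2 : Integrable (fun ω => ‖X ω‖ ^ 2) P) :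
    tailMoment P X K ≤ ∫ ω, ‖X ω‖ ^ 2 ∂P :=
  integral_mono (integrable_tail hX h2 K) h2 fun ω => by
    simp only
    split_ifs
    · exact le_rfl
    · positivity

lemma integrable_norm_of_sq [IsProbabilityMeasure P] (hX : Measurable X)
    (h2 : Integrable (fun ω => ‖X ω‖ ^ 2) P) :
    Integrable X P := by
  have : Integrable (fun ω => 1 + ‖X ω‖ ^ 2) P := (integrable_const _).add h2
  refine this.mono hX.aestronglyMeasurable (ae_of_all _ fun ω => ?_)
  rw [Real.norm_eq_abs, abs_of_nonneg (by positivity)]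
  nlinarith [sq_nonneg (‖X ω‖ - 1)]

lemma integrable_rePart_mul (hX : Measurable X) (h2 : Integrable (fun ω => ‖X ω‖ ^ 2) P)
    (i j : Bool) : Integrable (fun ω => rePart i (X ω) * rePart j (X ω)) P := by
  refine h2.mono (((rePart i).continuous.measurable.comp hX).mul
    ((rePart j).continuous.measurable.comp hX)).aestronglyMeasurable (ae_of_all _ fun ω => ?_)
  rw [norm_mul, Real.norm_eq_abs, Real.norm_eq_abs, Real.norm_eq_abs,
    abs_of_nonneg (by positivity : (0 : ℝ) ≤ ‖X ω‖ ^ 2), pow_two]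
  exact mul_le_mul (abs_rePart_le i _) (abs_rePart_le j _) (abs_nonneg _) (norm_nonneg _)

variable [IsProbabilityMeasure P]

/-- The full mean is zero, so only the discarded part counts, and where |X| > K one has |X| ≤
|X|²/K. -/
lemma abs_integral_trunc_le (hX : Measurable X) (h2 : Integrable (fun ω => ‖X ω‖ ^ 2) P)
    (hK : 0 < K) (i : Bool) (h0 : ∫ ω, rePart i (X ω) ∂P = 0) :
    |∫ ω, rePart i (trunc K (X ω)) ∂P| ≤ tailMoment P X K / K := by
  have hi1 : Integrable (fun ω => rePart i (X ω)) P :=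
    (rePart i).integrable_comp (integrable_norm_of_sq hX h2)
  have hi2 : Integrable (fun ω => rePart i (trunc K (X ω))) P :=
    integrable_of_bdd ((rePart i).continuous.measurable.comp ((measurable_trunc K).comp hX))
      fun ω => (abs_rePart_le i _).trans (norm_trunc_le_abs K _)
  have h : ∫ ω, rePart i (trunc K (X ω)) ∂P
      = ∫ ω, (rePart i (trunc K (X ω)) - rePart i (X ω)) ∂P := by
    rw [integral_sub hi2 hi1, h0, sub_zero]
  rw [h, tailMoment, ← integral_div]
  rw [← Real.norm_eq_abs]
  refine norm_integral_le_of_norm_le ((integrable_tail hX h2 K).div_const K)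
    (ae_of_all _ fun ω => ?_)
  by_cases hω : ‖X ω‖ ≤ K
  · simp [trunc, hω, not_lt.2 hω]
  · have h3 := not_le.1 hω
    simp only [trunc, hω, h3, if_true, if_false, map_zero, zero_sub, norm_neg]
    rw [le_div_iff₀ hK, pow_two]
    exact mul_le_mul (abs_rePart_le i _) h3.le hK.le (norm_nonneg _)

lemma abs_integral_sub_trunc_le (hX : Measurable X) (h2 : Integrable (fun ω => ‖X ω‖ ^ 2) P)
    (K : ℝ) (i j : Bool) :
    |∫ ω, rePart i (X ω) * rePart j (X ω) ∂P
      - ∫ ω, rePart i (trunc K (X ω)) * rePart j (trunc K (X ω)) ∂P| ≤ tailMoment P X K := by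
  have hi2 : Integrable (fun ω => rePart i (trunc K (X ω)) * rePart j (trunc K (X ω))) P := by
    refine integrable_rePart_mul ((measurable_trunc K).comp hX) ?_ i j
    refine integrable_of_bdd (((measurable_trunc K).comp hX).norm.pow_const 2) (K := |K| ^ 2)
      fun ω => ?_
    rw [abs_of_nonneg (by positivity)]
    exact pow_le_pow_left₀ (norm_nonneg _) (norm_trunc_le_abs K _) 2
  rw [← integral_sub (integrable_rePart_mul hX h2 i j) hi2]
  rw [← Real.norm_eq_abs]
  refine norm_integral_le_of_norm_le (integrable_tail hX h2 K) (ae_of_all _ fun ω => ?_)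
  by_cases hω : ‖X ω‖ ≤ K
  · simp [trunc, hω, not_lt.2 hω]
  · have h3 := not_le.1 hω
    simp only [trunc, hω, h3, if_true, if_false, map_zero, sub_zero, mul_zero]
    rw [norm_mul, pow_two]
    exact mul_le_mul (abs_rePart_le i _) (abs_rePart_le j _) (norm_nonneg _) (norm_nonneg _)

/-- One factor of the cube is at most 2K and the square of the sum is at most 2(|X|² + |Y|²). -/
lemma integral_trunc_cube_le {Y : Ω → ℂ} (hX : Measurable X) (hY : Measurable Y)
    (h2 : Integrable (fun ω => ‖X ω‖ ^ 2) P) (h2' : Integrable (fun ω => ‖Y ω‖ ^ 2) P)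
    (hK : 0 ≤ K) :
    ∫ ω, (‖trunc K (X ω)‖ + ‖trunc K (Y ω)‖) ^ 3 ∂P
      ≤ 4 * K * (∫ ω, ‖X ω‖ ^ 2 ∂P + ∫ ω, ‖Y ω‖ ^ 2 ∂P) := by
  rw [← integral_add h2 h2', ← integral_const_mul]
  refine integral_mono ?_ ((h2.add h2').const_mul _) fun ω => ?_
  · refine integrable_of_bdd ((((measurable_trunc K).comp hX).norm.add
      ((measurable_trunc K).comp hY).norm).pow_const 3) (K := (|K| + |K|) ^ 3) fun ω => ?_
    rw [abs_of_nonneg (by positivity)]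
    exact pow_le_pow_left₀ (by positivity)
      (add_le_add (norm_trunc_le_abs _ _) (norm_trunc_le_abs _ _)) 3
  · have a1 := norm_trunc_le_abs K (X ω)
    have a2 := norm_trunc_le_abs K (Y ω)
    rw [abs_of_nonneg hK] at a1 a2
    have b1 := norm_trunc_le_norm K (X ω)
    have b2 := norm_trunc_le_norm K (Y ω)
    have n1 := norm_nonneg (trunc K (X ω))
    have n2 := norm_nonneg (trunc K (Y ω))
    calc (‖trunc K (X ω)‖ + ‖trunc K (Y ω)‖) ^ 3
        = (‖trunc K (X ω)‖ + ‖trunc K (Y ω)‖) * (‖trunc K (X ω)‖ + ‖trunc K (Y ω)‖) ^ 2 := by ring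
      _ ≤ (K + K) * (‖X ω‖ + ‖Y ω‖) ^ 2 := by gcongr
      _ ≤ (K + K) * (2 * (‖X ω‖ ^ 2 + ‖Y ω‖ ^ 2)) := by
          gcongr; nlinarith [sq_nonneg (‖X ω‖ - ‖Y ω‖)]
      _ = _ := by ring

lemma integral_indicator_le (hX : Measurable X) (h2 : Integrable (fun ω => ‖X ω‖ ^ 2) P)
    (hK : 0 < K) :
    ∫ ω, (if K < ‖X ω‖ then (1 : ℝ) else 0) ∂P ≤ tailMoment P X K / K ^ 2 := by
  rw [tailMoment, ← integral_div]
  refine integral_mono ?_ ((integrable_tail hX h2 K).div_const _) fun ω => ?_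
  · refine integrable_of_bdd (Measurable.ite (measurableSet_lt measurable_const hX.norm)
      measurable_const measurable_const) (K := 1) fun ω => ?_
    split_ifs <;> simp
  · simp only
    split_ifs with h
    · rw [le_div_iff₀ (by positivity), one_mul]
      exact pow_le_pow_left₀ hK.le h.le 2
    · simp

/-! ### Gaussian variables -/

-- One has y¹⁴/14! ≤ e^|y| ≤ e^y + e^(-y), and a centred Gaussian of variance at most 1 has
-- exponential moments at most e^(1/2) at ±1. The exponent 14 yields tails of order K⁻¹², which is
-- at most n⁻² once K ≥ n^(1/6).
omit [IsProbabilityMeasure P] in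
lemma integral_pow_gaussian_le {Y : Ω → ℝ} (hm : Measurable Y) (hY : HasGaussianLaw Y P)
    (h0 : ∫ ω, Y ω ∂P = 0) (h1 : ∫ ω, Y ω ^ 2 ∂P ≤ 1) :
    Integrable (fun ω => Y ω ^ 14) P ∧
      ∫ ω, Y ω ^ 14 ∂P ≤ 2 * (Nat.factorial 14 * Real.exp (1 / 2)) := by
  have hlaw := hY.map_eq_gaussianReal
  have hvar : Var[Y; P] ≤ 1 := by
    rw [variance_of_integral_eq_zero hm.aemeasurable h0]; exact h1
  have hexp : ∀ t : ℝ, Integrable (fun ω => Real.exp (t * Y ω)) P := fun t => by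
    have := integrable_exp_mul_gaussianReal (μ := P[Y]) (v := Var[Y; P].toNNReal) t
    rw [← hlaw] at this
    exact this.comp_measurable hm
  have hmgf : ∀ t : ℝ, t ^ 2 = 1 → ∫ ω, Real.exp (t * Y ω) ∂P ≤ Real.exp (1 / 2) := fun t ht => by
    have := mgf_gaussianReal hlaw t
    rw [mgf, h0, ht] at this
    rw [this]
    apply Real.exp_le_exp.2
    rw [Real.coe_toNNReal _ (variance_nonneg _ _)]
    linarith
  have hpt : ∀ y : ℝ, y ^ 14 ≤ Nat.factorial 14 * (Real.exp (1 * y) + Real.exp (-1 * y)) := by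
    intro y
    have h := Real.pow_div_factorial_le_exp |y| (abs_nonneg y) 14
    rw [div_le_iff₀ (by positivity), Even.pow_abs (by decide)] at h
    refine h.trans ?_
    rw [mul_comm]
    refine mul_le_mul_of_nonneg_left ?_ (by positivity)
    rw [one_mul, neg_one_mul]
    rcases abs_cases y with h | h <;> rw [h.1]
    · linarith [Real.exp_pos (-y)]
    · linarith [Real.exp_pos y]
  have hdom : Integrable (fun ω => (Nat.factorial 14 : ℝ)
      * (Real.exp (1 * Y ω) + Real.exp (-1 * Y ω))) P := ((hexp 1).add (hexp (-1))).const_mul _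
  have hint : Integrable (fun ω => Y ω ^ 14) P := by
    refine hdom.mono (hm.pow_const 14).aestronglyMeasurable (ae_of_all _ fun ω => ?_)
    rw [Real.norm_eq_abs, Real.norm_eq_abs, abs_of_nonneg (Even.pow_nonneg (by decide) _),
      abs_of_nonneg (by positivity)]
    exact hpt _
  refine ⟨hint, (integral_mono hint hdom fun ω => hpt _).trans ?_⟩
  rw [integral_const_mul, integral_add (hexp 1) (hexp (-1))]
  have := hmgf 1 (by norm_num)
  have := hmgf (-1) (by norm_num)
  calc _ ≤ (Nat.factorial 14 : ℝ) * (Real.exp (1 / 2) + Real.exp (1 / 2)) := by gcongr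
    _ = _ := by ring

/-- The constant in the Gaussian tail bound. -/
def gaussConst : ℝ := 64 * (4 * (Nat.factorial 14 * Real.exp (1 / 2)))

lemma gaussConst_nonneg : 0 ≤ gaussConst := by unfold gaussConst; positivity

omit [IsProbabilityMeasure P] in
lemma tailMoment_gaussian_le {Y : Ω → ℂ} (hm : Measurable Y) (hY : HasGaussianLaw Y P)
    (hre : ∫ ω, (Y ω).re ∂P = 0) (him : ∫ ω, (Y ω).im ∂P = 0)
    (hre2 : ∫ ω, (Y ω).re ^ 2 ∂P ≤ 1) (him2 : ∫ ω, (Y ω).im ^ 2 ∂P ≤ 1) {K : ℝ} (hK : 0 < K) :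
    tailMoment P Y K ≤ gaussConst / K ^ 12 := by
  obtain ⟨i1, b1⟩ := integral_pow_gaussian_le (Complex.measurable_re.comp hm)
    (hY.map_fun Complex.reCLM) hre hre2
  obtain ⟨i2, b2⟩ := integral_pow_gaussian_le (Complex.measurable_im.comp hm)
    (hY.map_fun Complex.imCLM) him him2
  simp only [Function.comp_apply] at i1 i2 b1 b2
  have hpt : ∀ ω, (if K < ‖Y ω‖ then ‖Y ω‖ ^ 2 else 0)
      ≤ (64 * ((Y ω).re ^ 14 + (Y ω).im ^ 14)) / K ^ 12 := by
    intro ω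
    -- Here 64 = 2⁶ comes from (u + v)⁷ ≤ 2⁶(u⁷ + v⁷) with u, v the squared real and imaginary
    -- parts.
    have h14 : ‖Y ω‖ ^ 14 ≤ 64 * ((Y ω).re ^ 14 + (Y ω).im ^ 14) := by
      have e1 : ‖Y ω‖ ^ 14 = ((Y ω).re ^ 2 + (Y ω).im ^ 2) ^ 7 := by
        rw [← Complex.normSq_add_mul_I, Complex.re_add_im, Complex.normSq_eq_norm_sq]; ring
      rw [e1]
      have := add_pow_le (sq_nonneg (Y ω).re) (sq_nonneg (Y ω).im) 7
      calc _ ≤ _ := this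
        _ = _ := by norm_num; ring
    split_ifs with h
    · rw [le_div_iff₀ (by positivity)]
      calc ‖Y ω‖ ^ 2 * K ^ 12 ≤ ‖Y ω‖ ^ 2 * ‖Y ω‖ ^ 12 := by gcongr
        _ = ‖Y ω‖ ^ 14 := by ring
        _ ≤ _ := h14
    · exact div_nonneg ((by positivity : (0 : ℝ) ≤ ‖Y ω‖ ^ 14).trans h14) (by positivity)
  have hint : Integrable (fun ω => (64 * ((Y ω).re ^ 14 + (Y ω).im ^ 14)) / K ^ 12) P :=
    ((i1.add i2).const_mul 64).div_const _
  have hint' : Integrable (fun ω => if K < ‖Y ω‖ then ‖Y ω‖ ^ 2 else 0) P := by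
    refine hint.mono (measurable_tail hm K).aestronglyMeasurable (ae_of_all _ fun ω => ?_)
    have h0 : (0 : ℝ) ≤ if K < ‖Y ω‖ then ‖Y ω‖ ^ 2 else 0 := by split_ifs <;> positivity
    rw [Real.norm_eq_abs, Real.norm_eq_abs, abs_of_nonneg h0, abs_of_nonneg (h0.trans (hpt ω))]
    exact hpt ω
  refine (integral_mono hint' hint hpt).trans ?_
  rw [integral_div, integral_const_mul, integral_add i1 i2, gaussConst]
  gcongr
  linarith

end TruncatedMoments

/-! ### Ranks of differences of matrix tuples -/

section Ranks

variable {m n : ℕ} {d : Fin (m + 1) → ℕ}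

/-- Only one matrix of the tuple changes, and its difference has a single nonzero row. Rows are
therefore the blocks for the variance bound. -/
lemma sum_rank_le_of_eq_off_row {A B : MatTuple d} (q : Fin m) (j : Fin (d q.castSucc))
    (h : ∀ q' j', (⟨q', j'⟩ : (q : Fin m) × Fin (d q.castSucc)) ≠ ⟨q, j⟩ →
      ∀ k, A q' j' k = B q' j' k) :
    ∑ q : Fin m, ((A q - B q).rank : ℝ) ≤ 1 := by
  rw [Finset.sum_eq_single q]
  · have : (A q - B q).rank ≤ ({j} : Finset (Fin (d q.castSucc))).card := by
      refine Matrix.rank_le_card_of_support_subset _ _ fun j' hj' => ?_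
      by_contra hne
      simp only [Finset.coe_singleton, Set.mem_singleton_iff] at hne
      refine hj' (funext fun k => ?_)
      simp [Matrix.row, h q j' (fun hh => hne (by simpa using hh)) k]
    simpa using this
  · intro q' _ hq'
    have : A q' - B q' = 0 := by
      ext j' k
      simp [h q' j' (fun hh => hq' (congrArg Sigma.fst hh)) k]
    simp [this]
  · simp

/-- A rank is at most the number of nonzero rows, and every nonzero row contains a position of S. -/
lemma sum_rank_le_card {A B : MatTuple d} (S : Finset (Entry d))
    (h : ∀ e : Entry d, e ∉ S → A e.1 e.2.1 e.2.2 = B e.1 e.2.1 e.2.2) :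
    ∑ q : Fin m, ((A q - B q).rank : ℝ) ≤ S.card := by
  classical
  have h1 : ∀ q, (A q - B q).rank ≤ ∑ p, if (⟨q, p⟩ : Entry d) ∈ S then 1 else 0 := by
    intro q
    rw [← Finset.card_filter]
    refine le_trans ?_ (Finset.card_image_le (f := Prod.fst))
    refine Matrix.rank_le_card_of_support_subset _ _ fun j hj => ?_
    by_contra hne
    refine hj (funext fun k => ?_)
    have : (⟨q, j, k⟩ : Entry d) ∉ S := fun hS => hne (by simpa using ⟨k, hS⟩)
    simp [Matrix.row, h _ this]
  have h4 : ∑ q, (A q - B q).rank ≤ S.card := by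
    refine (Finset.sum_le_sum fun q _ => h1 q).trans_eq ?_
    rw [← Fintype.sum_sigma' (fun q p => if (⟨q, p⟩ : Entry d) ∈ S then 1 else 0)]
    simp
  exact_mod_cast h4

end Ranks

/-! ### The normalized resolvent trace -/

section ResTr

lemma measurable_det {α ι : Type*} [MeasurableSpace α] [Fintype ι] [DecidableEq ι]
    {M : α → Matrix ι ι ℂ} (hM : ∀ a b, Measurable fun u => M u a b) :
    Measurable fun u => (M u).det := by
  simp_rw [Matrix.det_apply']
  exact Finset.measurable_sum _ fun σ _ =>
    measurable_const.mul (Finset.measurable_prod _ fun i _ => hM _ _)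

lemma measurable_inv_apply {α ι : Type*} [MeasurableSpace α] [Fintype ι] [DecidableEq ι]
    {M : α → Matrix ι ι ℂ} (hM : ∀ a b, Measurable fun u => M u a b) (a b : ι) :
    Measurable fun u => (M u)⁻¹ a b := by
  simp_rw [Matrix.inv_def, Ring.inverse_eq_inv', Matrix.smul_apply, smul_eq_mul,
    Matrix.adjugate_apply]
  refine (measurable_det hM).inv.mul (measurable_det fun i j => ?_)
  by_cases h : i = b
  · subst h; simp
  · simpa [Matrix.updateRow_ne h] using hM i j

/-- The normalized trace `n⁻¹ Tr (A*A + w)⁻¹`. -/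
def resTr {n : ℕ} (A : Matrix (Fin n) (Fin n) ℂ) (w : ℝ) : ℝ :=
  (1 / (n : ℝ)) * ((A.conjTranspose * A + (w : ℂ) • 1)⁻¹).trace.re

variable {n : ℕ} (A B : Matrix (Fin n) (Fin n) ℂ) {w : ℝ}

lemma resTr_eq (hw : 0 < w) :
    resTr A w = (1 / (n : ℝ)) * ∑ j ∈ Finset.range n, (sv A j ^ 2 + w)⁻¹ := by
  rw [resTr, trace_gram_add_inv A hw, Complex.ofReal_re]

lemma resTr_nonneg (hw : 0 < w) : 0 ≤ resTr A w := by
  rw [resTr_eq A hw]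
  have : ∀ j, 0 ≤ (sv A j ^ 2 + w)⁻¹ := fun j => by positivity
  exact mul_nonneg (by positivity) (Finset.sum_nonneg fun j _ => this j)

lemma resTr_le (hw : 0 < w) : resTr A w ≤ w⁻¹ := by
  rw [resTr_eq A hw]
  rcases Nat.eq_zero_or_pos n with hn | hn
  · subst hn; simp [hw.le]
  have hn' : (0 : ℝ) < n := by exact_mod_cast hn
  have : ∑ j ∈ Finset.range n, (sv A j ^ 2 + w)⁻¹ ≤ ∑ _j ∈ Finset.range n, w⁻¹ :=
    Finset.sum_le_sum fun j _ => inv_anti₀ hw (by nlinarith [sq_nonneg (sv A j)])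
  rw [Finset.sum_const, Finset.card_range, nsmul_eq_mul] at this
  rw [one_div, inv_mul_le_iff₀ hn']
  exact this

lemma abs_resTr_le (hw : 0 < w) : |resTr A w| ≤ w⁻¹ := by
  rw [abs_of_nonneg (resTr_nonneg A hw)]; exact resTr_le A hw

lemma abs_resTr_sub_le (hw : 0 < w) :
    |resTr A w - resTr B w| ≤ 4 / w / n * (A - B).rank := by
  rw [resTr_eq A hw, resTr_eq B hw, ← mul_sub, abs_mul, abs_of_nonneg (by positivity)]
  calc _ ≤ 1 / (n : ℝ) * (4 / w * (A - B).rank) := by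
        gcongr; exact abs_sum_inv_sub_le A B hw
    _ = _ := by ring

/-- Defining `resTr` by a matrix inverse makes it measurable by Cramer's rule, with no appeal to
measurability of singular values. Joint measurability with w is needed for Fubini in w. -/
lemma measurable_resTr {α : Type*} [MeasurableSpace α] {M : α → Matrix (Fin n) (Fin n) ℂ}
    (hM : ∀ a b, Measurable fun u => M u a b) {w : α → ℝ} (hw : Measurable w) :
    Measurable fun u => resTr (M u) (w u) := by
  have h : ∀ a b, Measurable fun u => ((M u).conjTranspose * M u + (w u : ℂ) • 1) a b := by
    intro a b
    simp only [Matrix.add_apply, Matrix.mul_apply, Matrix.conjTranspose_apply, Matrix.smul_apply,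
      smul_eq_mul]
    refine (Finset.measurable_sum _ fun k _ => ?_).add
      ((Complex.measurable_ofReal.comp hw).mul_const _)
    exact (Complex.continuous_conj.measurable.comp (hM k a)).mul (hM k b)
  unfold resTr
  simp only [Matrix.trace, Matrix.diag_apply]
  exact (Complex.measurable_re.comp
    (Finset.measurable_sum _ fun a _ => measurable_inv_apply h a a)).const_mul _

end ResTr

/-! ### Concentration and truncation of the resolvent trace -/

section Concentration

variable {Ω : Type*} [MeasurableSpace Ω] {P : Measure Ω} [IsProbabilityMeasure P]
  {m n : ℕ} {d : Fin (m + 1) → ℕ} {F : MatTuple d → Matrix (Fin n) (Fin n) ℂ}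

lemma continuous_scaled : Continuous (scaled (d := d)) :=
  continuous_pi fun e => (continuous_apply e).div_const _

lemma measurable_valueAt (hF : ∀ a b, Continuous fun u : Entry d → ℂ => F (ofEntries u) a b)
    (a b : Fin n) : Measurable fun x : Entry d → ℂ => valueAt F x a b :=
  ((hF a b).comp continuous_scaled).measurable

lemma measurable_valueAt_sub (hF : ∀ a b, Continuous fun u : Entry d → ℂ => F (ofEntries u) a b)
    {α : Type*} [MeasurableSpace α] {x : α → Entry d → ℂ} (hx : Measurable x) {c : α → ℂ}
    (hc : Measurable c) (a b : Fin n) :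
    Measurable fun u => (valueAt F (x u) - c u • 1) a b := by
  simp only [Matrix.sub_apply, Matrix.smul_apply, smul_eq_mul]
  exact ((measurable_valueAt hF a b).comp hx).sub (hc.mul_const _)

variable (hF : ∀ a b, Continuous fun u : Entry d → ℂ => F (ofEntries u) a b) {C : ℝ} (hC : 0 ≤ C)
  (hrank : ∀ A B : MatTuple d, ((F A - F B).rank : ℝ) ≤ C * ∑ q : Fin m, ((A q - B q).rank : ℝ))
  (α : ℂ) {w : ℝ} (hw : 0 < w) {X : Entry d → Ω → ℂ} (hX : ∀ e, Measurable (X e))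

include hF in
lemma measurable_resTr_valueAt :
    Measurable fun x : Entry d → ℂ => resTr (valueAt F x - α • 1) w :=
  measurable_resTr (measurable_valueAt_sub hF measurable_id measurable_const) measurable_const

include hF hX hw in
lemma integrable_resTr_valueAt :
    Integrable (fun ω => resTr (valueAt F (fun e => X e ω) - α • 1) w) P :=
  integrable_of_bdd ((measurable_resTr_valueAt hF α).comp (measurable_pi_lambda _ hX))
    fun _ => abs_resTr_le _ hw

include hrank hC hw in
lemma abs_resTr_valueAt_sub_le (x y : Entry d → ℂ) {r : ℝ}
    (hr : ∑ q : Fin m, (((ofEntries (scaled x) : MatTuple d) q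
      - (ofEntries (scaled y) : MatTuple d) q).rank : ℝ) ≤ r) :
    |resTr (valueAt F x - α • 1) w - resTr (valueAt F y - α • 1) w| ≤ 4 / w / n * (C * r) := by
  refine (abs_resTr_sub_le _ _ hw).trans ?_
  rw [sub_sub_sub_cancel_right]
  refine mul_le_mul_of_nonneg_left ((hrank _ _).trans ?_) (by positivity)
  exact mul_le_mul_of_nonneg_left hr hC

-- The blocks are the rows of all matrices. Resampling a row is a change of rank at most one in the
-- arguments, hence moves the trace by O(1/n); with O(n) rows the variance is O(1/n). The variance
-- of |g| being nonnegative turns the L² bound into an L¹ bound.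
include hF hC hrank hw hX in
lemma integral_abs_resTr_sub_mean_le (hind : iIndepFun X P) :
    ∫ ω, |resTr (valueAt F (fun e => X e ω) - α • 1) w
        - ∫ ω', resTr (valueAt F (fun e => X e ω') - α • 1) w ∂P| ∂P
      ≤ Real.sqrt ((∑ q : Fin m, (d q.castSucc : ℝ)) * (4 / w / n * C) ^ 2) := by
  set f : (Entry d → ℂ) → ℝ := fun x => resTr (valueAt F x - α • 1) w with hf
  have hfm : Measurable f := measurable_resTr_valueAt hF α
  have hXm : Measurable fun ω e => X e ω := measurable_pi_lambda _ hX
  have : ∀ e, IsProbabilityMeasure (P.map (X e)) := fun e =>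
    Measure.isProbabilityMeasure_map (hX e).aemeasurable
  have hlaw : P.map (fun ω e => X e ω) = Measure.pi fun e => P.map (X e) :=
    hind.map_fun_eq_pi_map fun e => (hX e).aemeasurable
  have hvar := variance_le_of_block_diff (fun e => P.map (X e))
    (fun e : Entry d => (⟨e.1, e.2.1⟩ : (q : Fin m) × Fin (d q.castSucc))) hfm
    (K := w⁻¹) (c := 4 / w / n * C) (fun x => abs_resTr_le _ hw) (by
      rintro ⟨q, j⟩ x y hxy
      have := abs_resTr_valueAt_sub_le hC hrank α hw x y (r := 1)
        (sum_rank_le_of_eq_off_row q j fun q' j' hne k => by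
          simp only [ofEntries, Matrix.of_apply, scaled]
          rw [hxy ⟨q', j', k⟩ hne])
      rwa [mul_one] at this)
  rw [← hlaw, integral_map hXm.aemeasurable hfm.aestronglyMeasurable,
    integral_map hXm.aemeasurable ((hfm.sub_const _).pow_const 2).aestronglyMeasurable] at hvar
  have hcard : (Fintype.card ((q : Fin m) × Fin (d q.castSucc)) : ℝ)
      = ∑ q : Fin m, (d q.castSucc : ℝ) := by
    rw [Fintype.card_sigma]; simp
  rw [hcard] at hvar
  set g : Ω → ℝ := fun ω => f (fun e => X e ω) - ∫ ω', f (fun e => X e ω') ∂P with hg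
  have hgm : Measurable g := (hfm.comp hXm).sub_const _
  have hgb : ∀ ω, |g ω| ≤ w⁻¹ + w⁻¹ := fun ω => by
    refine (abs_sub _ _).trans (add_le_add (abs_resTr_le _ hw) ?_)
    have := norm_integral_le_of_norm_le_const (μ := P) (f := fun ω' => f (fun e => X e ω'))
      (C := w⁻¹) (ae_of_all _ fun ω => abs_resTr_le _ hw)
    simpa using this
  have hgL : MemLp (fun ω => |g ω|) 2 P :=
    MemLp.of_bound hgm.abs.aestronglyMeasurable (w⁻¹ + w⁻¹) (ae_of_all _ fun ω => by
      rw [Real.norm_eq_abs, abs_abs]; exact hgb ω)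
  have hv := variance_nonneg (fun ω => |g ω|) P
  rw [variance_eq_sub hgL] at hv
  have hsq : P[(fun ω => |g ω|) ^ 2] = ∫ ω, g ω ^ 2 ∂P := by
    congr 1; funext ω; simp
  rw [hsq] at hv
  refine Real.le_sqrt_of_sq_le ?_
  exact (by linarith : (∫ ω, |g ω| ∂P) ^ 2 ≤ ∫ ω, g ω ^ 2 ∂P).trans hvar

-- The rank of the change is controlled by the number of entries exceeding K, whose expectation is
-- bounded by Chebyshev's inequality applied to the tails.
include hF hC hrank hw hX in
lemma integral_abs_resTr_sub_trunc_le (h2 : ∀ e, Integrable (fun ω => ‖X e ω‖ ^ 2) P) {K : ℝ}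
    (hK : 0 < K) :
    ∫ ω, |resTr (valueAt F (fun e => X e ω) - α • 1) w
        - resTr (valueAt F (fun e => trunc K (X e ω)) - α • 1) w| ∂P
      ≤ 4 / w / n * (C * ∑ e, tailMoment P (X e) K / K ^ 2) := by
  classical
  have hXt : ∀ e, Measurable fun ω => trunc K (X e ω) := fun e => (measurable_trunc K).comp (hX e)
  have hii : ∀ e, Integrable (fun ω => if K < ‖X e ω‖ then (1 : ℝ) else 0) P := fun e =>
    integrable_of_bdd (Measurable.ite (measurableSet_lt measurable_const (hX e).norm)
      measurable_const measurable_const) (K := 1) fun ω => by split_ifs <;> simp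
  have hpt : ∀ ω, |resTr (valueAt F (fun e => X e ω) - α • 1) w
        - resTr (valueAt F (fun e => trunc K (X e ω)) - α • 1) w|
      ≤ 4 / w / n * (C * ∑ e, if K < ‖X e ω‖ then (1 : ℝ) else 0) := by
    intro ω
    refine abs_resTr_valueAt_sub_le hC hrank α hw _ _ ?_
    refine (sum_rank_le_card (Finset.univ.filter fun e => K < ‖X e ω‖) fun e he => ?_).trans_eq ?_
    · have : ‖X e ω‖ ≤ K := by simpa using he
      simp [ofEntries, scaled, trunc, this]
    · rw [Finset.card_filter]; push_cast; rfl
  refine (integral_mono ((integrable_resTr_valueAt hF α hw hX).sub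
    (integrable_resTr_valueAt hF α hw hXt)).abs
    (((integrable_finsetSum _ fun e _ => hii e).const_mul C).const_mul _) hpt).trans ?_
  rw [integral_const_mul, integral_const_mul, integral_finsetSum _ fun e _ => hii e]
  gcongr with e
  exact integral_indicator_le (hX e) (h2 e) hK

end Concentration

/-! ### Comparison of the resolvent traces -/

section Comparison

variable {Ω : Type*} [MeasurableSpace Ω] {P : Measure Ω} [IsProbabilityMeasure P]
  {m n : ℕ} {d : Fin (m + 1) → ℕ} {F : MatTuple d → Matrix (Fin n) (Fin n) ℂ}

lemma negResTrace_eq (hn : 1 ≤ n) (α : ℂ) {v : ℝ} (hv : 0 < v) (x : Entry d → ℂ) :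
    negResTrace F ((-α) • 1) ((v : ℂ) * Complex.I) (scaled x)
      = -(2 * v * n * Complex.I) * (resTr (valueAt F x - α • 1) (v ^ 2) : ℂ) := by
  have hn' : (n : ℂ) ≠ 0 := by exact_mod_cast (by omega : n ≠ 0)
  rw [negResTrace, neg_smul, ← sub_eq_add_neg, trace_hermitization_inv _ hv,
    resTr_eq _ (by positivity), valueAt]
  push_cast
  field_simp

variable {X Y : Entry d → Ω → ℂ} {τ A₀ A₁ A₂ κ C : ℝ}

/-- The expected resolvent traces of the truncated matrices. -/
lemma abs_integral_resTr_trunc_sub_le (hn : 1 ≤ n)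
    (hF : ∀ a b, ContDiff ℝ 3 fun u : Entry d → ℂ => F (ofEntries u) a b)
    (hX : ∀ e, Measurable (X e)) (hY : ∀ e, Measurable (Y e))
    (h_indep : iIndepFun (Sum.elim X Y) P)
    (hX2 : ∀ e, ∫ ω, ‖X e ω‖ ^ 2 ∂P = 1) (hY2 : ∀ e, ∫ ω, ‖Y e ω‖ ^ 2 ∂P = 1)
    (hX0 : ∀ e i, ∫ ω, rePart i (X e ω) ∂P = 0) (hY0 : ∀ e i, ∫ ω, rePart i (Y e ω) ∂P = 0)
    (hXY : ∀ e i j, ∫ ω, rePart i (Y e ω) * rePart j (Y e ω) ∂P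
      = ∫ ω, rePart i (X e ω) * rePart j (X e ω) ∂P)
    (α : ℂ) {v : ℝ} (hv : 0 < v) (hK : 1 ≤ τ * Real.sqrt n)
    (hA0 : 0 < A₀) (hA1 : 0 < A₁) (hA2 : 0 < A₂)
    (hA : ∀ φ ∈ Set.Icc (0 : ℝ) (Real.pi / 2), ∀ e : Entry d, ∀ x y : ℂ,
      ∀ c₀ ∈ ({1, Complex.I} : Set ℂ),
        ‖condMean P n τ φ X Y e (gFun F ((-α) • 1) ((v : ℂ) * Complex.I) e c₀) x y‖ ≤ A₀ ∧
        ∀ c₁ ∈ ({1, Complex.I} : Set ℂ),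
          ‖condMean P n τ φ X Y e (partialDeriv e c₁
            (gFun F ((-α) • 1) ((v : ℂ) * Complex.I) e c₀)) x y‖ ≤ A₁ ∧
          ∀ c₂ ∈ ({1, Complex.I} : Set ℂ),
            ‖condMean P n τ φ X Y e (partialDeriv e c₂ (partialDeriv e c₁
              (gFun F ((-α) • 1) ((v : ℂ) * Complex.I) e c₀))) x y‖ ≤ A₂)
    (hκ : ∀ e : Entry d, normFactor e ≤ κ) (hκ0 : 0 ≤ κ) :
    |∫ ω, resTr (valueAt F (fun e => trunc (τ * Real.sqrt n) (Y e ω)) - α • 1) (v ^ 2) ∂P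
      - ∫ ω, resTr (valueAt F (fun e => trunc (τ * Real.sqrt n) (X e ω)) - α • 1) (v ^ 2) ∂P|
      ≤ (4 * A₀ * κ / (τ * Real.sqrt n) * (∑ e, (tailMoment P (X e) (τ * Real.sqrt n)
            + tailMoment P (Y e) (τ * Real.sqrt n)))
          + 20 * A₁ * κ ^ 2 * (∑ e, (tailMoment P (X e) (τ * Real.sqrt n)
            + tailMoment P (Y e) (τ * Real.sqrt n)))
          + 64 * A₂ * κ ^ 3 * (τ * Real.sqrt n) * Fintype.card (Entry d)) / (v * n) := by
  set K := τ * Real.sqrt n with hKdef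
  have hK0 : 0 < K := by linarith
  have hn' : (0 : ℝ) < n := by exact_mod_cast hn
  have iX : ∀ e, Integrable (fun ω => ‖X e ω‖ ^ 2) P := fun e =>
    Integrable.of_integral_ne_zero (by rw [hX2 e]; exact one_ne_zero)
  have iY : ∀ e, Integrable (fun ω => ‖Y e ω‖ ^ 2) P := fun e =>
    Integrable.of_integral_ne_zero (by rw [hY2 e]; exact one_ne_zero)
  set l : Entry d → ℝ := fun e => tailMoment P (X e) K + tailMoment P (Y e) K with hl
  have lX0 : ∀ e, 0 ≤ tailMoment P (X e) K := fun e => tailMoment_nonneg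
  have lY0 : ∀ e, 0 ≤ tailMoment P (Y e) K := fun e => tailMoment_nonneg
  have l0 : ∀ e, 0 ≤ l e := fun e => add_nonneg (lX0 e) (lY0 e)
  have l2 : ∀ e, l e ≤ 2 := fun e => by
    have h1 := tailMoment_le (K := K) (hX e) (iX e)
    have h2 := tailMoment_le (K := K) (hY e) (iY e)
    rw [hX2 e] at h1; rw [hY2 e] at h2
    simp only [hl]; linarith
  have hg : ∀ e c, gFun F ((-α) • 1) ((v : ℂ) * Complex.I) e c
      = partialDeriv e c (negResTrace F ((-α) • 1) ((v : ℂ) * Complex.I)) :=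
    gFun_eq_partialDeriv ((-α) • 1) hF hv
  simp only [hg] at hA
  -- The mean error is l/K, the covariance error l and the third moment 4K(1 + 1) = 8K, where l adds
  -- the tails of X and Y so that one number serves both.
  have main := norm_integral_interp_sub_le n τ hX hY h_indep
    (contDiff_negResTrace ((-α) • 1) hF hv) hA (a := fun e => l e / K) (b := l)
    (t := fun _ => 8 * K)
    (fun e i => (abs_integral_trunc_le (hX e) (iX e) hK0 i (hX0 e i)).trans (by
      gcongr; simp only [hl]; linarith [lY0 e]))
    (fun e i => (abs_integral_trunc_le (hY e) (iY e) hK0 i (hY0 e i)).trans (by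
      gcongr; simp only [hl]; linarith [lX0 e]))
    (fun e i j => by
      have h1 := abs_integral_sub_trunc_le (hX e) (iX e) K i j
      have h2 := abs_integral_sub_trunc_le (hY e) (iY e) K i j
      rw [hXY e i j] at h2
      rw [abs_le] at h1 h2 ⊢
      simp only [hl]
      constructor <;> linarith)
    (fun e => by
      have := integral_trunc_cube_le (hX e) (hY e) (iX e) (iY e) hK0.le
      rw [hX2 e, hY2 e] at this
      linarith)
  have e1 : ∀ x y : Entry d → ℂ, negResTrace F ((-α) • 1) ((v : ℂ) * Complex.I)
      (interp n τ (Real.pi / 2) x y) = -(2 * v * n * Complex.I)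
        * (resTr (valueAt F (fun e => trunc K (y e)) - α • 1) (v ^ 2) : ℂ) := fun x y => by
    rw [← negResTrace_eq hn α hv]
    simp [interp, hKdef]
  have e0 : ∀ x y : Entry d → ℂ, negResTrace F ((-α) • 1) ((v : ℂ) * Complex.I)
      (interp n τ 0 x y) = -(2 * v * n * Complex.I)
        * (resTr (valueAt F (fun e => trunc K (x e)) - α • 1) (v ^ 2) : ℂ) := fun x y => by
    rw [← negResTrace_eq hn α hv]
    simp [interp, hKdef]
  simp only [e1, e0, integral_const_mul] at main
  rw [integral_complex_ofReal, integral_complex_ofReal, ← mul_sub, norm_mul, ← Complex.ofReal_sub,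
    Complex.norm_real, Real.norm_eq_abs] at main
  have hc : ‖-(2 * (v : ℂ) * n * Complex.I)‖ = 2 * v * n := by
    simp [abs_of_pos hv]
  rw [hc] at main
  have hsum : (∑ e, 2 * (A₀ * (2 * normFactor e * (l e / K))
        + 2 * A₁ * (normFactor e ^ 2 * (l e + 2 * (l e / K) ^ 2))
        + 4 * A₂ * (normFactor e ^ 3 * (8 * K))))
      ≤ 4 * A₀ * κ / K * (∑ e, l e) + 20 * A₁ * κ ^ 2 * (∑ e, l e)
        + 64 * A₂ * κ ^ 3 * K * Fintype.card (Entry d) := by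
    rw [Finset.mul_sum, Finset.mul_sum, ← Finset.sum_add_distrib]
    have : 64 * A₂ * κ ^ 3 * K * (Fintype.card (Entry d) : ℝ)
        = ∑ _e : Entry d, 64 * A₂ * κ ^ 3 * K := by
      rw [Finset.sum_const, Finset.card_univ, nsmul_eq_mul]; ring
    rw [this, ← Finset.sum_add_distrib]
    refine Finset.sum_le_sum fun e _ => ?_
    have hne := normFactor_nonneg e
    have hle := l0 e
    -- K ≥ 1 and l ≤ 2 make the squared mean error linear in l, so that only the sum of the tails
    -- enters.
    have q1 : (l e / K) ^ 2 ≤ 2 * l e := by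
      have : l e / K ≤ l e := div_le_self hle hK
      have h0 : 0 ≤ l e / K := by positivity
      nlinarith [l2 e]
    have q2 : l e + 2 * (l e / K) ^ 2 ≤ 5 * l e := by linarith
    calc _ ≤ 2 * (A₀ * (2 * κ * (l e / K)) + 2 * A₁ * (κ ^ 2 * (5 * l e))
          + 4 * A₂ * (κ ^ 3 * (8 * K))) := by
          have := hκ e
          gcongr
      _ = _ := by ring
  rw [le_div_iff₀ (by positivity)]
  -- The length of the path is bounded by 2, which cancels the 2 in the prefactor 2vn.
  have hpi : Real.pi / 2 ≤ 2 := by linarith [Real.pi_le_four]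
  have hS0 : 0 ≤ 4 * A₀ * κ / K * (∑ e, l e) + 20 * A₁ * κ ^ 2 * (∑ e, l e)
        + 64 * A₂ * κ ^ 3 * K * Fintype.card (Entry d) := by
    have := Finset.sum_nonneg fun e (_ : e ∈ Finset.univ) => l0 e
    positivity
  have := main.trans ((mul_le_mul_of_nonneg_right hsum (by positivity)).trans
    (mul_le_mul_of_nonneg_left hpi hS0))
  linarith

end Comparison

/-! ### Comparability of the matrix sizes with `n` -/

section Sizes

variable {m : ℕ} {N : ℕ → Fin (m + 1) → ℕ}

lemma exists_size_bound (hN_first : ∀ n, N n 0 = n)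
    (hN_shape : ∀ q : Fin m, ∃ y : ℝ, 0 < y ∧
      Tendsto (fun n : ℕ => (n : ℝ) / (N n q.succ : ℝ)) atTop (𝓝 y)) :
    ∃ c : ℝ, 1 ≤ c ∧ ∀ᶠ n : ℕ in atTop, (∀ i, (N n i : ℝ) ≤ c * n) ∧
      ∀ q : Fin m, (n : ℝ) ≤ c * N n q.succ := by
  choose y hy hlim using hN_shape
  have hpos : ∀ q ∈ Finset.univ, 0 ≤ 2 * y q + 2 / y q := fun q _ => by
    have := hy q; positivity
  have hle : ∀ q, 2 * y q + 2 / y q ≤ 1 + ∑ q, (2 * y q + 2 / y q) := fun q => by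
    have := Finset.single_le_sum hpos (Finset.mem_univ q)
    linarith
  refine ⟨1 + ∑ q, (2 * y q + 2 / y q), by linarith [Finset.sum_nonneg hpos], ?_⟩
  have h1 : ∀ᶠ n : ℕ in atTop, ∀ q : Fin m, (n : ℝ) / (N n q.succ : ℝ) ∈
      Set.Ioo (y q / 2) (2 * y q) := by
    rw [eventually_all]
    intro q
    exact (hlim q).eventually (Ioo_mem_nhds (by linarith [hy q]) (by linarith [hy q]))
  filter_upwards [h1] with n h
  have hq : ∀ q : Fin m, (N n q.succ : ℝ) ≤ 2 / y q * n ∧ (n : ℝ) ≤ 2 * y q * N n q.succ := by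
    intro q
    obtain ⟨h2, h3⟩ := h q
    have hyq := hy q
    -- A vanishing size would make the quotient 0 by convention, below y/2.
    have hN : (0 : ℝ) < N n q.succ := by
      rcases Nat.eq_zero_or_pos (N n q.succ) with h0 | h0
      · rw [h0] at h2; simp at h2; linarith
      · exact_mod_cast h0
    rw [lt_div_iff₀ hN] at h2
    rw [div_lt_iff₀ hN] at h3
    refine ⟨?_, h3.le⟩
    rw [div_mul_eq_mul_div, le_div_iff₀ hyq]
    linarith
  have hn0 : (0 : ℝ) ≤ n := Nat.cast_nonneg n
  constructor
  · intro i
    refine Fin.cases ?_ (fun q => ?_) i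
    · rw [hN_first]
      nlinarith [Finset.sum_nonneg hpos]
    · refine (hq q).1.trans (mul_le_mul_of_nonneg_right ?_ hn0)
      have := hle q; have := hy q; linarith
  · intro q
    refine (hq q).2.trans (mul_le_mul_of_nonneg_right ?_ (Nat.cast_nonneg _))
    have h4 : 0 < 2 / y q := by have := hy q; positivity
    linarith [hle q]

end Sizes

/-! ### The resolvent comparison at fixed `n` -/

section Limit

variable {Ω : Type*} [MeasurableSpace Ω] {P : Measure Ω} [IsProbabilityMeasure P]

/-- The resolvent trace comparison for one `n`, with explicit constants. -/
lemma integral_abs_resTr_sub_le {m n : ℕ} {d : Fin (m + 1) → ℕ}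
    {F : MatTuple d → Matrix (Fin n) (Fin n) ℂ} {X Y : Entry d → Ω → ℂ}
    {τ A₀ A₁ A₂ κ C : ℝ} (hn : 1 ≤ n)
    (hF : ∀ a b, ContDiff ℝ 3 fun u : Entry d → ℂ => F (ofEntries u) a b)
    (hX : ∀ e, Measurable (X e)) (hY : ∀ e, Measurable (Y e))
    (h_indep : iIndepFun (Sum.elim X Y) P)
    (hX2 : ∀ e, ∫ ω, ‖X e ω‖ ^ 2 ∂P = 1) (hY2 : ∀ e, ∫ ω, ‖Y e ω‖ ^ 2 ∂P = 1)
    (hX0 : ∀ e i, ∫ ω, rePart i (X e ω) ∂P = 0) (hY0 : ∀ e i, ∫ ω, rePart i (Y e ω) ∂P = 0)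
    (hXY : ∀ e i j, ∫ ω, rePart i (Y e ω) * rePart j (Y e ω) ∂P
      = ∫ ω, rePart i (X e ω) * rePart j (X e ω) ∂P) (hC : 0 ≤ C)
    (hrank : ∀ A B : MatTuple d, ((F A - F B).rank : ℝ) ≤ C * ∑ q : Fin m, ((A q - B q).rank : ℝ))
    (α : ℂ) {v : ℝ} (hv : 0 < v) (hK : 1 ≤ τ * Real.sqrt n)
    (hA0 : 0 < A₀) (hA1 : 0 < A₁) (hA2 : 0 < A₂)
    (hA : ∀ φ ∈ Set.Icc (0 : ℝ) (Real.pi / 2), ∀ e : Entry d, ∀ x y : ℂ,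
      ∀ c₀ ∈ ({1, Complex.I} : Set ℂ),
        ‖condMean P n τ φ X Y e (gFun F ((-α) • 1) ((v : ℂ) * Complex.I) e c₀) x y‖ ≤ A₀ ∧
        ∀ c₁ ∈ ({1, Complex.I} : Set ℂ),
          ‖condMean P n τ φ X Y e (partialDeriv e c₁
            (gFun F ((-α) • 1) ((v : ℂ) * Complex.I) e c₀)) x y‖ ≤ A₁ ∧
          ∀ c₂ ∈ ({1, Complex.I} : Set ℂ),
            ‖condMean P n τ φ X Y e (partialDeriv e c₂ (partialDeriv e c₁
              (gFun F ((-α) • 1) ((v : ℂ) * Complex.I) e c₀))) x y‖ ≤ A₂)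
    (hκ : ∀ e : Entry d, normFactor e ≤ κ) (hκ0 : 0 ≤ κ) {T : ℝ}
    (hT : ∑ e, (tailMoment P (X e) (τ * Real.sqrt n) + tailMoment P (Y e) (τ * Real.sqrt n)) ≤ T) :
    ∫ ω, |resTr (valueAt F (fun e => X e ω) - α • 1) (v ^ 2)
        - resTr (valueAt F (fun e => Y e ω) - α • 1) (v ^ 2)| ∂P
      ≤ 2 * Real.sqrt ((∑ q : Fin m, (d q.castSucc : ℝ)) * (4 / v ^ 2 / n * C) ^ 2)
        + 4 / v ^ 2 / n * (C * (T / (τ * Real.sqrt n) ^ 2))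
        + (4 * A₀ * κ / (τ * Real.sqrt n) * T + 20 * A₁ * κ ^ 2 * T
          + 64 * A₂ * κ ^ 3 * (τ * Real.sqrt n) * Fintype.card (Entry d)) / (v * n) := by
  have hn' : (0 : ℝ) < n := by exact_mod_cast hn
  have hcomp := abs_integral_resTr_trunc_sub_le hn hF hX hY h_indep hX2 hY2 hX0 hY0 hXY α hv hK
    hA0 hA1 hA2 hA hκ hκ0
  set K := τ * Real.sqrt n with hKdef
  have hK0 : 0 < K := by linarith
  have hw : (0 : ℝ) < v ^ 2 := by positivity
  have iX : ∀ e, Integrable (fun ω => ‖X e ω‖ ^ 2) P := fun e =>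
    Integrable.of_integral_ne_zero (by rw [hX2 e]; exact one_ne_zero)
  have iY : ∀ e, Integrable (fun ω => ‖Y e ω‖ ^ 2) P := fun e =>
    Integrable.of_integral_ne_zero (by rw [hY2 e]; exact one_ne_zero)
  have hFc : ∀ a b, Continuous fun u : Entry d → ℂ => F (ofEntries u) a b :=
    fun a b => (hF a b).continuous
  have indX : iIndepFun X P := iIndepFun.precomp (g := Sum.inl) Sum.inl_injective h_indep
  have indY : iIndepFun Y P := iIndepFun.precomp (g := Sum.inr) Sum.inr_injective h_indep
  have hXt : ∀ e, Measurable fun ω => trunc K (X e ω) := fun e => (measurable_trunc K).comp (hX e)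
  have hYt : ∀ e, Measurable fun ω => trunc K (Y e ω) := fun e => (measurable_trunc K).comp (hY e)
  have cX := integral_abs_resTr_sub_mean_le hFc hC hrank α hw hX indX
  have cY := integral_abs_resTr_sub_mean_le hFc hC hrank α hw hY indY
  have tX := integral_abs_resTr_sub_trunc_le hFc hC hrank α hw hX iX hK0
  have tY := integral_abs_resTr_sub_trunc_le hFc hC hrank α hw hY iY hK0
  have jX := integrable_resTr_valueAt (P := P) hFc α hw hX
  have jY := integrable_resTr_valueAt (P := P) hFc α hw hY
  have jXt := integrable_resTr_valueAt (P := P) hFc α hw hXt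
  have jYt := integrable_resTr_valueAt (P := P) hFc α hw hYt
  set SX : Ω → ℝ := fun ω => resTr (valueAt F (fun e => X e ω) - α • 1) (v ^ 2)
  set SY : Ω → ℝ := fun ω => resTr (valueAt F (fun e => Y e ω) - α • 1) (v ^ 2)
  set RX : Ω → ℝ := fun ω => resTr (valueAt F (fun e => trunc K (X e ω)) - α • 1) (v ^ 2)
  set RY : Ω → ℝ := fun ω => resTr (valueAt F (fun e => trunc K (Y e ω)) - α • 1) (v ^ 2)
  change |∫ ω, RY ω ∂P - ∫ ω, RX ω ∂P| ≤ _ at hcomp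
  change ∫ ω, |SX ω - ∫ ω', SX ω' ∂P| ∂P ≤ _ at cX
  change ∫ ω, |SY ω - ∫ ω', SY ω' ∂P| ∂P ≤ _ at cY
  change ∫ ω, |SX ω - RX ω| ∂P ≤ _ at tX
  change ∫ ω, |SY ω - RY ω| ∂P ≤ _ at tY
  change Integrable SX P at jX
  change Integrable SY P at jY
  change Integrable RX P at jXt
  change Integrable RY P at jYt
  change ∫ ω, |SX ω - SY ω| ∂P ≤ _
  have mX : |∫ ω, SX ω ∂P - ∫ ω, RX ω ∂P| ≤ ∫ ω, |SX ω - RX ω| ∂P := by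
    rw [← integral_sub jX jXt]; exact abs_integral_le_integral_abs
  have mY : |∫ ω, SY ω ∂P - ∫ ω, RY ω ∂P| ≤ ∫ ω, |SY ω - RY ω| ∂P := by
    rw [← integral_sub jY jYt]; exact abs_integral_le_integral_abs
  -- The means are compared through their truncated versions; the fluctuations around the means are
  -- added in `hsplit`.
  have hmean : |∫ ω, SX ω ∂P - ∫ ω, SY ω ∂P|
      ≤ ∫ ω, |SX ω - RX ω| ∂P + ∫ ω, |SY ω - RY ω| ∂P
        + |∫ ω, RY ω ∂P - ∫ ω, RX ω ∂P| := by
    have h1 := abs_le.1 mX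
    have h2 := abs_le.1 mY
    have h3 := abs_le.1 (le_refl |∫ ω, RY ω ∂P - ∫ ω, RX ω ∂P|)
    rw [abs_le]
    constructor <;> linarith
  have hsplit : ∫ ω, |SX ω - SY ω| ∂P ≤ ∫ ω, |SX ω - ∫ ω', SX ω' ∂P| ∂P
      + ∫ ω, |SY ω - ∫ ω', SY ω' ∂P| ∂P + |∫ ω, SX ω ∂P - ∫ ω, SY ω ∂P| := by
    have i1 : Integrable (fun ω => |SX ω - ∫ ω', SX ω' ∂P|) P :=
      (jX.sub (integrable_const _)).abs
    have i2 : Integrable (fun ω => |SY ω - ∫ ω', SY ω' ∂P|) P :=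
      (jY.sub (integrable_const _)).abs
    have : ∫ _ω : Ω, |∫ ω, SX ω ∂P - ∫ ω, SY ω ∂P| ∂P = |∫ ω, SX ω ∂P - ∫ ω, SY ω ∂P| := by simp
    have i12 : Integrable (fun ω => |SX ω - ∫ ω', SX ω' ∂P| + |SY ω - ∫ ω', SY ω' ∂P|) P :=
      i1.add i2
    rw [← this, ← integral_add i1 i2, ← integral_add i12 (integrable_const _)]
    refine integral_mono (jX.sub jY).abs (i12.add (integrable_const _)) fun ω => ?_
    have h1 := abs_le.1 (le_refl |SX ω - ∫ ω', SX ω' ∂P|)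
    have h2 := abs_le.1 (le_refl |SY ω - ∫ ω', SY ω' ∂P|)
    have h3 := abs_le.1 (le_refl |∫ ω, SX ω ∂P - ∫ ω, SY ω ∂P|)
    simp only
    rw [abs_le]
    constructor <;> linarith
  have htr : 4 / v ^ 2 / n * (C * ∑ e, tailMoment P (X e) K / K ^ 2)
      + 4 / v ^ 2 / n * (C * ∑ e, tailMoment P (Y e) K / K ^ 2)
      ≤ 4 / v ^ 2 / n * (C * (T / K ^ 2)) := by
    rw [← mul_add, ← mul_add, ← Finset.sum_add_distrib]
    simp_rw [← add_div]
    rw [← Finset.sum_div]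
    gcongr
  have hco : (4 * A₀ * κ / K * (∑ e, (tailMoment P (X e) K + tailMoment P (Y e) K))
          + 20 * A₁ * κ ^ 2 * (∑ e, (tailMoment P (X e) K + tailMoment P (Y e) K))
          + 64 * A₂ * κ ^ 3 * K * Fintype.card (Entry d)) / (v * n)
      ≤ (4 * A₀ * κ / K * T + 20 * A₁ * κ ^ 2 * T
          + 64 * A₂ * κ ^ 3 * K * Fintype.card (Entry d)) / (v * n) := by
    gcongr
  linarith

end Limit

/-! ### The resolvent comparison in the limit -/

section Limit

variable {Ω : Type*} [MeasurableSpace Ω] {P : Measure Ω} [IsProbabilityMeasure P]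

omit [IsProbabilityMeasure P] in
lemma integral_sq_re_add_sq_im {X : Ω → ℂ} (h : Integrable (fun ω => ‖X ω‖ ^ 2) P)
    (hX : Measurable X) :
    ∫ ω, ‖X ω‖ ^ 2 ∂P = ∫ ω, (X ω).re ^ 2 ∂P + ∫ ω, (X ω).im ^ 2 ∂P := by
  have h1 := integrable_rePart_mul hX h true true
  have h2 := integrable_rePart_mul hX h false false
  simp only [rePart, cond_true, cond_false, Complex.reCLM_apply, Complex.imCLM_apply,
    ← pow_two] at h1 h2
  rw [← integral_add h1 h2]
  congr 1
  funext ω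
  rw [← Complex.normSq_eq_norm_sq, Complex.normSq_apply]; ring

/-- The error bound of the comparison in terms of the truncation level `t` and of a bound `Λ`
for the Lindeberg sums divided by `t ^ 4`. -/
def comparisonBound (m c v C A₀ A₁ A₂ : ℝ) (r Λ t : ℝ) : ℝ :=
  2 * Real.sqrt (m * c * (4 / v ^ 2 * C) ^ 2 * r) + 4 / v ^ 2 * C * (Λ * t ^ 2)
    + (4 * A₀ * Real.sqrt c * (Λ * t ^ 3) + 20 * A₁ * c * (Λ * t ^ 4)
      + 64 * A₂ * Real.sqrt c ^ 3 * (m * c ^ 2) * t) / v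

lemma tendsto_comparisonBound (m c v C A₀ A₁ A₂ : ℝ) {r Λ t : ℕ → ℝ}
    (hr : Tendsto r atTop (𝓝 0)) (hΛ : Tendsto Λ atTop (𝓝 0)) (ht : Tendsto t atTop (𝓝 0)) :
    Tendsto (fun n => comparisonBound m c v C A₀ A₁ A₂ (r n) (Λ n) (t n)) atTop (𝓝 0) := by
  have hcont : Continuous fun p : ℝ × ℝ × ℝ =>
      comparisonBound m c v C A₀ A₁ A₂ p.1 p.2.1 p.2.2 := by
    unfold comparisonBound
    fun_prop
  have h := (hcont.tendsto (0, 0, 0)).comp (hr.prodMk_nhds (hΛ.prodMk_nhds ht))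
  simpa [comparisonBound, Function.comp_def] using h

theorem tendsto_integral_abs_resTr_sub {m : ℕ} {N : ℕ → Fin (m + 1) → ℕ}
    (hN_first : ∀ n, N n 0 = n)
    (hN_shape : ∀ q : Fin m, ∃ y : ℝ, 0 < y ∧
      Tendsto (fun n : ℕ => (n : ℝ) / (N n q.succ : ℝ)) atTop (𝓝 y))
    {F : (n : ℕ) → MatTuple (N n) → Matrix (Fin n) (Fin n) ℂ}
    (hF : ∀ (n : ℕ) (a b : Fin n), ContDiff ℝ 3
      (fun u : Entry (N n) → ℂ => F n (ofEntries u) a b))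
    {X Y : (n : ℕ) → Entry (N n) → Ω → ℂ}
    (hX_meas : ∀ n e, Measurable (X n e)) (hY_meas : ∀ n e, Measurable (Y n e))
    (h_indep : ∀ n, iIndepFun (Sum.elim (X n) (Y n)) P)
    (hX_mean : ∀ n e, ∫ ω, X n e ω ∂P = 0)
    (hX_var : ∀ n e, ∫ ω, ‖X n e ω‖ ^ 2 ∂P = 1)
    (hY_gauss : ∀ n e, HasGaussianLaw (Y n e) P)
    (hY_re : ∀ n e, ∫ ω, (Y n e ω).re ∂P = ∫ ω, (X n e ω).re ∂P)
    (hY_im : ∀ n e, ∫ ω, (Y n e ω).im ∂P = ∫ ω, (X n e ω).im ∂P)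
    (hY_re_re : ∀ n e, ∫ ω, (Y n e ω).re ^ 2 ∂P = ∫ ω, (X n e ω).re ^ 2 ∂P)
    (hY_im_im : ∀ n e, ∫ ω, (Y n e ω).im ^ 2 ∂P = ∫ ω, (X n e ω).im ^ 2 ∂P)
    (hY_re_im : ∀ n e, ∫ ω, (Y n e ω).re * (Y n e ω).im ∂P
      = ∫ ω, (X n e ω).re * (X n e ω).im ∂P)
    (h_rank : RankCondition N F)
    {τ : ℕ → ℝ} (hτ_zero : Tendsto τ atTop (𝓝 0))
    (hτ_lindeberg : Tendsto
      (fun n : ℕ => lindebergSum P n (X n) (τ n) * (τ n ^ 4)⁻¹) atTop (𝓝 0))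
    (hτ_lower : ∀ n : ℕ, 1 ≤ n → (n : ℝ) ^ (-(1 / 3 : ℝ)) ≤ τ n)
    (h_deriv : ∀ α : ℂ, DerivativeBounds P N F X Y τ (fun _ => α • 1))
    (α : ℂ) {w : ℝ} (hw : 0 < w) :
    Tendsto (fun n => ∫ ω, |resTr (valueAt (F n) (fun e => X n e ω) - α • 1) w
        - resTr (valueAt (F n) (fun e => Y n e ω) - α • 1) w| ∂P) atTop (𝓝 0) := by
  obtain ⟨C₀, hC₀⟩ := h_rank
  set C := |C₀| with hC
  have hrank : ∀ (n : ℕ) (A B : MatTuple (N n)),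
      ((F n A - F n B).rank : ℝ) ≤ C * ∑ q : Fin m, ((A q - B q).rank : ℝ) := fun n A B =>
    (hC₀ n A B).trans (mul_le_mul_of_nonneg_right (le_abs_self _) (by positivity))
  obtain ⟨c, hc1, hc⟩ := exists_size_bound hN_first hN_shape
  set v := Real.sqrt w with hv'
  have hv : 0 < v := Real.sqrt_pos.2 hw
  have hvw : v ^ 2 = w := Real.sq_sqrt hw.le
  -- The derivative conditions add the shift while the potentials subtract it, hence -α. The
  -- resolvent at iv sees v² = w.
  obtain ⟨A₀, A₁, A₂, hA0, hA1, hA2, hA⟩ := h_deriv (-α) ((v : ℂ) * Complex.I) (by simpa using hv)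
  set r : ℕ → ℝ := fun n => (n : ℝ)⁻¹
  set Λ : ℕ → ℝ := fun n => lindebergSum P n (X n) (τ n) * (τ n ^ 4)⁻¹
    + m * c ^ 2 * gaussConst * τ n ^ 2 with hΛdef
  have hr : Tendsto r atTop (𝓝 0) := tendsto_inv_atTop_nhds_zero_nat
  have hΛ : Tendsto Λ atTop (𝓝 0) := by
    have := hτ_lindeberg.add ((hτ_zero.pow 2).const_mul (m * c ^ 2 * gaussConst))
    simpa [Λ] using this
  refine squeeze_zero' (Eventually.of_forall fun n => integral_nonneg fun ω => abs_nonneg _) ?_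
    (tendsto_comparisonBound m c v C A₀ A₁ A₂ hr hΛ hτ_zero)
  filter_upwards [hc, eventually_ge_atTop 1] with n ⟨hn1, hn2⟩ hn
  have hn' : (0 : ℝ) < n := by exact_mod_cast hn
  have hn1' : (1 : ℝ) ≤ n := by exact_mod_cast hn
  have hτ : 0 < τ n := lt_of_lt_of_le (Real.rpow_pos_of_pos hn' _) (hτ_lower n hn)
  have hτ3 : 1 ≤ τ n ^ 3 * n := by
    have h1 : ((n : ℝ) ^ (-(1 / 3 : ℝ))) ^ 3 = (n : ℝ)⁻¹ := by
      rw [← Real.rpow_natCast, ← Real.rpow_mul hn'.le]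
      norm_num
      exact Real.rpow_neg_one _
    have h2 := pow_le_pow_left₀ (Real.rpow_nonneg hn'.le _) (hτ_lower n hn) 3
    rw [h1] at h2
    rw [← inv_mul_cancel₀ hn'.ne']
    exact mul_le_mul_of_nonneg_right h2 hn'.le
  set s := Real.sqrt n with hs
  have hs0 : 0 < s := Real.sqrt_pos.2 hn'
  have hs2 : s ^ 2 = n := Real.sq_sqrt hn'.le
  -- From τ ≥ n^(-1/3) the truncation level is at least n^(1/6), so the Gaussian tails K⁻¹², summed
  -- over O(n²) entries, stay bounded.
  have hK12 : (n : ℝ) ^ 2 ≤ (τ n * s) ^ 12 := by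
    have : (τ n * s) ^ 12 = (τ n ^ 3 * n) ^ 4 * n ^ 2 := by rw [← hs2]; ring
    rw [this]
    exact le_mul_of_one_le_left (by positivity) (one_le_pow₀ hτ3)
  have hK : 1 ≤ τ n * s := by
    by_contra h
    have h1 : (τ n * s) ^ 12 < 1 := pow_lt_one₀ (by positivity) (not_le.1 h) (by norm_num)
    nlinarith
  have iX : ∀ e, Integrable (fun ω => ‖X n e ω‖ ^ 2) P := fun e =>
    Integrable.of_integral_ne_zero (by rw [hX_var n e]; exact one_ne_zero)
  have iY : ∀ e, Integrable (fun ω => ‖Y n e ω‖ ^ 2) P := fun e => by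
    have := (hY_gauss n e).memLp_two
    exact (memLp_two_iff_integrable_sq_norm (hY_meas n e).aestronglyMeasurable).1 this
  have xX : ∀ e, Integrable (X n e) P := fun e => integrable_norm_of_sq (hX_meas n e) (iX e)
  have hXre : ∀ e, ∫ ω, (X n e ω).re ∂P = 0 := fun e => by
    have := Complex.reCLM.integral_comp_comm (xX e)
    simp only [Complex.reCLM_apply] at this
    rw [this, hX_mean]; simp
  have hXim : ∀ e, ∫ ω, (X n e ω).im ∂P = 0 := fun e => by
    have := Complex.imCLM.integral_comp_comm (xX e)
    simp only [Complex.imCLM_apply] at this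
    rw [this, hX_mean]; simp
  have hYre : ∀ e, ∫ ω, (Y n e ω).re ∂P = 0 := fun e => (hY_re n e).trans (hXre e)
  have hYim : ∀ e, ∫ ω, (Y n e ω).im ∂P = 0 := fun e => (hY_im n e).trans (hXim e)
  have hsumX : ∀ e, ∫ ω, (X n e ω).re ^ 2 ∂P + ∫ ω, (X n e ω).im ^ 2 ∂P = 1 := fun e => by
    rw [← integral_sq_re_add_sq_im (iX e) (hX_meas n e), hX_var]
  have hY2 : ∀ e, ∫ ω, ‖Y n e ω‖ ^ 2 ∂P = 1 := fun e => by
    rw [integral_sq_re_add_sq_im (iY e) (hY_meas n e), hY_re_re, hY_im_im, hsumX]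
  have p1 : ∀ e, 0 ≤ ∫ ω, (X n e ω).re ^ 2 ∂P := fun e => integral_nonneg fun ω => sq_nonneg _
  have p2 : ∀ e, 0 ≤ ∫ ω, (X n e ω).im ^ 2 ∂P := fun e => integral_nonneg fun ω => sq_nonneg _
  have hX0 : ∀ e i, ∫ ω, rePart i (X n e ω) ∂P = 0 := fun e i => by
    cases i
    · exact hXim e
    · exact hXre e
  have hY0 : ∀ e i, ∫ ω, rePart i (Y n e ω) ∂P = 0 := fun e i => by
    cases i
    · exact hYim e
    · exact hYre e
  have hXY : ∀ e i j, ∫ ω, rePart i (Y n e ω) * rePart j (Y n e ω) ∂P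
      = ∫ ω, rePart i (X n e ω) * rePart j (X n e ω) ∂P := fun e i j => by
    cases i <;> cases j <;> simp only [rePart, cond_true, cond_false, Complex.reCLM_apply,
      Complex.imCLM_apply]
    · simpa only [pow_two] using hY_im_im n e
    · simpa only [mul_comm] using hY_re_im n e
    · exact hY_re_im n e
    · simpa only [pow_two] using hY_re_re n e
  have hcard : (Fintype.card (Entry (N n)) : ℝ) ≤ m * c ^ 2 * n ^ 2 := by
    rw [Fintype.card_sigma]
    push_cast
    calc ∑ q : Fin m, (Fintype.card (Fin (N n q.castSucc) × Fin (N n q.succ)) : ℝ)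
        ≤ ∑ _q : Fin m, (c * n) * (c * n) := Finset.sum_le_sum fun q _ => by
          rw [Fintype.card_prod, Fintype.card_fin, Fintype.card_fin]
          push_cast
          exact mul_le_mul (hn1 _) (hn1 _) (by positivity) (by positivity)
      _ = _ := by rw [Finset.sum_const, Finset.card_univ, Fintype.card_fin, nsmul_eq_mul]; ring
  have hdim : (∑ q : Fin m, (N n q.castSucc : ℝ)) ≤ m * c * n := by
    calc (∑ q : Fin m, (N n q.castSucc : ℝ)) ≤ ∑ _q : Fin m, c * n :=
          Finset.sum_le_sum fun q _ => hn1 _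
      _ = _ := by rw [Finset.sum_const, Finset.card_univ, Fintype.card_fin, nsmul_eq_mul]; ring
  have hG := gaussConst_nonneg
  have hLY : ∑ e, tailMoment P (Y n e) (τ n * s) ≤ m * c ^ 2 * gaussConst := by
    have : ∀ e, tailMoment P (Y n e) (τ n * s) ≤ gaussConst / n ^ 2 := fun e => by
      refine (tailMoment_gaussian_le (hY_meas n e) (hY_gauss n e) (hYre e) (hYim e) ?_ ?_
        (by linarith : 0 < τ n * s)).trans (div_le_div_of_nonneg_left hG (by positivity) hK12)
      · rw [hY_re_re]; linarith [hsumX e, p2 e]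
      · rw [hY_im_im]; linarith [hsumX e, p1 e]
    refine (Finset.sum_le_sum fun e _ => this e).trans ?_
    rw [Finset.sum_const, Finset.card_univ, nsmul_eq_mul]
    calc (Fintype.card (Entry (N n)) : ℝ) * (gaussConst / n ^ 2)
        ≤ (m * c ^ 2 * n ^ 2) * (gaussConst / n ^ 2) := by gcongr
      _ = _ := by field_simp
  have hLX : ∑ e, tailMoment P (X n e) (τ n * s) = n ^ 2 * lindebergSum P n (X n) (τ n) := by
    rw [lindebergSum, ← mul_assoc, mul_one_div_cancel (by positivity), one_mul]
    rfl
  have hT : ∑ e, (tailMoment P (X n e) (τ n * s) + tailMoment P (Y n e) (τ n * s))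
      ≤ n ^ 2 * (Λ n * τ n ^ 4) := by
    rw [Finset.sum_add_distrib, hLX]
    have h1 : Λ n * τ n ^ 4 = lindebergSum P n (X n) (τ n)
        + m * c ^ 2 * gaussConst * τ n ^ 6 := by
      simp only [hΛdef]
      field_simp
    rw [h1, mul_add]
    -- This absorbs the bounded Gaussian contribution into the second term of Λ, which vanishes in
    -- the limit although it was divided by τ⁴.
    have h2 : (1 : ℝ) ≤ n ^ 2 * τ n ^ 6 := by
      have : (n : ℝ) ^ 2 * τ n ^ 6 = (τ n ^ 3 * n) ^ 2 := by ring
      rw [this]; exact one_le_pow₀ hτ3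
    have h3 : (0 : ℝ) ≤ m * c ^ 2 * gaussConst := by positivity
    nlinarith
  have hκ : ∀ e : Entry (N n), normFactor e ≤ Real.sqrt c / s := fun e => by
    have hNpos : (0 : ℝ) < N n e.1.succ := by
      have := hn2 e.1
      by_contra h
      nlinarith [not_lt.1 h]
    rw [normFactor, inv_eq_one_div, div_le_div_iff₀ (Real.sqrt_pos.2 hNpos) hs0, one_mul,
      ← Real.sqrt_mul (by linarith)]
    exact Real.sqrt_le_sqrt (hn2 e.1)
  have main := integral_abs_resTr_sub_le hn (hF n) (hX_meas n) (hY_meas n) (h_indep n) (hX_var n)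
    hY2 hX0 hY0 hXY (abs_nonneg C₀) (hrank n) α hv hK hA0 hA1 hA2 (hA n hn) hκ (by positivity) hT
  rw [← hC, ← hs, hvw] at main
  refine main.trans ?_
  have hL0 : 0 ≤ Λ n := by
    have : 0 ≤ ∑ e, (tailMoment P (X n e) (τ n * s) + tailMoment P (Y n e) (τ n * s)) :=
      Finset.sum_nonneg fun e _ => add_nonneg tailMoment_nonneg tailMoment_nonneg
    have h1 := this.trans hT
    by_contra h
    have h2 : (0 : ℝ) < n ^ 2 * τ n ^ 4 := by positivity
    nlinarith [mul_pos h2 (neg_pos.2 (not_le.1 h))]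
  have hC0 : 0 ≤ C := abs_nonneg _
  rw [comparisonBound, hvw]
  have b1 : Real.sqrt ((∑ q : Fin m, (N n q.castSucc : ℝ)) * (4 / w / n * C) ^ 2)
      ≤ Real.sqrt (m * c * (4 / w * C) ^ 2 * r n) := by
    apply Real.sqrt_le_sqrt
    calc _ ≤ (m * c * n) * (4 / w / n * C) ^ 2 := by gcongr
      _ = _ := by simp only [r]; field_simp
  have b2 : 4 / w / n * (C * (n ^ 2 * (Λ n * τ n ^ 4) / (τ n * s) ^ 2))
      = 4 / w * C * (Λ n * τ n ^ 2) := by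
    rw [mul_pow, hs2]; field_simp
  have b3 : (4 * A₀ * (Real.sqrt c / s) / (τ n * s) * (n ^ 2 * (Λ n * τ n ^ 4))
      + 20 * A₁ * (Real.sqrt c / s) ^ 2 * (n ^ 2 * (Λ n * τ n ^ 4))
      + 64 * A₂ * (Real.sqrt c / s) ^ 3 * (τ n * s) * Fintype.card (Entry (N n))) / (v * n)
      ≤ (4 * A₀ * Real.sqrt c * (Λ n * τ n ^ 3) + 20 * A₁ * c * (Λ n * τ n ^ 4)
      + 64 * A₂ * Real.sqrt c ^ 3 * (m * c ^ 2) * τ n) / v := by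
    have hc0 : 0 ≤ Real.sqrt c := Real.sqrt_nonneg _
    have hcc : Real.sqrt c ^ 2 = c := Real.sq_sqrt (by linarith)
    calc _ ≤ (4 * A₀ * (Real.sqrt c / s) / (τ n * s) * (n ^ 2 * (Λ n * τ n ^ 4))
      + 20 * A₁ * (Real.sqrt c / s) ^ 2 * (n ^ 2 * (Λ n * τ n ^ 4))
      + 64 * A₂ * (Real.sqrt c / s) ^ 3 * (τ n * s) * (m * c ^ 2 * n ^ 2)) / (v * n) := by gcongr
      _ = (4 * A₀ * Real.sqrt c * (Λ n * τ n ^ 3) + 20 * A₁ * Real.sqrt c ^ 2 * (Λ n * τ n ^ 4)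
      + 64 * A₂ * Real.sqrt c ^ 3 * (m * c ^ 2) * τ n) / v := by
        rw [← hs2]; field_simp
      _ = _ := by rw [hcc]
  linarith

end Limit

/-! ### Logarithmic potentials in terms of singular values -/

section LogPotential

/-- Subadditivity gives (1 + x)^q ≤ 1 + x^q; then log y ≤ y - 1. An arbitrarily small moment thus
controls logarithms. -/
lemma log_one_add_le_rpow {x q : ℝ} (hx : 0 ≤ x) (hq : 0 < q) (hq1 : q ≤ 1) :
    Real.log (1 + x) ≤ x ^ q / q := by
  have h1 := Real.rpow_add_le_add_rpow zero_le_one hx hq.le hq1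
  rw [Real.one_rpow] at h1
  have h2 : Real.log ((1 + x) ^ q) ≤ x ^ q := by
    have h3 := Real.log_le_sub_one_of_pos (by positivity : 0 < (1 + x) ^ q)
    linarith
  rw [Real.log_rpow (by linarith)] at h2
  rw [le_div_iff₀ hq]
  linarith

lemma sum_range_sv {n : ℕ} (A : Matrix (Fin n) (Fin n) ℂ) (g : ℝ → ℝ) :
    ∑ j ∈ Finset.range n, g (sv A j) = ∑ k ∈ Finset.Icc 1 n, g (singVal A k) := by
  have h := Finset.sum_Ico_add' (fun k => g (singVal A k)) 0 n 1
  rw [Finset.range_eq_Ico]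
  have h2 : Finset.Icc 1 n = Finset.Ico (0 + 1) (n + 1) := by
    ext k; simp only [Finset.mem_Icc, Finset.mem_Ico]; omega
  rw [h2, ← h]
  rfl

lemma singVal_antitone {n : ℕ} (A : Matrix (Fin n) (Fin n) ℂ) : Antitone (singVal A) :=
  fun i j hij => sv_antitone A (by omega : i - 1 ≤ j - 1)

variable {n : ℕ} (A : Matrix (Fin n) (Fin n) ℂ)

/-- The contribution of the large singular values to the logarithmic potential. -/
lemma mean_log_one_add_div_le (hn : 1 ≤ n) (α : ℂ) {a p q : ℝ} (ha : 0 < a)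
    (hq : 0 < q) (hq1 : q ≤ 1) (hqp : 2 * q ≤ p) :
    (1 / (n : ℝ)) * ∑ j ∈ Finset.range n, Real.log (1 + sv (A - α • 1) j ^ 2 / a)
      ≤ Real.log (1 + 2 * ‖α‖ ^ 2 / a)
        + (2 / a) ^ q / q * (1 + (1 / (n : ℝ)) * ∑ k ∈ Finset.Icc 1 n, singVal A k ^ p) := by
  have hn' : (0 : ℝ) < n := by exact_mod_cast hn
  rw [← sum_range_sv A (fun x => x ^ p)]
  have hx : ∀ (B : Matrix (Fin n) (Fin n) ℂ) j, 0 ≤ sv B j ^ 2 / a := fun B j => by positivity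
  have hy : ∀ j, 0 ≤ 2 * sv A j ^ 2 / a := fun j => by positivity
  have hα : 0 ≤ 2 * ‖α‖ ^ 2 / a := by positivity
  have hlog : ∀ x : ℝ, 0 ≤ x → Real.log (1 + x / a) = Real.log (x + a) - Real.log a := by
    intro x hx
    rw [← Real.log_div (by positivity) ha.ne']
    congr 1
    field_simp
    ring
  have h1 : ∑ j ∈ Finset.range n, Real.log (1 + sv (A - α • 1) j ^ 2 / a)
      ≤ ∑ j ∈ Finset.range n, Real.log (1 + (2 * sv A j ^ 2 + 2 * ‖α‖ ^ 2) / a) := by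
    have e1 : ∀ j ∈ Finset.range n, Real.log (1 + sv (A - α • 1) j ^ 2 / a)
        = Real.log (sv (A - α • 1) j ^ 2 + a) - Real.log a := fun j _ => hlog _ (sq_nonneg _)
    have e2 : ∀ j ∈ Finset.range n, Real.log (1 + (2 * sv A j ^ 2 + 2 * ‖α‖ ^ 2) / a)
        = Real.log (2 * sv A j ^ 2 + (2 * ‖α‖ ^ 2 + a)) - Real.log a := fun j _ => by
      rw [hlog _ (by positivity), add_assoc]
    rw [Finset.sum_congr rfl e1, Finset.sum_congr rfl e2, Finset.sum_sub_distrib,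
      Finset.sum_sub_distrib]
    refine sub_le_sub_right ?_ _
    rw [← Real.log_prod (fun j _ => by positivity), ← Real.log_prod (fun j _ => by positivity)]
    exact Real.log_le_log (Finset.prod_pos fun j _ => by positivity)
      (prod_sv_sub_smul_le A α ha.le)
  have h2 : ∀ j, Real.log (1 + (2 * sv A j ^ 2 + 2 * ‖α‖ ^ 2) / a)
      ≤ Real.log (1 + 2 * ‖α‖ ^ 2 / a) + (2 / a) ^ q / q * (1 + sv A j ^ p) := by
    intro j
    have h3 : Real.log (1 + (2 * sv A j ^ 2 + 2 * ‖α‖ ^ 2) / a)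
        ≤ Real.log (1 + 2 * ‖α‖ ^ 2 / a) + Real.log (1 + 2 * sv A j ^ 2 / a) := by
      rw [← Real.log_mul (by positivity) (by positivity)]
      refine Real.log_le_log (by positivity) ?_
      have h4 : 0 ≤ 2 * ‖α‖ ^ 2 / a * (2 * sv A j ^ 2 / a) := mul_nonneg hα (hy j)
      have h5 : (2 * sv A j ^ 2 + 2 * ‖α‖ ^ 2) / a = 2 * sv A j ^ 2 / a + 2 * ‖α‖ ^ 2 / a :=
        add_div _ _ _
      rw [h5]
      linarith
    refine h3.trans (add_le_add_right ((log_one_add_le_rpow (hy j) hq hq1).trans ?_) _)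
    have hs := sv_nonneg A j
    have h6 : (2 * sv A j ^ 2 / a) ^ q = (2 / a) ^ q * (sv A j) ^ (2 * q) := by
      rw [mul_div_right_comm, Real.mul_rpow (by positivity) (by positivity), Real.rpow_mul hs]
      norm_num
    have h7 : sv A j ^ (2 * q) ≤ 1 + sv A j ^ p := by
      have h0 := Real.rpow_nonneg hs p
      rcases le_total (sv A j) 1 with h | h
      · have := Real.rpow_le_one hs h (by linarith : 0 ≤ 2 * q)
        linarith
      · have := Real.rpow_le_rpow_of_exponent_le h hqp
        linarith
    rw [h6, mul_div_right_comm]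
    exact mul_le_mul_of_nonneg_left h7 (by positivity)
  calc (1 / (n : ℝ)) * ∑ j ∈ Finset.range n, Real.log (1 + sv (A - α • 1) j ^ 2 / a)
      ≤ (1 / (n : ℝ)) * ∑ j ∈ Finset.range n,
        (Real.log (1 + 2 * ‖α‖ ^ 2 / a) + (2 / a) ^ q / q * (1 + sv A j ^ p)) := by
        exact mul_le_mul_of_nonneg_left (h1.trans (Finset.sum_le_sum fun j _ => h2 j))
          (by positivity)
    _ = _ := by
        rw [Finset.sum_add_distrib, ← Finset.mul_sum, Finset.sum_add_distrib]
        simp only [Finset.sum_const, Finset.card_range, nsmul_eq_mul]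
        field_simp

/-- The contribution of the small singular values to the logarithmic potential. -/
lemma sum_log_one_add_div_le {s : ℕ → ℝ} (hs : Antitone s) {n ν₁ ν₂ : ℕ} (h1 : 1 ≤ ν₁)
    (h12 : ν₁ ≤ ν₂) (h2n : ν₂ ≤ n) {ρ b t l : ℝ} (hρ : 0 < ρ) (hρ1 : ρ ≤ 1) (hρs : ρ ≤ s n)
    (hb : 0 < b) (hb1 : b ≤ 1) (ht : ∑ j ∈ Finset.Icc ν₁ ν₂, |Real.log (s j)| ≤ t)
    (hl : 0 < l) (hl2 : l ≤ (ν₂ : ℝ) + 1 - ν₁) :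
    ∑ j ∈ Finset.Icc 1 n, Real.log (1 + b / s j ^ 2)
      ≤ n * (b * Real.exp (2 * t / l)) + n * b + 2 * t
        + (n - ν₂) * (Real.log 2 + 2 * Real.log ρ⁻¹) := by
  have hpos : ∀ j ∈ Finset.Icc 1 n, 0 < s j := fun j hj =>
    hρ.trans_le (hρs.trans (hs (Finset.mem_Icc.1 hj).2))
  have hn0 : 1 ≤ n := h1.trans (h12.trans h2n)
  have hsν : 0 < s ν₁ := hpos _ (Finset.mem_Icc.2 ⟨h1, h12.trans h2n⟩)
  have hlρ : 0 ≤ Real.log ρ⁻¹ := Real.log_nonneg (one_le_inv_iff₀.2 ⟨hρ, hρ1⟩)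
  -- If s_ν₁ < 1, every |log s_j| in the block is at least |log s_ν₁|, and the block has at least l
  -- members. This bounds from below all singular values before the block.
  have hkey : -Real.log (s ν₁) ≤ t / l := by
    have h0 : 0 ≤ t := (Finset.sum_nonneg fun j _ => abs_nonneg _).trans ht
    by_cases hlog : 0 ≤ Real.log (s ν₁)
    · have : 0 ≤ t / l := by positivity
      linarith
    · rw [not_le] at hlog
      rw [le_div_iff₀ hl]
      have h3 : ∑ _j ∈ Finset.Icc ν₁ ν₂, -Real.log (s ν₁) ≤ t := by
        refine (Finset.sum_le_sum fun j hj => ?_).trans ht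
        obtain ⟨hj1, hj2⟩ := Finset.mem_Icc.1 hj
        have := Real.log_le_log (hpos j (Finset.mem_Icc.2 ⟨h1.trans hj1, hj2.trans h2n⟩)) (hs hj1)
        rw [abs_of_neg (by linarith)]
        linarith
      rw [Finset.sum_const, Nat.card_Icc, nsmul_eq_mul, Nat.cast_sub (by omega)] at h3
      push_cast at h3
      nlinarith
  set E := Real.exp (2 * t / l) with hE
  have hinv : (s ν₁ ^ 2)⁻¹ ≤ E := by
    rw [hE, ← Real.exp_log (inv_pos.2 (pow_pos hsν 2)), Real.log_inv, Real.log_pow]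
    refine Real.exp_le_exp.2 ?_
    push_cast
    rw [mul_div_assoc]
    linarith
  have hpt : ∀ j ∈ Finset.Icc 1 n, Real.log (1 + b / s j ^ 2) ≤ (b * E + b)
      + (if j ∈ Finset.Icc ν₁ ν₂ then 2 * |Real.log (s j)| else 0)
      + (if j ∈ Finset.Ioc ν₂ n then Real.log 2 + 2 * Real.log ρ⁻¹ else 0) := by
    intro j hj
    have hj0 := hpos j hj
    have hEb : 0 < b * E := by positivity
    have hl2 : 0 < Real.log 2 := Real.log_pos (by norm_num)
    have hx : 0 ≤ b / s j ^ 2 := by positivity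
    obtain ⟨hj1, hj2⟩ := Finset.mem_Icc.1 hj
    -- Before the block s_j ≥ s_ν₁; inside it log(1 + b/s²) ≤ b + 2|log s|; beyond it only the floor
    -- ρ is available, for the n - ν₂ last indices.
    by_cases c1 : j < ν₁
    · rw [if_neg (by simp; omega), if_neg (by simp; omega)]
      have h3 := Real.log_le_sub_one_of_pos (by positivity : 0 < 1 + b / s j ^ 2)
      have h4 : b / s j ^ 2 ≤ b * E := by
        rw [div_eq_mul_inv]
        refine mul_le_mul_of_nonneg_left (le_trans ?_ hinv) hb.le
        exact inv_anti₀ (by positivity) (pow_le_pow_left₀ hsν.le (hs c1.le) 2)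
      linarith
    · by_cases c2 : j ≤ ν₂
      · rw [if_pos (by simp; omega), if_neg (by simp; omega)]
        have h3 : Real.log (1 + b / s j ^ 2) = Real.log (s j ^ 2 + b) - 2 * Real.log (s j) := by
          rw [show 1 + b / s j ^ 2 = (s j ^ 2 + b) / s j ^ 2 by field_simp,
            Real.log_div (by positivity) (by positivity), Real.log_pow]
          norm_num
        rcases le_total (s j) 1 with h | h
        · rw [h3, abs_of_nonpos (Real.log_nonpos hj0.le h)]
          have h4 := Real.log_le_sub_one_of_pos (by positivity : 0 < s j ^ 2 + b)
          have h5 : s j ^ 2 ≤ 1 := pow_le_one₀ hj0.le h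
          linarith
        · have h4 := Real.log_le_sub_one_of_pos (by positivity : 0 < 1 + b / s j ^ 2)
          have h5 : b / s j ^ 2 ≤ b := div_le_self hb.le (one_le_pow₀ h)
          have := abs_nonneg (Real.log (s j))
          linarith
      · rw [if_neg (by simp; omega), if_pos (by simp; omega)]
        have h3 : 1 + b / s j ^ 2 ≤ 2 * ρ⁻¹ ^ 2 := by
          have h4 : b / s j ^ 2 ≤ ρ⁻¹ ^ 2 := by
            rw [inv_pow, ← one_div]
            exact div_le_div₀ zero_le_one hb1 (by positivity)
              (pow_le_pow_left₀ hρ.le (hρs.trans (hs hj2)) 2)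
          have h5 : (1 : ℝ) ≤ ρ⁻¹ ^ 2 := one_le_pow₀ (one_le_inv_iff₀.2 ⟨hρ, hρ1⟩)
          linarith
        have h4 := Real.log_le_log (by positivity) h3
        rw [Real.log_mul (by norm_num) (by positivity), Real.log_pow] at h4
        push_cast at h4
        linarith
  refine (Finset.sum_le_sum hpt).trans ?_
  rw [Finset.sum_add_distrib, Finset.sum_add_distrib, Finset.sum_ite_mem, Finset.sum_ite_mem,
    Finset.inter_eq_right.2 (Finset.Icc_subset_Icc h1 h2n),
    Finset.inter_eq_right.2 (fun j hj => by simp at hj ⊢; omega), ← Finset.mul_sum]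
  simp only [Finset.sum_const, Nat.card_Icc, Nat.card_Ioc, nsmul_eq_mul]
  rw [Nat.cast_sub h2n, Nat.add_sub_cancel]
  linarith

/-- The logarithmic potential as an integral of resolvent traces, up to the contributions of the
small and of the large singular values. -/
lemma two_mul_log_det_eq (hn : 1 ≤ n) (hpos : ∀ j ∈ Finset.range n, 0 < sv A j) {a b : ℝ}
    (hb : 0 < b) (hba : b ≤ a) :
    2 * ((1 / (n : ℝ)) * Real.log ‖A.det‖)
      = Real.log a + (1 / (n : ℝ)) * ∑ j ∈ Finset.range n, Real.log (1 + sv A j ^ 2 / a)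
        - (∫ w in b..a, resTr A w)
        - (1 / (n : ℝ)) * ∑ j ∈ Finset.range n, Real.log (1 + b / sv A j ^ 2) := by
  have ha : 0 < a := hb.trans_le hba
  have hn' : (0 : ℝ) < n := by exact_mod_cast hn
  have hint : ∫ w in b..a, resTr A w = (1 / (n : ℝ)) * ∑ j ∈ Finset.range n,
      (Real.log (sv A j ^ 2 + a) - Real.log (sv A j ^ 2 + b)) := by
    have h1 : ∫ w in b..a, resTr A w
        = ∫ w in b..a, (1 / (n : ℝ)) * ∑ j ∈ Finset.range n, (sv A j ^ 2 + w)⁻¹ := by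
      refine intervalIntegral.integral_congr fun w hw => ?_
      rw [Set.uIcc_of_le hba] at hw
      exact resTr_eq A (hb.trans_le hw.1)
    have hii : ∀ j, IntervalIntegrable (fun w => (sv A j ^ 2 + w)⁻¹) volume b a := fun j => by
      refine ContinuousOn.intervalIntegrable (ContinuousOn.inv₀ (by fun_prop) fun w hw => ?_)
      rw [Set.uIcc_of_le hba] at hw
      have := hb.trans_le hw.1
      positivity
    rw [h1, intervalIntegral.integral_const_mul,
      intervalIntegral.integral_finsetSum fun j _ => hii j]
    congr 1
    refine Finset.sum_congr rfl fun j _ => ?_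
    rw [intervalIntegral.integral_comp_add_left (fun w => w⁻¹) (sv A j ^ 2),
      integral_inv_of_pos (by positivity) (by positivity),
      Real.log_div (by positivity) (by positivity)]
  have hdet : 2 * Real.log ‖A.det‖ = ∑ j ∈ Finset.range n, 2 * Real.log (sv A j) := by
    have h1 : 2 * Real.log ‖A.det‖ = Real.log (‖A.det‖ ^ 2) := by rw [Real.log_pow]; norm_num
    rw [h1, norm_det_sq, Real.log_prod fun j hj => (pow_pos (hpos j hj) 2).ne']
    refine Finset.sum_congr rfl fun j _ => ?_
    rw [Real.log_pow]; norm_num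
  have e1 : 2 * ((1 / (n : ℝ)) * Real.log ‖A.det‖) = (1 / (n : ℝ)) *
      ∑ j ∈ Finset.range n, 2 * Real.log (sv A j) := by rw [← hdet]; ring
  have e2 : Real.log a = (1 / (n : ℝ)) * ∑ _j ∈ Finset.range n, Real.log a := by
    rw [Finset.sum_const, Finset.card_range, nsmul_eq_mul]; field_simp
  rw [hint, e1, e2, ← mul_add, ← mul_sub, ← mul_sub, ← Finset.sum_add_distrib,
    ← Finset.sum_sub_distrib, ← Finset.sum_sub_distrib]
  congr 1
  refine Finset.sum_congr rfl fun j hj => ?_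
  have hj0 := hpos j hj
  rw [show 1 + sv A j ^ 2 / a = (sv A j ^ 2 + a) / a by field_simp; ring,
    show 1 + b / sv A j ^ 2 = (sv A j ^ 2 + b) / sv A j ^ 2 by field_simp,
    Real.log_div (by positivity) (by positivity), Real.log_div (by positivity) (by positivity),
    Real.log_pow]
  push_cast
  ring

end LogPotential

/-! ### Uniform smallness of the tails of the logarithmic potentials -/

section Tails

variable {Ω : Type*} [MeasurableSpace Ω] {P : Measure Ω}
  {M : (n : ℕ) → Ω → Matrix (Fin n) (Fin n) ℂ}

lemma eventually_prob_upper_le (hC0 : CondC0 P M) (α : ℂ) {ε : ℝ} (hε : 0 < ε) {η : ENNReal}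
    (hη : 0 < η) :
    ∀ᶠ a : ℝ in atTop, ∀ᶠ n : ℕ in atTop,
      P {ω | ε < (1 / (n : ℝ)) *
        ∑ j ∈ Finset.range n, Real.log (1 + sv (M n ω - α • 1) j ^ 2 / a)} ≤ η := by
  obtain ⟨p, hp, h⟩ := hC0
  obtain ⟨K, hK⟩ := h η hη
  -- q ≤ 1 is needed for subadditivity, 2q ≤ p for domination by the moment in (C0).
  set q := min (p / 2) 1 with hq
  have hq0 : 0 < q := lt_min (by linarith) one_pos
  have hq1 : q ≤ 1 := min_le_right _ _
  have hqp : 2 * q ≤ p := by linarith [min_le_left (p / 2) 1]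
  have hlim : Tendsto (fun a : ℝ => Real.log (1 + 2 * ‖α‖ ^ 2 / a) + (2 / a) ^ q / q * (1 + K))
      atTop (𝓝 0) := by
    have h1 : Tendsto (fun a : ℝ => 2 * ‖α‖ ^ 2 / a) atTop (𝓝 0) :=
      tendsto_const_nhds.div_atTop tendsto_id
    have h2 : Tendsto (fun a : ℝ => 2 / a) atTop (𝓝 0) := tendsto_const_nhds.div_atTop tendsto_id
    have h3 : Tendsto (fun a : ℝ => Real.log (1 + 2 * ‖α‖ ^ 2 / a)) atTop (𝓝 0) := by
      have := ((h1.const_add 1).log (by norm_num))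
      simpa using this
    have h4 : Tendsto (fun a : ℝ => (2 / a) ^ q / q * (1 + K)) atTop (𝓝 0) := by
      have := ((h2.rpow_const (p := q) (Or.inr hq0.le)).div_const q).mul_const (1 + K)
      simpa [Real.zero_rpow hq0.ne'] using this
    simpa using h3.add h4
  filter_upwards [hlim.eventually (gt_mem_nhds hε), eventually_gt_atTop 0] with a ha ha0
  filter_upwards [hK, eventually_ge_atTop 1] with n hn hn1
  refine le_trans (measure_mono fun ω hω => ?_) hn
  simp only [Set.mem_ofPred_eq] at hω ⊢
  by_contra hcon
  have h1 := mean_log_one_add_div_le (M n ω) hn1 α ha0 hq0 hq1 hqp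
  have h2 : (2 / a) ^ q / q * (1 + (1 / (n : ℝ)) * ∑ k ∈ Finset.Icc 1 n, singVal (M n ω) k ^ p)
      ≤ (2 / a) ^ q / q * (1 + K) := by
    refine mul_le_mul_of_nonneg_left ?_ (by positivity)
    linarith [not_lt.1 hcon]
  linarith

/-- In (C2) the fraction of the small singular values may be fixed. -/
lemma exists_fraction (hC2 : CondC2 P M) (α : ℂ) :
    ∃ γ : ℝ, 0 < γ ∧ γ < 1 ∧ ∀ ε : ℝ, 0 < ε → ∀ η : ENNReal, 0 < η →
      ∃ δ : ℝ, 0 < δ ∧ δ ≤ 1 ∧ ∀ᶠ n : ℕ in atTop,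
        P {ω | (∃ j ∈ Finset.Icc (⌊(n : ℝ) - n * δ⌋₊ + 1) ⌊(n : ℝ) - (n : ℝ) ^ γ⌋₊,
            singVal (M n ω - α • 1) j = 0) ∨
          ε < (1 / (n : ℝ)) *
            ∑ j ∈ Finset.Icc (⌊(n : ℝ) - n * δ⌋₊ + 1) ⌊(n : ℝ) - (n : ℝ) ^ γ⌋₊,
              |Real.log (singVal (M n ω - α • 1) j)|} ≤ η := by
  obtain ⟨γ, h0, h1, h⟩ := hC2 α
  refine ⟨γ, h0, h1, fun ε hε η hη => ?_⟩
  set E : ℝ → ℕ → Set Ω := fun δ n =>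
    {ω | (∃ j ∈ Finset.Icc (⌊(n : ℝ) - n * δ⌋₊ + 1) ⌊(n : ℝ) - (n : ℝ) ^ γ⌋₊,
            singVal (M n ω - α • 1) j = 0) ∨
          ε < (1 / (n : ℝ)) *
            ∑ j ∈ Finset.Icc (⌊(n : ℝ) - n * δ⌋₊ + 1) ⌊(n : ℝ) - (n : ℝ) ^ γ⌋₊,
              |Real.log (singVal (M n ω - α • 1) j)|} with hE
  change ∃ δ : ℝ, 0 < δ ∧ δ ≤ 1 ∧ ∀ᶠ n : ℕ in atTop, P (E δ n) ≤ η
  by_contra! hcon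
  have hfreq : ∀ k : ℕ, ∃ᶠ n : ℕ in atTop, η < P (E (1 / ((k : ℝ) + 1)) n) := fun k => by
    have := hcon (1 / ((k : ℝ) + 1)) (by positivity)
      (by rw [div_le_one (by positivity)]; linarith [(Nat.cast_nonneg k : (0 : ℝ) ≤ k)])
    simpa only [not_le] using this
  -- If no fraction works, δ = 1/(k+1) fails at arbitrarily large n, chosen increasingly as φ k. The
  -- sequence with these values along φ and 0 elsewhere tends to 0 and contradicts (C2).
  obtain ⟨φ, hφ, hφP⟩ := extraction_forall_of_frequently hfreq
  set δ : ℕ → ℝ := Function.extend φ (fun k => 1 / ((k : ℝ) + 1)) 0 with hδ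
  have hδφ : ∀ k, δ (φ k) = 1 / ((k : ℝ) + 1) := fun k => hφ.injective.extend_apply _ _ k
  have hδ0 : Tendsto δ atTop (𝓝 0) := by
    rw [Metric.tendsto_atTop]
    intro r hr
    obtain ⟨k₀, hk₀⟩ := exists_nat_one_div_lt hr
    refine ⟨φ k₀, fun n hn => ?_⟩
    rw [Real.dist_0_eq_abs]
    by_cases hex : ∃ k, φ k = n
    · obtain ⟨k, rfl⟩ := hex
      have hk : k₀ ≤ k := hφ.le_iff_le.1 hn
      rw [hδφ, abs_of_nonneg (by positivity)]
      refine lt_of_le_of_lt (one_div_le_one_div_of_le (by positivity) ?_) hk₀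
      exact_mod_cast Nat.succ_le_succ hk
    · rw [hδ, Function.extend_apply' _ _ _ hex]
      simpa using hr
  have hlim := (h δ hδ0 ε hε).comp hφ.tendsto_atTop
  obtain ⟨k, hk⟩ := (hlim.eventually (gt_mem_nhds hη)).exists
  have hk' : P (E (δ (φ k)) (φ k)) < η := hk
  rw [hδφ] at hk'
  exact lt_asymm hk' (hφP k)

/-- At most n^γ + 1 indices lie beyond the range of (C2), and by (C1) each costs O(log n); since γ <
1 their share vanishes. -/
lemma tendsto_rpow_mul_log {γ : ℝ} (hγ1 : γ < 1) (c₁ c₂ : ℝ) :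
    Tendsto (fun n : ℕ => ((n : ℝ) ^ γ + 1) / n * (c₁ + c₂ * Real.log n)) atTop (𝓝 0) := by
  have hr : 0 < 1 - γ := by linarith
  have h1 : Tendsto (fun x : ℝ => Real.log x / x ^ (1 - γ)) atTop (𝓝 0) :=
    (isLittleO_log_rpow_atTop hr).tendsto_div_nhds_zero
  have h1' : Tendsto (fun x : ℝ => Real.log x / x ^ (1 : ℝ)) atTop (𝓝 0) :=
    (isLittleO_log_rpow_atTop one_pos).tendsto_div_nhds_zero
  have h2 : Tendsto (fun x : ℝ => x ^ (-(1 - γ))) atTop (𝓝 0) := tendsto_rpow_neg_atTop hr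
  have h2' : Tendsto (fun x : ℝ => x ^ (-(1 : ℝ))) atTop (𝓝 0) := tendsto_rpow_neg_atTop one_pos
  have h3 := (((h2.add h2').const_mul c₁).add ((h1.add h1').const_mul c₂)).comp
    (tendsto_natCast_atTop_atTop (R := ℝ))
  simp only [mul_zero, add_zero] at h3
  refine h3.congr' ?_
  filter_upwards [eventually_gt_atTop 0] with n hn
  have hn' : (0 : ℝ) < n := by exact_mod_cast hn
  simp only [Function.comp_apply, Real.rpow_neg hn'.le, Real.rpow_one, Real.rpow_sub hn']
  field_simp

lemma exists_prob_lower_le (hC1 : CondC1 P M) (hC2 : CondC2 P M) (α : ℂ) {ε : ℝ} (hε : 0 < ε)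
    {η : ENNReal} (hη : 0 < η) :
    ∃ b₀ : ℝ, 0 < b₀ ∧ ∀ b : ℝ, 0 < b → b ≤ b₀ → ∀ᶠ n : ℕ in atTop,
      P {ω | (∃ j ∈ Finset.range n, sv (M n ω - α • 1) j = 0) ∨ ε < (1 / (n : ℝ)) *
        ∑ j ∈ Finset.range n, Real.log (1 + b / sv (M n ω - α • 1) j ^ 2)} ≤ η := by
  obtain ⟨Q, hQ, h1⟩ := hC1 α
  obtain ⟨γ, hγ0, hγ1, h2⟩ := exists_fraction hC2 α
  have hη2 : 0 < η / 2 := ENNReal.half_pos hη.ne'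
  obtain ⟨δ, hδ, hδ1, h3⟩ := h2 (ε / 8) (by positivity) (η / 2) hη2
  -- The exponent is 2t/l with block sum t = nε/8 and block length l = nδ/2. The choice of b gives
  -- b(E + 1) ≤ ε/4, and the three ranges of indices cost at most ε/4 each.
  set E := Real.exp (ε / (2 * δ)) with hE
  refine ⟨min 1 (ε / (4 * (E + 1))), lt_min one_pos (by positivity), fun b hb hbb => ?_⟩
  have hb1 : b ≤ 1 := hbb.trans (min_le_left _ _)
  have hbE : b * (E + 1) ≤ ε / 4 := by
    have := hbb.trans (min_le_right _ _)
    rw [le_div_iff₀ (by positivity)] at this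
    linarith
  have h4 := (tendsto_rpow_mul_log hγ1 (Real.log 2) (2 * Q)).eventually
    (gt_mem_nhds (by positivity : 0 < ε / 4))
  -- Eventually n^γ + 1 < nδ/2, so at least nδ/2 indices remain in the block.
  have h5 := (tendsto_rpow_mul_log hγ1 1 0).eventually
    (gt_mem_nhds (by positivity : 0 < δ / 2))
  filter_upwards [h3, h1.eventually (gt_mem_nhds hη2), h4, h5, eventually_ge_atTop 1]
    with n e3 e1 e4 e5 hn
  have hn' : (0 : ℝ) < n := by exact_mod_cast hn
  have hn1 : (1 : ℝ) ≤ n := by exact_mod_cast hn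
  refine le_trans (measure_mono ?_) ((measure_union_le _ _).trans
    ((add_le_add e3 e1.le).trans_eq (ENNReal.add_halves η)))
  intro ω hω
  by_contra hcon
  simp only [Set.mem_union, Set.mem_ofPred_eq, not_or, not_lt, not_le] at hcon hω
  obtain ⟨⟨_, hmid⟩, hlast⟩ := hcon
  set ν₁ := ⌊(n : ℝ) - n * δ⌋₊ + 1
  set ν₂ := ⌊(n : ℝ) - (n : ℝ) ^ γ⌋₊
  have hnγ : (n : ℝ) ^ γ ≤ n := by
    simpa using Real.rpow_le_rpow_of_exponent_le hn1 hγ1.le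
  have hν₂ : (n : ℝ) - (n : ℝ) ^ γ - 1 < ν₂ := Nat.sub_one_lt_floor _
  have hν₂n : ν₂ ≤ n := by
    refine Nat.floor_le_of_le ?_
    have := Real.rpow_nonneg hn'.le γ
    linarith
  rw [zero_mul, add_zero, mul_one, div_lt_iff₀ hn'] at e5
  have hbnd : (n : ℝ) * δ / 2 ≤ (ν₂ : ℝ) + 1 - ν₁ := by
    have : (ν₁ : ℝ) ≤ n - n * δ + 1 := by
      simp only [ν₁]
      push_cast
      have := Nat.floor_le (by nlinarith : 0 ≤ (n : ℝ) - n * δ)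
      linarith
    linarith
  have hρ : (0 : ℝ) < (n : ℝ) ^ (-Q) := Real.rpow_pos_of_pos hn' _
  have hρ1 : (n : ℝ) ^ (-Q) ≤ 1 := Real.rpow_le_one_of_one_le_of_nonpos hn1 (by linarith)
  have hpos : ∀ j ∈ Finset.range n, 0 < sv (M n ω - α • 1) j := fun j hj =>
    (hρ.trans hlast).trans_le (sv_antitone _ (by have := Finset.mem_range.1 hj; omega))
  rcases hω with ⟨j, hj, hj0⟩ | hω
  · exact (hpos j hj).ne' hj0
  rw [one_div, inv_mul_le_iff₀ hn'] at hmid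
  rw [one_div, ← div_eq_inv_mul, lt_div_iff₀ hn',
    sum_range_sv _ (fun x => Real.log (1 + b / x ^ 2))] at hω
  have h12 : ν₁ ≤ ν₂ := by
    have h0 : (0 : ℝ) < n * δ / 2 := by positivity
    have : (ν₁ : ℝ) < ν₂ + 1 := by linarith
    exact_mod_cast Nat.lt_succ_iff.1 (by exact_mod_cast this)
  have main := sum_log_one_add_div_le (singVal_antitone (M n ω - α • 1)) (Nat.le_add_left _ _)
    h12 hν₂n hρ hρ1 hlast.le hb hb1 hmid (by positivity : 0 < (n : ℝ) * δ / 2) hbnd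
  have hlogρ : Real.log ((n : ℝ) ^ (-Q))⁻¹ = Q * Real.log n := by
    rw [Real.log_inv, Real.log_rpow hn']; ring
  have hexp : 2 * (n * (ε / 8)) / (n * δ / 2) = ε / (2 * δ) := by field_simp; norm_num
  rw [hlogρ, hexp, ← hE] at main
  have hlog0 : 0 ≤ Real.log n := Real.log_nonneg hn1
  have hlog2 : 0 ≤ Real.log 2 := Real.log_nonneg (by norm_num)
  have h6 : ((n : ℝ) - ν₂) * (Real.log 2 + 2 * (Q * Real.log n)) ≤ n * (ε / 4) := by
    rw [div_mul_eq_mul_div, div_lt_iff₀ hn'] at e4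
    refine le_trans (mul_le_mul_of_nonneg_right (by linarith : (n : ℝ) - ν₂ ≤ n ^ γ + 1)
      (by positivity)) ?_
    linarith
  have h7 := mul_le_mul_of_nonneg_left hbE hn'.le
  nlinarith [mul_pos hn' hε]

end Tails

/-! ### Convergence of the logarithmic potentials -/

section Convergence

variable {Ω : Type*} [MeasurableSpace Ω] {P : Measure Ω} [IsProbabilityMeasure P]

/-- Dominated convergence in s and Fubini give convergence of the double integral of |h| to 0;
Markov's inequality then gives convergence in probability. -/
lemma tendsto_prob_abs_integral {S : Type*} [MeasurableSpace S] {ν : Measure S}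
    [IsFiniteMeasure ν] {h : ℕ → S → Ω → ℝ} (hm : ∀ n, Measurable (Function.uncurry (h n)))
    {K : ℝ} (hK : ∀ᵐ s ∂ν, ∀ n ω, |h n s ω| ≤ K)
    (hlim : ∀ᵐ s ∂ν, Tendsto (fun n => ∫ ω, |h n s ω| ∂P) atTop (𝓝 0)) {ε : ℝ} (hε : 0 < ε) :
    Tendsto (fun n => P {ω | ε < |∫ s, h n s ω ∂ν|}) atTop (𝓝 0) := by
  have hprod : ∀ n, Integrable (fun p : S × Ω => |h n p.1 p.2|) (ν.prod P) := by
    intro n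
    refine Integrable.of_bound (C := K) (hm n).abs.aestronglyMeasurable ?_
    have h1 : MeasurableSet {p : S × Ω | ‖|h n p.1 p.2|‖ ≤ K} :=
      measurableSet_le (hm n).abs.norm measurable_const
    rw [Measure.ae_prod_iff_ae_ae h1]
    filter_upwards [hK] with s hs
    refine ae_of_all _ fun ω => ?_
    rw [Real.norm_eq_abs, abs_abs]
    exact hs n ω
  have hJ : Tendsto (fun n => ∫ s, ∫ ω, |h n s ω| ∂P ∂ν) atTop (𝓝 0) := by
    have := tendsto_integral_of_dominated_convergence (μ := ν)
      (F := fun n s => ∫ ω, |h n s ω| ∂P) (f := fun _ => 0) (fun _ => K)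
      (fun n => (hprod n).integral_prod_left.aestronglyMeasurable) (integrable_const K) (by
        intro n
        filter_upwards [hK] with s hs
        have h2 := norm_integral_le_of_norm_le_const (μ := P) (f := fun ω => |h n s ω|) (C := K)
          (ae_of_all _ fun ω => by rw [Real.norm_eq_abs, abs_abs]; exact hs n ω)
        simpa using h2) hlim
    simpa using this
  have hle : ∀ n, P {ω | ε < |∫ s, h n s ω ∂ν|}
      ≤ ENNReal.ofReal ((∫ s, ∫ ω, |h n s ω| ∂P ∂ν) / ε) := by
    intro n
    have hi : Integrable (fun ω => ∫ s, |h n s ω| ∂ν) P := (hprod n).integral_prod_right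
    have h3 := mul_meas_ge_le_integral_of_nonneg (μ := P)
      (ae_of_all _ fun ω => integral_nonneg fun s => abs_nonneg (h n s ω)) hi ε
    rw [integral_integral_swap (hprod n)]
    refine (measure_mono (t := {ω | ε ≤ ∫ s, |h n s ω| ∂ν}) fun ω hω => ?_).trans ?_
    · exact (le_of_lt hω).trans abs_integral_le_integral_abs
    · rw [← ofReal_measureReal]
      refine ENNReal.ofReal_le_ofReal ?_
      rw [le_div_iff₀ hε]
      linarith
  refine tendsto_of_tendsto_of_tendsto_of_le_of_le tendsto_const_nhds ?_ (fun _ => zero_le) hle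
  have := ENNReal.tendsto_ofReal (hJ.div_const ε)
  simpa using this

lemma intervalIntegrable_resTr {n : ℕ} (A : Matrix (Fin n) (Fin n) ℂ) {a b : ℝ} (hb : 0 < b)
    (hba : b ≤ a) : IntervalIntegrable (resTr A) volume b a := by
  have h : ∀ w ∈ Set.uIcc b a, 0 < w := fun w hw => by
    rw [Set.uIcc_of_le hba] at hw; exact hb.trans_le hw.1
  refine ContinuousOn.intervalIntegrable (ContinuousOn.congr (f := fun w => (1 / (n : ℝ)) *
    ∑ j ∈ Finset.range n, (sv A j ^ 2 + w)⁻¹) ?_ fun w hw => resTr_eq A (h w hw))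
  refine continuousOn_const.mul (continuousOn_finsetSum _ fun j _ => ?_)
  exact ContinuousOn.inv₀ (by fun_prop) fun w hw => by have := h w hw; positivity

/-- The difference of the normalized logarithms of two determinants. -/
def logDetDiff {n : ℕ} (A B : Matrix (Fin n) (Fin n) ℂ) : ℝ :=
  (1 / (n : ℝ)) * Real.log ‖A.det‖ - (1 / (n : ℝ)) * Real.log ‖B.det‖

variable {M M' : (n : ℕ) → Ω → Matrix (Fin n) (Fin n) ℂ}

theorem tendsto_prob_logDetDiff (hM : ∀ n a b, Measurable fun ω => M n ω a b)
    (hM' : ∀ n a b, Measurable fun ω => M' n ω a b)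
    (hC0 : CondC0 P M) (hC1 : CondC1 P M) (hC2 : CondC2 P M)
    (hC0' : CondC0 P M') (hC1' : CondC1 P M') (hC2' : CondC2 P M') (α : ℂ)
    (hres : ∀ w : ℝ, 0 < w → Tendsto (fun n => ∫ ω, |resTr (M n ω - α • 1) w
      - resTr (M' n ω - α • 1) w| ∂P) atTop (𝓝 0)) {ε : ℝ} (hε : 0 < ε) :
    Tendsto (fun n => P {ω | ε < |logDetDiff (M n ω - α • 1) (M' n ω - α • 1)|}) atTop (𝓝 0) := by
  rw [ENNReal.tendsto_nhds_zero]
  intro η hη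
  -- Five exceptional events: the lower and the upper tail for each of the two matrices, and the
  -- integral of the resolvent difference.
  set η' := η / 5 with hη'
  have hη0 : 0 < η' := ENNReal.div_pos hη.ne' (by norm_num)
  set ε' := ε / 5 with hε'
  have hε0 : 0 < ε' := by positivity
  obtain ⟨b₁, hb₁, l1⟩ := exists_prob_lower_le hC1 hC2 α hε0 hη0
  obtain ⟨b₂, hb₂, l2⟩ := exists_prob_lower_le hC1' hC2' α hε0 hη0
  set b := min b₁ b₂
  have hb : 0 < b := lt_min hb₁ hb₂
  obtain ⟨a, hba, u1, u2⟩ := ((eventually_ge_atTop b).and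
    ((eventually_prob_upper_le hC0 α hε0 hη0).and
      (eventually_prob_upper_le hC0' α hε0 hη0))).exists
  have i1 : Tendsto (fun n => P {ω | ε' < |∫ w in Set.Ioc b a,
      (resTr (M n ω - α • 1) w - resTr (M' n ω - α • 1) w)|}) atTop (𝓝 0) := by
    refine tendsto_prob_abs_integral (ν := volume.restrict (Set.Ioc b a)) (K := b⁻¹ + b⁻¹)
      (h := fun n w ω => resTr (M n ω - α • 1) w - resTr (M' n ω - α • 1) w) ?_ ?_ ?_ hε0
    · intro n
      have hsub : ∀ {L : (n : ℕ) → Ω → Matrix (Fin n) (Fin n) ℂ},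
          (∀ n a b, Measurable fun ω => L n ω a b) → ∀ i j,
          Measurable fun p : ℝ × Ω => (L n p.2 - α • 1) i j := fun hL i j => by
        simp only [Matrix.sub_apply]
        exact ((hL n i j).comp measurable_snd).sub_const _
      exact (measurable_resTr (hsub hM) measurable_fst).sub
        (measurable_resTr (hsub hM') measurable_fst)
    · filter_upwards [ae_restrict_mem measurableSet_Ioc] with w hw n ω
      have hw0 : 0 < w := hb.trans hw.1
      refine (abs_sub _ _).trans (add_le_add ?_ ?_) <;>
        exact (abs_resTr_le _ hw0).trans (inv_anti₀ hb hw.1.le)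
    · filter_upwards [ae_restrict_mem measurableSet_Ioc] with w hw
      exact hres w (hb.trans hw.1)
  filter_upwards [l1 b hb (min_le_left _ _), l2 b hb (min_le_right _ _), u1, u2,
    (ENNReal.tendsto_nhds_zero.1 i1) η' hη0, eventually_ge_atTop 1] with n e1 e2 e3 e4 e5 hn
  have hn' : (0 : ℝ) < n := by exact_mod_cast hn
  have hsum : η' + η' + η' + η' + η' = η := by
    have : η' + η' + η' + η' + η' = 5 * η' := by ring
    rw [this, hη']
    exact ENNReal.mul_div_cancel (by norm_num) (by norm_num)
  rw [← hsum]
  refine le_trans (measure_mono ?_) ((measure_union_le _ _).trans (add_le_add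
    ((measure_union_le _ _).trans (add_le_add ((measure_union_le _ _).trans (add_le_add
    ((measure_union_le _ _).trans (add_le_add e1 e2)) e3)) e4)) e5))
  intro ω hω
  by_contra hcon
  simp only [Set.mem_union, Set.mem_ofPred_eq, not_or, not_lt, not_exists, not_and] at hcon hω
  obtain ⟨⟨⟨⟨⟨z1, c1⟩, ⟨z2, c2⟩⟩, c3⟩, c4⟩, c5⟩ := hcon
  set A := M n ω - α • 1
  set B := M' n ω - α • 1
  have ha : 0 < a := hb.trans_le hba
  have pA : ∀ j ∈ Finset.range n, 0 < sv A j := fun j hj =>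
    lt_of_le_of_ne (sv_nonneg _ _) (Ne.symm (z1 j hj))
  have pB : ∀ j ∈ Finset.range n, 0 < sv B j := fun j hj =>
    lt_of_le_of_ne (sv_nonneg _ _) (Ne.symm (z2 j hj))
  have d1 := two_mul_log_det_eq A hn pA hb hba
  have d2 := two_mul_log_det_eq B hn pB hb hba
  rw [← intervalIntegral.integral_of_le hba, intervalIntegral.integral_sub
    (intervalIntegrable_resTr A hb hba) (intervalIntegrable_resTr B hb hba)] at c5
  have nonneg1 : ∀ L : Matrix (Fin n) (Fin n) ℂ, 0 ≤ (1 / (n : ℝ)) *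
      ∑ j ∈ Finset.range n, Real.log (1 + sv L j ^ 2 / a) := fun L =>
    mul_nonneg (by positivity) (Finset.sum_nonneg fun j _ => Real.log_nonneg (by
      have : 0 ≤ sv L j ^ 2 / a := by positivity
      linarith))
  have nonneg2 : ∀ L : Matrix (Fin n) (Fin n) ℂ, 0 ≤ (1 / (n : ℝ)) *
      ∑ j ∈ Finset.range n, Real.log (1 + b / sv L j ^ 2) := fun L =>
    mul_nonneg (by positivity) (Finset.sum_nonneg fun j _ => Real.log_nonneg (by
      have : 0 ≤ b / sv L j ^ 2 := by positivity
      linarith))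
  have hA1 := nonneg1 A
  have hA2 := nonneg2 A
  have hB1 := nonneg1 B
  have hB2 := nonneg2 B
  rw [abs_le] at c5
  have : |logDetDiff A B| ≤ ε := by
    rw [logDetDiff, abs_le]
    constructor <;> linarith
  linarith

end Convergence

/-! ### Logarithmic potentials in the plane -/

section Potential

/-- The function `‖β‖⁻¹` on the closed unit disc. -/
def invDisc (β : ℂ) : ℝ := if ‖β‖ ≤ 1 then ‖β‖⁻¹ else 0

lemma invDisc_nonneg (β : ℂ) : 0 ≤ invDisc β := by
  unfold invDisc; split_ifs <;> positivity

/-- In polar coordinates the area factor cancels the singularity. -/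
lemma integrable_invDisc : Integrable invDisc := by
  have h := (integrable_fun_norm_addHaar (volume : Measure ℂ)
    (f := fun y : ℝ => if y ≤ 1 then y⁻¹ else 0)).2 (by
      rw [Complex.finrank_real_complex]
      have h1 : IntegrableOn (fun y : ℝ => (Set.Ioc (0 : ℝ) 1).indicator (fun _ => (1 : ℝ)) y)
          (Set.Ioi 0) :=
        ((integrable_indicator_iff measurableSet_Ioc).2
          (integrableOn_const (by simp))).integrableOn
      refine h1.congr_fun (fun y hy => ?_) measurableSet_Ioi
      have hy0 : (0 : ℝ) < y := hy
      by_cases hy1 : y ≤ 1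
      · simp [hy1, hy0, hy0.ne']
      · simp [hy1])
  exact h

lemma abs_log_norm_le (β : ℂ) : |Real.log ‖β‖| ≤ ‖β‖ + invDisc β := by
  rcases eq_or_ne β 0 with rfl | h0
  · simp [invDisc]
  have hpos : 0 < ‖β‖ := norm_pos_iff.2 h0
  have h1 := Real.log_le_sub_one_of_pos hpos
  have h2 := Real.log_le_sub_one_of_pos (inv_pos.2 hpos)
  rw [Real.log_inv] at h2
  have h3 := invDisc_nonneg β
  rw [abs_le]
  refine ⟨?_, by linarith⟩
  by_cases h : ‖β‖ ≤ 1
  · rw [invDisc, if_pos h]; linarith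
  · have := Real.log_nonneg (not_le.1 h).le
    linarith

lemma measurable_log_norm_sub (l : ℂ) : Measurable fun α : ℂ => Real.log ‖α - l‖ :=
  Real.measurable_log.comp (measurable_id.sub_const l).norm

lemma integrableOn_log_norm_sub (l : ℂ) (ρ : ℝ) :
    IntegrableOn (fun α : ℂ => Real.log ‖α - l‖) (Metric.closedBall 0 ρ) := by
  have h1 : IntegrableOn (fun α : ℂ => ‖α - l‖) (Metric.closedBall 0 ρ) :=
    ContinuousOn.integrableOn_compact (isCompact_closedBall _ _) (by fun_prop)
  have h2 : IntegrableOn (fun α : ℂ => invDisc (α - l)) (Metric.closedBall 0 ρ) :=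
    (integrable_invDisc.comp_sub_right l).integrableOn
  refine Integrable.mono (h1.add h2) (measurable_log_norm_sub l).aestronglyMeasurable
    (ae_of_all _ fun α => ?_)
  rw [Real.norm_eq_abs, Real.norm_eq_abs]
  exact (abs_log_norm_le (α - l)).trans (le_abs_self _)

/-- The uniform measure on the angles. -/
def angle : Measure ℝ := volume.restrict (Set.Ioc 0 (2 * Real.pi))

instance : IsFiniteMeasure angle := by unfold angle; infer_instance

/-- The mean of `f` over the circle of radius `R` around `α`. -/
def circleMean (f : ℂ → ℂ) (R : ℝ) (α : ℂ) : ℂ :=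
  ((2 * Real.pi)⁻¹ : ℝ) * ∫ θ, f (α + circleMap 0 R θ) ∂angle

/-- Jensen's formula for a single zero: averaging the logarithm over a circle truncates it at the
radius. -/
lemma integral_log_norm_circle {R : ℝ} (hR : 0 < R) (a : ℂ) :
    (2 * Real.pi)⁻¹ * ∫ θ, Real.log ‖a - circleMap 0 R θ‖ ∂angle = Real.log (max R ‖a‖) := by
  have h := circleAverage_log_norm_sub_const_eq_log_radius_add_posLog (a := a) (c := 0) hR.ne'
  rw [Real.circleAverage_def, intervalIntegral.integral_of_le (by positivity)] at h
  simp only [smul_eq_mul, norm_sub_rev _ a, sub_zero] at h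
  rw [angle, h, Real.posLog_eq_log_max_one (by positivity), ← Real.log_mul hR.ne' (by positivity),
    mul_max_of_nonneg _ _ hR.le, mul_one, mul_inv_cancel_left₀ hR.ne']

variable {f : ℂ → ℂ} (hf : Continuous f) {K ρ : ℝ} (hK : ∀ c, ‖f c‖ ≤ K)
  (hρ : ∀ c, ρ < ‖c‖ → f c = 0)

include hf hK hρ in
lemma integrable_circle_mul_log {R : ℝ} (hR : 0 < R) (l : ℂ) :
    Integrable (fun p : ℝ × ℂ => f (p.2 + circleMap 0 R p.1) * (Real.log ‖p.2 - l‖ : ℂ))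
      (angle.prod volume) := by
  have h1 : Integrable ((Metric.closedBall (0 : ℂ) (ρ + R)).indicator
      (fun α => K * |Real.log ‖α - l‖|)) :=
    (integrable_indicator_iff measurableSet_closedBall).2
      ((integrableOn_log_norm_sub l (ρ + R)).abs.const_mul K)
  refine (h1.comp_snd angle).mono ?_ (ae_of_all _ fun p => ?_)
  · refine Measurable.aestronglyMeasurable (Measurable.mul ?_ ?_)
    · exact (hf.comp (continuous_snd.add ((continuous_circleMap 0 R).comp
        continuous_fst))).measurable
    · exact Complex.measurable_ofReal.comp ((measurable_log_norm_sub l).comp measurable_snd)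
  · have hK0 : 0 ≤ K := (norm_nonneg _).trans (hK 0)
    rw [norm_mul, Complex.norm_real]
    by_cases hp : p.2 ∈ Metric.closedBall (0 : ℂ) (ρ + R)
    · rw [Set.indicator_of_mem hp, norm_mul, Real.norm_eq_abs, Real.norm_eq_abs,
        Real.norm_eq_abs, abs_abs, abs_of_nonneg hK0]
      exact mul_le_mul_of_nonneg_right (hK _) (abs_nonneg _)
    · rw [Set.indicator_of_notMem hp, hρ, norm_zero, zero_mul, norm_zero]
      rw [mem_closedBall_zero_iff, not_le] at hp
      have h2 : ‖circleMap 0 R p.1‖ = R := by rw [norm_circleMap_zero, abs_of_pos hR]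
      have h3 := norm_sub_norm_le p.2 (-circleMap 0 R p.1)
      rw [norm_neg, sub_neg_eq_add, h2] at h3
      linarith

include hf hK hρ in
lemma integrable_circleMean_mul_log {R : ℝ} (hR : 0 < R) (l : ℂ) :
    Integrable fun α => circleMean f R α * (Real.log ‖α - l‖ : ℂ) := by
  have h := ((integrable_circle_mul_log hf hK hρ hR l).integral_prod_right).const_mul
    (((2 * Real.pi)⁻¹ : ℝ) : ℂ)
  refine h.congr (ae_of_all _ fun α => ?_)
  simp only [circleMean]
  rw [integral_mul_const, mul_assoc]

include hf hK hρ in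
/-- Testing a circle mean against the logarithm. -/
lemma integral_circleMean_mul_log {R : ℝ} (hR : 0 < R) (l : ℂ) :
    ∫ α, circleMean f R α * (Real.log ‖α - l‖ : ℂ)
      = ∫ c, f c * (Real.log (max R ‖c - l‖) : ℂ) := by
  have hi := integrable_circle_mul_log hf hK hρ hR l
  -- Transported from `hi` by translating the plane variable for each fixed angle.
  have hi2 : Integrable (fun p : ℝ × ℂ => f p.2 * (Real.log ‖p.2 - l - circleMap 0 R p.1‖ : ℂ))
      (angle.prod volume) := by
    have hm : AEStronglyMeasurable
        (fun p : ℝ × ℂ => f p.2 * (Real.log ‖p.2 - l - circleMap 0 R p.1‖ : ℂ))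
        (angle.prod volume) := by
      refine Measurable.aestronglyMeasurable (Measurable.mul (hf.measurable.comp measurable_snd) ?_)
      refine Complex.measurable_ofReal.comp (Real.measurable_log.comp (Measurable.norm ?_))
      exact (measurable_snd.sub_const l).sub
        ((continuous_circleMap 0 R).measurable.comp measurable_fst)
    rw [integrable_prod_iff hi.aestronglyMeasurable] at hi
    rw [integrable_prod_iff hm]
    constructor
    · filter_upwards [hi.1] with θ hθ
      have := hθ.comp_sub_right (circleMap 0 R θ)
      simpa only [sub_add_cancel, sub_right_comm] using this
    · refine hi.2.congr (ae_of_all _ fun θ => ?_)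
      have := integral_sub_right_eq_self (μ := (volume : Measure ℂ))
        (fun α => ‖f (α + circleMap 0 R θ) * (Real.log ‖α - l‖ : ℂ)‖) (circleMap 0 R θ)
      simpa only [sub_add_cancel, sub_right_comm] using this.symm
  calc ∫ α, circleMean f R α * (Real.log ‖α - l‖ : ℂ)
      = ∫ α, (((2 * Real.pi)⁻¹ : ℝ) : ℂ) *
          ∫ θ, f (α + circleMap 0 R θ) * (Real.log ‖α - l‖ : ℂ) ∂angle := by
        congr 1; funext α
        simp only [circleMean]
        rw [integral_mul_const, mul_assoc]
    _ = (((2 * Real.pi)⁻¹ : ℝ) : ℂ) *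
          ∫ θ, (∫ α, f (α + circleMap 0 R θ) * (Real.log ‖α - l‖ : ℂ)) ∂angle := by
        rw [integral_const_mul, ← integral_integral_swap hi]
    _ = (((2 * Real.pi)⁻¹ : ℝ) : ℂ) *
          ∫ θ, (∫ c, f c * (Real.log ‖c - l - circleMap 0 R θ‖ : ℂ)) ∂angle := by
        congr 2; funext θ
        have := integral_sub_right_eq_self (μ := (volume : Measure ℂ))
          (fun α => f (α + circleMap 0 R θ) * (Real.log ‖α - l‖ : ℂ)) (circleMap 0 R θ)
        simpa only [sub_add_cancel, sub_right_comm] using this.symm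
    _ = ∫ c, (((2 * Real.pi)⁻¹ : ℝ) : ℂ) *
          ∫ θ, f c * (Real.log ‖c - l - circleMap 0 R θ‖ : ℂ) ∂angle := by
        rw [integral_integral_swap hi2, integral_const_mul]
    _ = ∫ c, f c * (Real.log (max R ‖c - l‖) : ℂ) := by
        congr 1; funext c
        rw [integral_const_mul, integral_complex_ofReal, mul_left_comm, ← Complex.ofReal_mul,
          integral_log_norm_circle hR]

end Potential

/-! ### Recovering a test function from logarithmic potentials -/

section Smoothing

/-- The difference of two truncated logarithms. -/
def logKernel (R r : ℝ) (a : ℂ) : ℝ := Real.log (max R ‖a‖) - Real.log (max r ‖a‖)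

variable {R r : ℝ}

lemma continuous_log_max (hR : 0 < R) : Continuous fun a : ℂ => Real.log (max R ‖a‖) :=
  (continuous_const.max continuous_norm).log fun _ => (lt_max_of_lt_left hR).ne'

lemma continuous_logKernel (hr : 0 < r) (hrR : r < R) : Continuous (logKernel R r) :=
  (continuous_log_max (hr.trans hrR)).sub (continuous_log_max hr)

lemma logKernel_nonneg (hr : 0 < r) (hrR : r < R) (a : ℂ) : 0 ≤ logKernel R r a :=
  sub_nonneg.2 (Real.log_le_log (lt_max_of_lt_left hr) (max_le_max_right _ hrR.le))

lemma logKernel_eq_zero (hrR : r < R) {a : ℂ} (ha : R < ‖a‖) : logKernel R r a = 0 := by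
  rw [logKernel, max_eq_right ha.le, max_eq_right (hrR.trans ha).le, sub_self]

lemma hasCompactSupport_logKernel (hrR : r < R) : HasCompactSupport (logKernel R r) :=
  HasCompactSupport.intro (isCompact_closedBall 0 R) fun a ha =>
    logKernel_eq_zero hrR (by simpa using ha)

lemma integrable_logKernel (hr : 0 < r) (hrR : r < R) : Integrable (logKernel R r) :=
  (continuous_logKernel hr hrR).integrable_of_hasCompactSupport (hasCompactSupport_logKernel hrR)

lemma integral_logKernel_pos (hr : 0 < r) (hrR : r < R) : 0 < ∫ a, logKernel R r a := by
  refine (continuous_logKernel hr hrR).integral_pos_of_hasCompactSupport_nonneg_nonzero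
    (hasCompactSupport_logKernel hrR) (fun a => logKernel_nonneg hr hrR a) (x := 0) ?_
  rw [logKernel, norm_zero, max_eq_left hr.le, max_eq_left (hr.trans hrR).le]
  exact (sub_pos.2 (Real.log_lt_log hr hrR)).ne'

/-- The convolution of `f` with the kernel. -/
def logSmooth (f : ℂ → ℂ) (R r : ℝ) (l : ℂ) : ℂ := ∫ c, f c * (logKernel R r (c - l) : ℂ)

/-- The function whose logarithmic potential is the convolution. -/
def testFn (f : ℂ → ℂ) (R r : ℝ) (α : ℂ) : ℂ := circleMean f R α - circleMean f r α

variable {f : ℂ → ℂ} (hf : Continuous f) {K ρ : ℝ} (hK : ∀ c, ‖f c‖ ≤ K)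
  (hρ : ∀ c, ρ < ‖c‖ → f c = 0)

lemma norm_circleMean_le (hK : ∀ c, ‖f c‖ ≤ K) (α : ℂ) : ‖circleMean f R α‖ ≤ K := by
  have h := norm_integral_le_of_norm_le_const (μ := angle)
    (f := fun θ => f (α + circleMap 0 R θ)) (C := K) (ae_of_all _ fun θ => hK _)
  have h2 : angle.real Set.univ = 2 * Real.pi := by
    rw [angle, measureReal_restrict_apply_univ, Real.volume_real_Ioc_of_le (by positivity),
      sub_zero]
  rw [h2] at h
  rw [circleMean, norm_mul, Complex.norm_real, Real.norm_eq_abs, abs_of_nonneg (by positivity),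
    inv_mul_le_iff₀ (by positivity)]
  linarith

lemma circleMean_eq_zero (hρ : ∀ c, ρ < ‖c‖ → f c = 0) (hR : 0 < R) {α : ℂ} (hα : ρ + R < ‖α‖) :
    circleMean f R α = 0 := by
  have : ∀ θ, f (α + circleMap 0 R θ) = 0 := fun θ => by
    refine hρ _ ?_
    have h2 : ‖circleMap 0 R θ‖ = R := by rw [norm_circleMap_zero, abs_of_pos hR]
    have h3 := norm_sub_norm_le α (-circleMap 0 R θ)
    rw [norm_neg, sub_neg_eq_add, h2] at h3
    linarith
  simp [circleMean, this]

lemma norm_testFn_le (hK : ∀ c, ‖f c‖ ≤ K) (hρ : ∀ c, ρ < ‖c‖ → f c = 0) (hr : 0 < r)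
    (hrR : r < R) (α : ℂ) :
    ‖testFn f R r α‖ ≤ (Metric.closedBall (0 : ℂ) (ρ + R)).indicator (fun _ => 2 * K) α := by
  by_cases h : α ∈ Metric.closedBall (0 : ℂ) (ρ + R)
  · rw [Set.indicator_of_mem h]
    refine (norm_sub_le _ _).trans ?_
    linarith [norm_circleMean_le (R := R) hK α, norm_circleMean_le (R := r) hK α]
  · rw [Set.indicator_of_notMem h]
    rw [mem_closedBall_zero_iff, not_le] at h
    rw [testFn, circleMean_eq_zero hρ (hr.trans hrR) h, circleMean_eq_zero hρ hr (by linarith),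
      sub_zero, norm_zero]

include hf hK hρ in
lemma integrable_testFn_mul_log (hr : 0 < r) (hrR : r < R) (l : ℂ) :
    Integrable fun α => testFn f R r α * (Real.log ‖α - l‖ : ℂ) := by
  refine ((integrable_circleMean_mul_log hf hK hρ (hr.trans hrR) l).sub
    (integrable_circleMean_mul_log hf hK hρ hr l)).congr (ae_of_all _ fun α => ?_)
  simp only [testFn, Pi.sub_apply]
  ring

-- The circle means truncate the logarithm at R and at r. The two truncations agree at distance
-- greater than R from l, so their difference is a compactly supported kernel.
include hf hK hρ in
lemma integral_testFn_mul_log (hr : 0 < r) (hrR : r < R) (l : ℂ) :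
    ∫ α, testFn f R r α * (Real.log ‖α - l‖ : ℂ) = logSmooth f R r l := by
  have hcs : HasCompactSupport f := HasCompactSupport.intro (isCompact_closedBall 0 ρ)
    fun c hc => hρ c (by simpa using hc)
  have hi : ∀ {R : ℝ}, 0 < R → Integrable fun c => f c * (Real.log (max R ‖c - l‖) : ℂ) :=
    fun hR => Continuous.integrable_of_hasCompactSupport
      (hf.mul (Complex.continuous_ofReal.comp ((continuous_log_max hR).comp
        (continuous_id.sub continuous_const)))) hcs.mul_right
  have e : ∀ α, testFn f R r α * (Real.log ‖α - l‖ : ℂ)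
      = circleMean f R α * (Real.log ‖α - l‖ : ℂ) - circleMean f r α * (Real.log ‖α - l‖ : ℂ) :=
    fun α => sub_mul _ _ _
  simp_rw [e]
  rw [integral_sub (integrable_circleMean_mul_log hf hK hρ (hr.trans hrR) l)
    (integrable_circleMean_mul_log hf hK hρ hr l),
    integral_circleMean_mul_log hf hK hρ (hr.trans hrR), integral_circleMean_mul_log hf hK hρ hr,
    ← integral_sub (hi (hr.trans hrR)) (hi hr), logSmooth]
  congr 1; funext c
  rw [logKernel, Complex.ofReal_sub, mul_sub]

lemma log_prod_norm_sub {s : Multiset ℂ} {α : ℂ} (hα : α ∉ s) :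
    Real.log (s.map fun l => ‖α - l‖).prod = (s.map fun l => Real.log ‖α - l‖).sum := by
  induction s using Multiset.induction with
  | empty => simp
  | cons a s ih =>
    rw [Multiset.mem_cons, not_or] at hα
    rw [Multiset.map_cons, Multiset.prod_cons, Multiset.map_cons, Multiset.sum_cons,
      Real.log_mul (norm_ne_zero_iff.2 (sub_ne_zero.2 hα.1)), ih hα.2]
    intro h0
    obtain ⟨l, hl, h1⟩ := Multiset.mem_map.1 (Multiset.prod_eq_zero_iff.1 h0)
    exact hα.2 (by rwa [sub_eq_zero.1 (norm_eq_zero.1 h1)])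

lemma ae_notMem_multiset (s : Multiset ℂ) : ∀ᵐ α : ℂ, α ∉ s := by
  have h : (volume : Measure ℂ) {α | α ∈ s} = 0 := by
    have : {α | α ∈ s} = (s.toFinset : Set ℂ) := by ext; simp
    rw [this]
    exact s.toFinset.finite_toSet.measure_zero _
  rw [ae_iff]
  simpa using h

include hf hK hρ in
lemma integral_testFn_mul_sum_log (hr : 0 < r) (hrR : r < R) (s : Multiset ℂ) :
    Integrable (fun α => testFn f R r α * ((s.map fun l => Real.log ‖α - l‖).sum : ℂ)) ∧
    ∫ α, testFn f R r α * ((s.map fun l => Real.log ‖α - l‖).sum : ℂ)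
      = (s.map (logSmooth f R r)).sum := by
  induction s using Multiset.induction with
  | empty => simp
  | cons a s ih =>
    have e : ∀ α, testFn f R r α * (((a ::ₘ s).map fun l => Real.log ‖α - l‖).sum : ℂ)
        = testFn f R r α * (Real.log ‖α - a‖ : ℂ)
          + testFn f R r α * ((s.map fun l => Real.log ‖α - l‖).sum : ℂ) := fun α => by
      rw [Multiset.map_cons, Multiset.sum_cons, Complex.ofReal_add, mul_add]
    have h1 := integrable_testFn_mul_log hf hK hρ hr hrR a
    simp_rw [e]
    refine ⟨h1.add ih.1, ?_⟩
    rw [integral_add h1 ih.1, ih.2, integral_testFn_mul_log hf hK hρ hr hrR, Multiset.map_cons,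
      Multiset.sum_cons]

/-- Multiplicativity of the logarithm requires α off the spectrum, where no factor is 0; the
spectrum is finite, hence a null set. -/
lemma ae_log_det_eq {n : ℕ} (A : Matrix (Fin n) (Fin n) ℂ) :
    ∀ᵐ α : ℂ, Real.log ‖(A - α • 1).det‖
      = (A.charpoly.roots.map fun l => Real.log ‖α - l‖).sum := by
  filter_upwards [ae_notMem_multiset A.charpoly.roots] with α hα
  rw [norm_det_sub_smul, norm_eval_charpoly, log_prod_norm_sub hα]

include hf hK hρ in
lemma integral_testFn_mul_log_det (hr : 0 < r) (hrR : r < R) {n : ℕ}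
    (A : Matrix (Fin n) (Fin n) ℂ) :
    Integrable (fun α => testFn f R r α * (Real.log ‖(A - α • 1).det‖ : ℂ)) ∧
    ∫ α, testFn f R r α * (Real.log ‖(A - α • 1).det‖ : ℂ)
      = (A.charpoly.roots.map (logSmooth f R r)).sum := by
  obtain ⟨h1, h2⟩ := integral_testFn_mul_sum_log hf hK hρ hr hrR A.charpoly.roots
  have h3 : (fun α => testFn f R r α
        * ((A.charpoly.roots.map fun l => Real.log ‖α - l‖).sum : ℂ))
      =ᵐ[volume] fun α => testFn f R r α * (Real.log ‖(A - α • 1).det‖ : ℂ) := by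
    filter_upwards [ae_log_det_eq A] with α hα
    rw [hα]
  exact ⟨h1.congr h3, by rw [← h2, integral_congr_ae h3]⟩

-- The kernel is nonnegative and supported in the disc of radius R, so only the oscillation of f at
-- scale R is felt.
include hf hK in
lemma norm_logSmooth_sub_le (hr : 0 < r) (hrR : r < R) {ε : ℝ} {l : ℂ}
    (hε : ∀ c, ‖c - l‖ ≤ R → ‖f c - f l‖ ≤ ε) :
    ‖logSmooth f R r l - ((∫ a, logKernel R r a : ℝ) : ℂ) * f l‖
      ≤ ε * ∫ a, logKernel R r a := by
  have hk : Integrable fun c => logKernel R r (c - l) :=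
    (integrable_logKernel hr hrR).comp_sub_right l
  have hk2 : Integrable fun c => (logKernel R r (c - l) : ℂ) := hk.ofReal
  have hint : ∫ a, logKernel R r a = ∫ c, logKernel R r (c - l) :=
    (integral_sub_right_eq_self (fun a => logKernel R r a) l).symm
  have hfk : Integrable fun c => f c * (logKernel R r (c - l) : ℂ) :=
    hk2.bdd_mul hf.aestronglyMeasurable (ae_of_all _ hK)
  have e : logSmooth f R r l - ((∫ a, logKernel R r a : ℝ) : ℂ) * f l
      = ∫ c, (f c - f l) * (logKernel R r (c - l) : ℂ) := by
    rw [hint, ← integral_complex_ofReal, mul_comm, ← integral_const_mul, logSmooth,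
      ← integral_sub hfk (hk2.const_mul _)]
    simp_rw [sub_mul]
  rw [e, hint, ← integral_const_mul]
  refine norm_integral_le_of_norm_le (hk.const_mul ε) (ae_of_all _ fun c => ?_)
  have h0 := logKernel_nonneg hr hrR (c - l)
  rw [norm_mul, Complex.norm_real, Real.norm_eq_abs, abs_of_nonneg h0]
  by_cases h : ‖c - l‖ ≤ R
  · exact mul_le_mul_of_nonneg_right (hε c h) h0
  · rw [logKernel_eq_zero hrR (not_le.1 h), mul_zero, mul_zero]

end Smoothing

/-! ### From potentials to eigenvalue means, with bounds independent of the eigenvalue positions -/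

section Comparison

/-- For x ≤ 1 write -log x = L + log(e^(-L)/x) ≤ L + e^(-L)/x. A larger constant L buys a small
weight on the singular part, which is integrable. -/
lemma abs_log_norm_sub_le {α l : ℂ} {ρ L : ℝ} (hα : ‖α‖ ≤ ρ) (hL : 0 ≤ L) :
    |Real.log ‖α - l‖| ≤ (Real.log 2 + Real.posLog ρ + L) + Real.posLog ‖l‖
      + Real.exp (-L) * invDisc (α - l) := by
  have h0 := mul_nonneg (Real.exp_pos (-L)).le (invDisc_nonneg (α - l))
  have h1 := Real.posLog_le_posLog (norm_nonneg α) hα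
  have h2 := Real.posLog_norm_add_le α (-l)
  rw [norm_neg, ← sub_eq_add_neg] at h2
  have h3 : 0 ≤ Real.posLog ‖l‖ := Real.posLog_nonneg
  have h4 : 0 ≤ Real.posLog ρ := Real.posLog_nonneg
  have h5 : 0 ≤ Real.log 2 := Real.log_nonneg (by norm_num)
  have h6 : Real.log ‖α - l‖ ≤ Real.posLog ‖α - l‖ := le_max_right _ _
  have h7 : -Real.log ‖α - l‖ ≤ L + Real.exp (-L) * invDisc (α - l) := by
    rcases eq_or_ne (α - l) 0 with hz | hz
    · rw [hz] at h0 ⊢; simp only [norm_zero, Real.log_zero, neg_zero]; linarith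
    have hpos : 0 < ‖α - l‖ := norm_pos_iff.2 hz
    by_cases hle : ‖α - l‖ ≤ 1
    · rw [invDisc, if_pos hle]
      have h8 := Real.log_le_sub_one_of_pos (by positivity : 0 < Real.exp (-L) * ‖α - l‖⁻¹)
      rw [Real.log_mul (by positivity) (by positivity), Real.log_exp, Real.log_inv] at h8
      linarith
    · have := Real.log_nonneg (not_le.1 hle).le
      linarith
  rw [abs_le]
  constructor <;> linarith

/-- The mean of a function over the eigenvalues. -/
def rootMean {n : ℕ} (A : Matrix (Fin n) (Fin n) ℂ) (g : ℂ → ℝ) : ℝ :=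
  (n : ℝ)⁻¹ * (A.charpoly.roots.map g).sum

variable {n : ℕ} (A B : Matrix (Fin n) (Fin n) ℂ)

lemma rootMean_mono {g h : ℂ → ℝ} (hgh : ∀ l, g l ≤ h l) : rootMean A g ≤ rootMean A h :=
  mul_le_mul_of_nonneg_left (Multiset.sum_map_le_sum_map _ _ fun l _ => hgh l) (by positivity)

lemma rootMean_nonneg {g : ℂ → ℝ} (hg : ∀ l, 0 ≤ g l) : 0 ≤ rootMean A g :=
  mul_nonneg (by positivity) (Multiset.sum_nonneg fun x hx => by
    obtain ⟨l, _, rfl⟩ := Multiset.mem_map.1 hx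
    exact hg l)

lemma rootMean_const (hn : 1 ≤ n) (c : ℝ) : rootMean A (fun _ => c) = c := by
  have : (n : ℝ) ≠ 0 := by exact_mod_cast (by omega : n ≠ 0)
  rw [rootMean, Multiset.map_const', Multiset.sum_replicate, card_roots_charpoly, nsmul_eq_mul,
    inv_mul_cancel_left₀ this]

lemma rootMean_add (g h : ℂ → ℝ) :
    rootMean A (fun l => g l + h l) = rootMean A g + rootMean A h := by
  rw [rootMean, Multiset.sum_map_add, mul_add, rootMean, rootMean]

lemma rootMean_const_mul (c : ℝ) (g : ℂ → ℝ) :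
    rootMean A (fun l => c * g l) = c * rootMean A g := by
  rw [rootMean, Multiset.sum_map_mul_left, rootMean]; ring

lemma norm_mean_roots_le (g : ℂ → ℂ) :
    ‖(n : ℂ)⁻¹ * (A.charpoly.roots.map g).sum‖ ≤ rootMean A fun l => ‖g l‖ := by
  rw [norm_mul, norm_inv, Complex.norm_natCast, rootMean]
  refine mul_le_mul_of_nonneg_left ?_ (by positivity)
  have := norm_multiset_sum_le (A.charpoly.roots.map g)
  rwa [Multiset.map_map] at this

/-- A bound for the logarithmic potential of a matrix, with an integrable singular part. -/
lemma ae_abs_log_det_le (hn : 1 ≤ n) (ρ : ℝ) {L : ℝ} (hL : 0 ≤ L) :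
    ∀ᵐ α : ℂ, ‖α‖ ≤ ρ → |(1 / (n : ℝ)) * Real.log ‖(A - α • 1).det‖|
      ≤ (Real.log 2 + Real.posLog ρ + L) + rootMean A (fun l => Real.posLog ‖l‖)
        + Real.exp (-L) * rootMean A (fun l => invDisc (α - l)) := by
  filter_upwards [ae_log_det_eq A] with α h hα
  have e1 : |(1 / (n : ℝ)) * Real.log ‖(A - α • 1).det‖|
      ≤ rootMean A (fun l => |Real.log ‖α - l‖|) := by
    rw [h, abs_mul, abs_of_nonneg (by positivity : 0 ≤ 1 / (n : ℝ)), one_div, rootMean]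
    refine mul_le_mul_of_nonneg_left ?_ (by positivity)
    have := norm_multiset_sum_le (A.charpoly.roots.map fun l => Real.log ‖α - l‖)
    rwa [Multiset.map_map] at this
  refine e1.trans ((rootMean_mono A fun l => abs_log_norm_sub_le hα hL).trans_eq ?_)
  rw [rootMean_add, rootMean_add, rootMean_const A hn, rootMean_const_mul]

/-- By translation invariance the singular part has the same integral wherever the eigenvalues are.
-/
lemma integral_rootMean_invDisc (hn : 1 ≤ n) :
    Integrable (fun α => rootMean A (fun l => invDisc (α - l))) ∧
      ∫ α, rootMean A (fun l => invDisc (α - l)) = ∫ β, invDisc β := by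
  have key : ∀ s : Multiset ℂ,
      Integrable (fun α => (s.map fun l => invDisc (α - l)).sum) ∧
      ∫ α, (s.map fun l => invDisc (α - l)).sum = s.card * ∫ β, invDisc β := by
    intro s
    induction s using Multiset.induction with
    | empty => simp
    | cons a s ih =>
      have h1 := integrable_invDisc.comp_sub_right a
      simp only [Multiset.map_cons, Multiset.sum_cons, Multiset.card_cons]
      refine ⟨h1.add ih.1, ?_⟩
      rw [integral_add h1 ih.1, ih.2, integral_sub_right_eq_self]
      push_cast; ring
  obtain ⟨h1, h2⟩ := key A.charpoly.roots
  have : (n : ℝ) ≠ 0 := by exact_mod_cast (by omega : n ≠ 0)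
  refine ⟨h1.const_mul _, ?_⟩
  simp only [rootMean]
  rw [integral_const_mul, h2, card_roots_charpoly, inv_mul_cancel_left₀ this]

variable {f : ℂ → ℂ} (hf : Continuous f) {K ρ : ℝ} (hK : ∀ c, ‖f c‖ ≤ K)
  (hρ : ∀ c, ρ < ‖c‖ → f c = 0) {R r : ℝ}

lemma measurable_logDetDiff {α : Type*} [MeasurableSpace α]
    {M M' : α → Matrix (Fin n) (Fin n) ℂ} (hM : ∀ a b, Measurable fun u => M u a b)
    (hM' : ∀ a b, Measurable fun u => M' u a b) :
    Measurable fun u => logDetDiff (M u) (M' u) :=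
  ((Real.measurable_log.comp (measurable_det hM).norm).const_mul _).sub
    ((Real.measurable_log.comp (measurable_det hM').norm).const_mul _)

lemma measurable_sub_smul_one (i j : Fin n) :
    Measurable fun α : ℂ => (A - α • (1 : Matrix (Fin n) (Fin n) ℂ)) i j := by
  simp only [Matrix.sub_apply, Matrix.smul_apply, smul_eq_mul]
  exact (measurable_id.mul_const _).const_sub _

include hf hK hρ in
lemma integral_testFn_mul_logDetDiff (hr : 0 < r) (hrR : r < R) :
    ∫ α, testFn f R r α * (logDetDiff (A - α • 1) (B - α • 1) : ℂ)
      = (n : ℂ)⁻¹ * (A.charpoly.roots.map (logSmooth f R r)).sum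
        - (n : ℂ)⁻¹ * (B.charpoly.roots.map (logSmooth f R r)).sum := by
  obtain ⟨iA, eA⟩ := integral_testFn_mul_log_det hf hK hρ hr hrR A
  obtain ⟨iB, eB⟩ := integral_testFn_mul_log_det hf hK hρ hr hrR B
  rw [← eA, ← eB, ← integral_const_mul, ← integral_const_mul,
    ← integral_sub (iA.const_mul _) (iB.const_mul _)]
  congr 1; funext α
  simp only [logDetDiff]
  push_cast
  ring

-- M dominates the nonsingular part of both potentials, so truncation at M loses at most e^(-L)
-- times the singular parts. The truncated integrand is bounded, as required for passing from
-- convergence in probability to integrals.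
include hK hρ in
lemma norm_integral_testFn_mul_logDetDiff_le (hn : 1 ≤ n) (hr : 0 < r) (hrR : r < R) {M L : ℝ}
    (hL : 0 ≤ L)
    (hM : 2 * (Real.log 2 + Real.posLog (ρ + R) + L) + rootMean A (fun l => Real.posLog ‖l‖)
      + rootMean B (fun l => Real.posLog ‖l‖) ≤ M) :
    ‖∫ α, testFn f R r α * (logDetDiff (A - α • 1) (B - α • 1) : ℂ)‖
      ≤ 2 * K * ((∫ α in Metric.closedBall (0 : ℂ) (ρ + R),
          min |logDetDiff (A - α • 1) (B - α • 1)| M)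
        + Real.exp (-L) * (2 * ∫ β, invDisc β)) := by
  have hK0 : 0 ≤ K := (norm_nonneg _).trans (hK 0)
  obtain ⟨jA, fA⟩ := integral_rootMean_invDisc A hn
  obtain ⟨jB, fB⟩ := integral_rootMean_invDisc B hn
  have nA : ∀ α, 0 ≤ rootMean A (fun l => invDisc (α - l)) := fun α =>
    rootMean_nonneg A fun l => invDisc_nonneg _
  have nB : ∀ α, 0 ≤ rootMean B (fun l => invDisc (α - l)) := fun α =>
    rootMean_nonneg B fun l => invDisc_nonneg _
  have hDmeas : Measurable fun α : ℂ => logDetDiff (A - α • 1) (B - α • 1) :=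
    measurable_logDetDiff (measurable_sub_smul_one A) (measurable_sub_smul_one B)
  have hM0 : 0 ≤ M := by
    have := rootMean_nonneg A (g := fun l => Real.posLog ‖l‖) fun l => Real.posLog_nonneg
    have := rootMean_nonneg B (g := fun l => Real.posLog ‖l‖) fun l => Real.posLog_nonneg
    have h4 : 0 ≤ Real.posLog (ρ + R) := Real.posLog_nonneg
    have h5 : 0 ≤ Real.log 2 := Real.log_nonneg (by norm_num)
    linarith
  have imin : IntegrableOn (fun α : ℂ => min |logDetDiff (A - α • 1) (B - α • 1)| M)
      (Metric.closedBall (0 : ℂ) (ρ + R)) := by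
    have hmin : Measurable fun α : ℂ => min |logDetDiff (A - α • 1) (B - α • 1)| M :=
      hDmeas.abs.min measurable_const
    refine Measure.integrableOn_of_bounded (M := M) (measure_closedBall_lt_top).ne
      hmin.aestronglyMeasurable (ae_of_all _ fun α => ?_)
    rw [Real.norm_eq_abs, abs_of_nonneg (le_min (abs_nonneg _) hM0)]
    exact min_le_right _ _
  have ibnd1 := (integrable_indicator_iff measurableSet_closedBall).2 imin
  have ibnd := (ibnd1.add ((jA.add jB).const_mul (Real.exp (-L)))).const_mul (2 * K)
  refine (norm_integral_le_of_norm_le ibnd ?_).trans_eq ?_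
  · filter_upwards [ae_abs_log_det_le A hn (ρ + R) hL, ae_abs_log_det_le B hn (ρ + R) hL]
      with α hα1 hα2
    have hG := norm_testFn_le hK hρ hr hrR α
    have hE := Real.exp_pos (-L)
    have hJ : 0 ≤ Real.exp (-L) * (rootMean A (fun l => invDisc (α - l))
        + rootMean B (fun l => invDisc (α - l))) := mul_nonneg hE.le (add_nonneg (nA α) (nB α))
    rw [norm_mul, Complex.norm_real, Real.norm_eq_abs]
    simp only [Pi.add_apply]
    by_cases hmem : α ∈ Metric.closedBall (0 : ℂ) (ρ + R)
    · rw [Set.indicator_of_mem hmem] at hG ⊢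
      rw [mem_closedBall_zero_iff] at hmem
      refine mul_le_mul hG ?_ (abs_nonneg _) (by positivity)
      rcases le_total |logDetDiff (A - α • 1) (B - α • 1)| M with h | h
      · rw [min_eq_left h]; linarith
      · rw [min_eq_right h]
        have h1 := hα1 hmem
        have h2 := hα2 hmem
        have h3 : |logDetDiff (A - α • 1) (B - α • 1)|
          ≤ |(1 / (n : ℝ)) * Real.log ‖(A - α • 1).det‖|
            + |(1 / (n : ℝ)) * Real.log ‖(B - α • 1).det‖| := abs_sub _ _
        linarith
    · rw [Set.indicator_of_notMem hmem] at hG ⊢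
      have : ‖testFn f R r α‖ = 0 := le_antisymm hG (norm_nonneg _)
      rw [this, zero_mul, zero_add]
      positivity
  · rw [integral_const_mul]
    congr 1
    have e1 := integral_add ibnd1 ((jA.add jB).const_mul (Real.exp (-L)))
    rw [integral_const_mul, integral_indicator measurableSet_closedBall] at e1
    have e2 := integral_add jA jB
    rw [fA, fB, ← two_mul] at e2
    refine Eq.trans ?_ (e1.trans ?_)
    · rfl
    · congr 2

include hf hK hρ in
/-- The eigenvalue means of two matrices are close if their logarithmic potentials are. -/
lemma norm_mean_roots_sub_le (hn : 1 ≤ n) (hr : 0 < r) (hrR : r < R) {ε : ℝ}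
    (hε : ∀ c l, ‖c - l‖ ≤ R → ‖f c - f l‖ ≤ ε) {M L : ℝ} (hL : 0 ≤ L)
    (hM : 2 * (Real.log 2 + Real.posLog (ρ + R) + L) + rootMean A (fun l => Real.posLog ‖l‖)
      + rootMean B (fun l => Real.posLog ‖l‖) ≤ M) :
    ‖(n : ℂ)⁻¹ * (A.charpoly.roots.map f).sum - (n : ℂ)⁻¹ * (B.charpoly.roots.map f).sum‖
      ≤ 2 * ε + (∫ a, logKernel R r a)⁻¹ * (2 * K * ((∫ α in Metric.closedBall (0 : ℂ) (ρ + R),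
          min |logDetDiff (A - α • 1) (B - α • 1)| M)
        + Real.exp (-L) * (2 * ∫ β, invDisc β))) := by
  have hm0 : 0 < ∫ a, logKernel R r a := integral_logKernel_pos hr hrR
  have happrox : ∀ A : Matrix (Fin n) (Fin n) ℂ,
      ‖(n : ℂ)⁻¹ * (A.charpoly.roots.map fun l => logSmooth f R r l
        - ((∫ a, logKernel R r a : ℝ) : ℂ) * f l).sum‖ ≤ ε * ∫ a, logKernel R r a := fun A => by
    refine (norm_mean_roots_le A _).trans ((rootMean_mono A fun l => ?_).trans_eq
      (rootMean_const A hn (ε * ∫ a, logKernel R r a)))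
    exact norm_logSmooth_sub_le hf hK hr hrR fun c => hε c l
  have hint := norm_integral_testFn_mul_logDetDiff_le A B hK hρ hn hr hrR hL hM
  have hdiff := integral_testFn_mul_logDetDiff A B hf hK hρ hr hrR
  generalize (∫ a, logKernel R r a) = m at hm0 happrox ⊢
  generalize (∫ α, testFn f R r α * (logDetDiff (A - α • 1) (B - α • 1) : ℂ)) = I at hint hdiff
  generalize 2 * K * ((∫ α in Metric.closedBall (0 : ℂ) (ρ + R),
      min |logDetDiff (A - α • 1) (B - α • 1)| M)
        + Real.exp (-L) * (2 * ∫ β, invDisc β)) = W at hint ⊢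
  have hsub : ∀ A : Matrix (Fin n) (Fin n) ℂ,
      (n : ℂ)⁻¹ * (A.charpoly.roots.map fun l => logSmooth f R r l - (m : ℂ) * f l).sum
      = (n : ℂ)⁻¹ * (A.charpoly.roots.map (logSmooth f R r)).sum
        - m * ((n : ℂ)⁻¹ * (A.charpoly.roots.map f).sum) := fun A => by
    rw [Multiset.sum_map_sub, Multiset.sum_map_mul_left]; ring
  have hA := happrox A
  have hB := happrox B
  rw [hsub] at hA hB
  generalize (n : ℂ)⁻¹ * (A.charpoly.roots.map f).sum = SA at hA ⊢
  generalize (n : ℂ)⁻¹ * (B.charpoly.roots.map f).sum = SB at hB ⊢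
  generalize (n : ℂ)⁻¹ * (A.charpoly.roots.map (logSmooth f R r)).sum = TA at hA hdiff
  generalize (n : ℂ)⁻¹ * (B.charpoly.roots.map (logSmooth f R r)).sum = TB at hB hdiff
  have hnorm : m * ‖SA - SB‖ ≤ W + ε * m + ε * m := by
    have h1 : m * ‖SA - SB‖ = ‖(m : ℂ) * (SA - SB)‖ := by
      rw [norm_mul, Complex.norm_real, Real.norm_eq_abs, abs_of_pos hm0]
    have h2 : (m : ℂ) * (SA - SB) = I - (TA - m * SA) + (TB - m * SB) := by rw [hdiff]; ring
    rw [h1, h2]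
    exact (norm_add_le _ _).trans (add_le_add ((norm_sub_le _ _).trans
      (add_le_add hint hA)) hB)
  have h3 : ‖SA - SB‖ ≤ (W + ε * m + ε * m) / m := by
    rw [le_div_iff₀ hm0]; linarith
  refine h3.trans_eq ?_
  field_simp
  ring

end Comparison

/-! ### Passage to the limit for eigenvalue means -/

section Final

variable {Ω : Type*} [MeasurableSpace Ω] {P : Measure Ω}
  {M M' : (n : ℕ) → Ω → Matrix (Fin n) (Fin n) ℂ}

/-- Because 2s² + 3 = 3(1 + s²/(3/2)), the case α = 0, a = 3/2 of `mean_log_one_add_div_le` converts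
Weyl's bound into the moment of (C0). -/
lemma rootMean_posLog_le {n : ℕ} (A : Matrix (Fin n) (Fin n) ℂ) (hn : 1 ≤ n) {p q : ℝ}
    (hq : 0 < q) (hq1 : q ≤ 1) (hqp : 2 * q ≤ p) :
    rootMean A (fun l => Real.posLog ‖l‖) ≤ (1 / 2) * (Real.log 3
      + (2 / (3 / 2)) ^ q / q * (1 + (1 / (n : ℝ)) * ∑ k ∈ Finset.Icc 1 n, singVal A k ^ p)) := by
  have hn' : (0 : ℝ) < n := by exact_mod_cast hn
  have h1 := mean_log_one_add_div_le A hn 0 (a := 3 / 2) (by norm_num) hq hq1 hqp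
  simp only [zero_smul, sub_zero, norm_zero] at h1
  norm_num only [zero_pow, mul_zero, zero_div, add_zero, Real.log_one, zero_add] at h1
  have h2 := mul_le_mul_of_nonneg_left (sum_posLog_roots_le A) (inv_nonneg.2 hn'.le)
  have h3 : ∑ j ∈ Finset.range n, Real.log (2 * sv A j ^ 2 + 3)
      = n * Real.log 3 + ∑ j ∈ Finset.range n, Real.log (1 + sv A j ^ 2 / (3 / 2)) := by
    have : (n : ℝ) * Real.log 3 = ∑ _j ∈ Finset.range n, Real.log 3 := by simp
    rw [this, ← Finset.sum_add_distrib]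
    refine Finset.sum_congr rfl fun j _ => ?_
    rw [← Real.log_mul (by norm_num) (by positivity)]
    congr 1
    ring
  rw [rootMean]
  refine h2.trans ?_
  rw [h3]
  have h4 : (n : ℝ)⁻¹ * (1 / 2 * (n * Real.log 3
      + ∑ j ∈ Finset.range n, Real.log (1 + sv A j ^ 2 / (3 / 2))))
      = 1 / 2 * (Real.log 3 + 1 / (n : ℝ)
        * ∑ j ∈ Finset.range n, Real.log (1 + sv A j ^ 2 / (3 / 2))) := by
    field_simp
  rw [h4]
  norm_num only at h1 ⊢
  linarith

lemma exists_prob_rootMean_posLog_le (hC0 : CondC0 P M) {η : ENNReal} (hη : 0 < η) :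
    ∃ T : ℝ, ∀ᶠ n : ℕ in atTop,
      P {ω | T < rootMean (M n ω) (fun l => Real.posLog ‖l‖)} ≤ η := by
  obtain ⟨p, hp, h⟩ := hC0
  obtain ⟨K, hK⟩ := h η hη
  set q := min (p / 2) 1 with hq
  have hq0 : 0 < q := lt_min (by linarith) one_pos
  have hq1 : q ≤ 1 := min_le_right _ _
  have hqp : 2 * q ≤ p := by linarith [min_le_left (p / 2) 1]
  refine ⟨(1 / 2) * (Real.log 3 + (2 / (3 / 2)) ^ q / q * (1 + K)), ?_⟩
  filter_upwards [hK, eventually_ge_atTop 1] with n hn hn1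
  refine le_trans (measure_mono fun ω hω => ?_) hn
  simp only [Set.mem_ofPred_eq] at hω ⊢
  by_contra hcon
  have h1 := rootMean_posLog_le (M n ω) hn1 hq0 hq1 hqp
  have h2 : ((2 : ℝ) / (3 / 2)) ^ q / q * (1 + (1 / (n : ℝ)) *
      ∑ k ∈ Finset.Icc 1 n, singVal (M n ω) k ^ p) ≤ (2 / (3 / 2)) ^ q / q * (1 + K) := by
    refine mul_le_mul_of_nonneg_left ?_ (by positivity)
    linarith [not_lt.1 hcon]
  linarith

variable [IsProbabilityMeasure P]

lemma tendsto_integral_min_abs {D : ℕ → Ω → ℝ} (hD : ∀ n, Measurable (D n))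
    (hlim : ∀ ε : ℝ, 0 < ε → Tendsto (fun n => P {ω | ε < |D n ω|}) atTop (𝓝 0)) {K : ℝ}
    (hK : 0 ≤ K) : Tendsto (fun n => ∫ ω, |min (|D n ω|) K| ∂P) atTop (𝓝 0) := by
  rw [Metric.tendsto_atTop']
  intro e he
  have h1 : Tendsto (fun n => K * P.real {ω | e / 2 < |D n ω|}) atTop (𝓝 0) := by
    have := ((ENNReal.tendsto_toReal ENNReal.zero_ne_top).comp (hlim (e / 2)
      (by positivity))).const_mul K
    simpa [Measure.real, Function.comp_def] using this
  obtain ⟨n₀, hn₀⟩ := eventually_atTop.1 (h1.eventually (gt_mem_nhds (half_pos he)))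
  refine ⟨n₀, fun n hn => ?_⟩
  have hset : MeasurableSet {ω | e / 2 < |D n ω|} := measurableSet_lt measurable_const (hD n).abs
  rw [Real.dist_0_eq_abs, abs_of_nonneg (integral_nonneg fun ω => abs_nonneg _)]
  have hle : ∫ ω, |min (|D n ω|) K| ∂P
      ≤ ∫ ω, (e / 2 + {ω | e / 2 < |D n ω|}.indicator (fun _ => K) ω) ∂P := by
    have hind : Integrable ({ω | e / 2 < |D n ω|}.indicator (fun _ => K)) P :=
      (integrable_const K).indicator hset
    refine integral_mono_of_nonneg (ae_of_all _ fun ω => abs_nonneg _)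
      ((integrable_const _).add hind) (ae_of_all _ fun ω => ?_)
    simp only
    rw [abs_of_nonneg (le_min (abs_nonneg _) hK)]
    by_cases hω : e / 2 < |D n ω|
    · rw [Set.indicator_of_mem (by exact hω)]
      linarith [min_le_right |D n ω| K]
    · rw [Set.indicator_of_notMem (by exact hω), add_zero]
      exact (min_le_left _ _).trans (not_lt.1 hω)
  refine hle.trans_lt ?_
  rw [integral_add (integrable_const _) ((integrable_const K).indicator hset),
    integral_indicator_const _ hset]
  simp only [integral_const, probReal_univ, smul_eq_mul, one_mul]
  have := hn₀ n hn.le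
  rw [mul_comm]
  linarith

lemma measurable_logDetDiff_sub {n : ℕ} {A B : Ω → Matrix (Fin n) (Fin n) ℂ}
    (hA : ∀ a b, Measurable fun ω => A ω a b) (hB : ∀ a b, Measurable fun ω => B ω a b) (α : ℂ) :
    Measurable fun ω => logDetDiff (A ω - α • 1) (B ω - α • 1) :=
  measurable_logDetDiff (M := fun ω => A ω - α • 1) (M' := fun ω => B ω - α • 1)
    (fun i j => (hA i j).sub_const _) (fun i j => (hB i j).sub_const _)

/-- Comparison of the eigenvalue means of a compactly supported function. -/
lemma tendsto_prob_mean_roots_of_compact (hM : ∀ n a b, Measurable fun ω => M n ω a b)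
    (hM' : ∀ n a b, Measurable fun ω => M' n ω a b) (hC0 : CondC0 P M) (hC0' : CondC0 P M')
    (hlog : ∀ (α : ℂ) (ε : ℝ), 0 < ε → Tendsto (fun n =>
      P {ω | ε < |logDetDiff (M n ω - α • 1) (M' n ω - α • 1)|}) atTop (𝓝 0))
    {f : ℂ → ℂ} (hf : Continuous f) {K ρ : ℝ} (hK : ∀ c, ‖f c‖ ≤ K)
    (hρ : ∀ c, ρ < ‖c‖ → f c = 0) {ε : ℝ} (hε : 0 < ε) :
    Tendsto (fun n : ℕ => P {ω | ε < ‖(n : ℂ)⁻¹ * ((M n ω).charpoly.roots.map f).sum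
      - (n : ℂ)⁻¹ * ((M' n ω).charpoly.roots.map f).sum‖}) atTop (𝓝 0) := by
  rw [ENNReal.tendsto_nhds_zero]
  intro η hη
  set η' := η / 3 with hη'
  have hη0 : 0 < η' := ENNReal.div_pos hη.ne' (by norm_num)
  have hK0 : 0 ≤ K := (norm_nonneg _).trans (hK 0)
  have huc : UniformContinuous f := by
    refine HasCompactSupport.uniformContinuous_of_continuous ?_ hf
    exact HasCompactSupport.intro (isCompact_closedBall 0 ρ) fun c hc => hρ c (by simpa using hc)
  -- Error budget: 2 · ε/8 for smoothing f at the eigenvalues of both matrices, ε/4 for the singular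
  -- part through L, and ε/4 for the truncated integral.
  obtain ⟨R', hR', hR2⟩ := Metric.uniformContinuous_iff.1 huc (ε / 8) (by positivity)
  set R := R' / 2
  have hR : 0 < R := half_pos hR'
  have hosc : ∀ c l, ‖c - l‖ ≤ R → ‖f c - f l‖ ≤ ε / 8 := fun c l hcl => by
    have := hR2 (a := c) (b := l) (by
      rw [dist_eq_norm]; exact lt_of_le_of_lt hcl (half_lt_self hR'))
    rw [dist_eq_norm] at this
    exact this.le
  have hr : 0 < R / 2 := half_pos hR
  have hrR : R / 2 < R := half_lt_self hR
  have hm0 := integral_logKernel_pos hr hrR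
  set W := (∫ a, logKernel R (R / 2) a)⁻¹ * (2 * K) with hW
  have hW0 : 0 ≤ W := by positivity
  have hL : ∃ L : ℝ, 0 ≤ L ∧ W * (Real.exp (-L) * (2 * ∫ β, invDisc β)) ≤ ε / 4 := by
    have : Tendsto (fun L : ℝ => W * (Real.exp (-L) * (2 * ∫ β, invDisc β))) atTop (𝓝 0) := by
      have := ((Real.tendsto_exp_neg_atTop_nhds_zero).mul_const (2 * ∫ β, invDisc β)).const_mul W
      simpa using this
    obtain ⟨L, h1, h2⟩ := ((eventually_ge_atTop 0).and
      (this.eventually (gt_mem_nhds (by positivity : 0 < ε / 4)))).exists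
    exact ⟨L, h1, h2.le⟩
  obtain ⟨L, hL0, hL⟩ := hL
  obtain ⟨T, hT⟩ := exists_prob_rootMean_posLog_le hC0 hη0
  obtain ⟨T', hT'⟩ := exists_prob_rootMean_posLog_le hC0' hη0
  -- A deterministic truncation level: T and T' bound the means of log⁺|λ| outside two events of
  -- probability at most η/3.
  set B := max 0 (2 * (Real.log 2 + Real.posLog (ρ + R) + L) + T + T') with hB
  have hB0 : 0 ≤ B := le_max_left _ _
  set Z : ℕ → Ω → ℝ := fun n ω => ∫ α in Metric.closedBall (0 : ℂ) (ρ + R),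
    min |logDetDiff (M n ω - α • 1) (M' n ω - α • 1)| B with hZ
  have hsub : ∀ {M : (n : ℕ) → Ω → Matrix (Fin n) (Fin n) ℂ},
      (∀ n a b, Measurable fun ω => M n ω a b) → ∀ n i j, Measurable fun p : ℂ × Ω =>
        (M n p.2 - p.1 • (1 : Matrix (Fin n) (Fin n) ℂ)) i j := fun hM n i j => by
    simp only [Matrix.sub_apply, Matrix.smul_apply, smul_eq_mul]
    exact ((hM n i j).comp measurable_snd).sub (measurable_fst.mul_const _)
  have hDm : ∀ n, Measurable fun p : ℂ × Ω =>
      logDetDiff (M n p.2 - p.1 • 1) (M' n p.2 - p.1 • 1) := fun n =>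
    measurable_logDetDiff (hsub hM n) (hsub hM' n)
  have : IsFiniteMeasure ((volume : Measure ℂ).restrict (Metric.closedBall (0 : ℂ) (ρ + R))) :=
    isFiniteMeasure_restrict.2 measure_closedBall_lt_top.ne
  have hZlim : Tendsto (fun n => P {ω | ε / (4 * (W + 1)) < |Z n ω|}) atTop (𝓝 0) := by
    refine tendsto_prob_abs_integral (K := B)
      (h := fun n α ω => min |logDetDiff (M n ω - α • 1) (M' n ω - α • 1)| B)
      (fun n => (hDm n).abs.min measurable_const) (ae_of_all _ fun α n ω => ?_)
      (ae_of_all _ fun α => ?_) (by positivity)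
    · rw [abs_of_nonneg (le_min (abs_nonneg _) hB0)]
      exact min_le_right _ _
    · exact tendsto_integral_min_abs (fun n => measurable_logDetDiff_sub (hM n) (hM' n) α)
        (hlog α) hB0
  filter_upwards [hT, hT', (ENNReal.tendsto_nhds_zero.1 hZlim) η' hη0, eventually_ge_atTop 1]
    with n e1 e2 e3 hn
  have hsum : η' + η' + η' = η := by
    have : η' + η' + η' = 3 * η' := by ring
    rw [this, hη']
    exact ENNReal.mul_div_cancel (by norm_num) (by norm_num)
  rw [← hsum]
  refine le_trans (measure_mono ?_) ((measure_union_le _ _).trans (add_le_add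
    ((measure_union_le _ _).trans (add_le_add e1 e2)) e3))
  intro ω hω
  by_contra hcon
  simp only [Set.mem_union, Set.mem_ofPred_eq, not_or, not_lt] at hcon hω
  obtain ⟨⟨c1, c2⟩, c3⟩ := hcon
  have main := norm_mean_roots_sub_le (M n ω) (M' n ω) hf hK hρ hn hr hrR hosc (M := B) hL0 (by
    refine le_trans ?_ (le_max_right _ _)
    linarith)
  have c4 : Z n ω ≤ ε / (4 * (W + 1)) := (le_abs_self _).trans c3
  have c5 : W * Z n ω ≤ ε / 4 := by
    refine (mul_le_mul_of_nonneg_left c4 hW0).trans ?_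
    rw [← mul_div_assoc, div_le_div_iff₀ (by positivity) (by norm_num)]
    nlinarith
  rw [← mul_assoc, ← hW, mul_add] at main
  change _ ≤ 2 * (ε / 8) + (W * Z n ω + _) at main
  linarith

/-- Comparison of the eigenvalue means of a bounded continuous function. -/
theorem tendsto_prob_mean_roots (hM : ∀ n a b, Measurable fun ω => M n ω a b)
    (hM' : ∀ n a b, Measurable fun ω => M' n ω a b) (hC0 : CondC0 P M) (hC0' : CondC0 P M')
    (hlog : ∀ (α : ℂ) (ε : ℝ), 0 < ε → Tendsto (fun n =>
      P {ω | ε < |logDetDiff (M n ω - α • 1) (M' n ω - α • 1)|}) atTop (𝓝 0))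
    {f : ℂ → ℂ} (hf : Continuous f) {K : ℝ} (hK : ∀ c, ‖f c‖ ≤ K) {ε : ℝ} (hε : 0 < ε) :
    Tendsto (fun n : ℕ => P {ω | ε < ‖(n : ℂ)⁻¹ * ((M n ω).charpoly.roots.map f).sum
      - (n : ℂ)⁻¹ * ((M' n ω).charpoly.roots.map f).sum‖}) atTop (𝓝 0) := by
  rw [ENNReal.tendsto_nhds_zero]
  intro η hη
  set η' := η / 3 with hη'
  have hη0 : 0 < η' := ENNReal.div_pos hη.ne' (by norm_num)
  have hK0 : 0 ≤ K := (norm_nonneg _).trans (hK 0)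
  obtain ⟨T, hT⟩ := exists_prob_rootMean_posLog_le hC0 hη0
  obtain ⟨T', hT'⟩ := exists_prob_rootMean_posLog_le hC0' hη0
  -- Markov's inequality for log⁺|λ|: the share of eigenvalues beyond ρ is at most the mean of
  -- log⁺|λ| divided by log ρ, so cutting f off there costs at most ε/2.
  obtain ⟨ρ, hρ1, hρT⟩ : ∃ ρ : ℝ, 1 < ρ ∧ K / Real.log ρ * (T + T') < ε / 2 := by
    have h1 : Tendsto (fun ρ : ℝ => K / Real.log ρ * (T + T')) atTop (𝓝 0) := by
      have := (tendsto_const_nhds (x := K)).div_atTop Real.tendsto_log_atTop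
      simpa using this.mul_const (T + T')
    exact ((eventually_gt_atTop 1).and (h1.eventually (gt_mem_nhds (half_pos hε)))).exists
  have hlogρ : 0 < Real.log ρ := Real.log_pos hρ1
  set χ : ℂ → ℝ := fun c => max 0 (min 1 (ρ + 1 - ‖c‖)) with hχ
  have hχ0 : ∀ c, 0 ≤ χ c := fun c => le_max_left _ _
  have hχ1 : ∀ c, χ c ≤ 1 := fun c => max_le zero_le_one (min_le_left _ _)
  have hχc : Continuous χ := by fun_prop
  set g : ℂ → ℂ := fun c => f c * (χ c : ℂ) with hg
  have hgc : Continuous g := hf.mul (Complex.continuous_ofReal.comp hχc)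
  have hgK : ∀ c, ‖g c‖ ≤ K := fun c => by
    simp only [hg]
    rw [norm_mul, Complex.norm_real, Real.norm_eq_abs, abs_of_nonneg (hχ0 c)]
    exact (mul_le_of_le_one_right (norm_nonneg _) (hχ1 c)).trans (hK c)
  have hgρ : ∀ c, ρ + 1 < ‖c‖ → g c = 0 := fun c hc => by
    have : χ c = 0 := max_eq_left ((min_le_right _ _).trans (by linarith))
    simp [hg, this]
  have hfg : ∀ c, ‖f c - g c‖ ≤ K / Real.log ρ * Real.posLog ‖c‖ := fun c => by
    by_cases hc : ‖c‖ ≤ ρ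
    · have : χ c = 1 := by
        simp only [hχ]
        rw [min_eq_left (by linarith), max_eq_right zero_le_one]
      simp only [hg, this, Complex.ofReal_one, mul_one, sub_self, norm_zero]
      exact mul_nonneg (by positivity) Real.posLog_nonneg
    · have h1 : f c - g c = f c * ((1 - χ c : ℝ) : ℂ) := by simp only [hg]; push_cast; ring
      have h2 : Real.log ρ ≤ Real.posLog ‖c‖ :=
        (Real.log_le_log (by linarith) (not_le.1 hc).le).trans (le_max_right _ _)
      rw [h1, norm_mul, Complex.norm_real, Real.norm_eq_abs,
        abs_of_nonneg (by linarith [hχ1 c]), div_mul_eq_mul_div, le_div_iff₀ hlogρ]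
      have h3 : ‖f c‖ * (1 - χ c) ≤ K :=
        (mul_le_of_le_one_right (norm_nonneg _) (by linarith [hχ0 c])).trans (hK c)
      exact mul_le_mul h3 h2 hlogρ.le hK0
  have hmean : ∀ {n : ℕ} (A : Matrix (Fin n) (Fin n) ℂ),
      ‖(n : ℂ)⁻¹ * (A.charpoly.roots.map f).sum - (n : ℂ)⁻¹ * (A.charpoly.roots.map g).sum‖
        ≤ K / Real.log ρ * rootMean A (fun l => Real.posLog ‖l‖) := fun A => by
    rw [← mul_sub, ← Multiset.sum_map_sub, ← rootMean_const_mul]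
    exact (norm_mean_roots_le A _).trans (rootMean_mono A hfg)
  have hcomp := tendsto_prob_mean_roots_of_compact hM hM' hC0 hC0' hlog hgc hgK hgρ (half_pos hε)
  filter_upwards [hT, hT', (ENNReal.tendsto_nhds_zero.1 hcomp) η' hη0] with n e1 e2 e3
  have hsum : η' + η' + η' = η := by
    have : η' + η' + η' = 3 * η' := by ring
    rw [this, hη']
    exact ENNReal.mul_div_cancel (by norm_num) (by norm_num)
  rw [← hsum]
  refine le_trans (measure_mono ?_) ((measure_union_le _ _).trans (add_le_add
    ((measure_union_le _ _).trans (add_le_add e1 e2)) e3))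
  intro ω hω
  by_contra hcon
  simp only [Set.mem_union, Set.mem_ofPred_eq, not_or, not_lt] at hcon hω
  obtain ⟨⟨c1, c2⟩, c3⟩ := hcon
  have m1 := hmean (M n ω)
  have m2 := hmean (M' n ω)
  have hq : 0 ≤ K / Real.log ρ := by positivity
  have k1 := mul_le_mul_of_nonneg_left c1 hq
  have k2 := mul_le_mul_of_nonneg_left c2 hq
  generalize (n : ℂ)⁻¹ * ((M n ω).charpoly.roots.map f).sum = a1 at m1 hω
  generalize (n : ℂ)⁻¹ * ((M' n ω).charpoly.roots.map f).sum = a2 at m2 hω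
  generalize (n : ℂ)⁻¹ * ((M n ω).charpoly.roots.map g).sum = b1 at m1 c3
  generalize (n : ℂ)⁻¹ * ((M' n ω).charpoly.roots.map g).sum = b2 at m2 c3
  have htri : ‖a1 - a2‖ ≤ ‖a1 - b1‖ + ‖b1 - b2‖ + ‖a2 - b2‖ := by
    have : a1 - a2 = (a1 - b1) + (b1 - b2) - (a2 - b2) := by ring
    rw [this]
    exact (norm_sub_le _ _).trans (add_le_add_left (norm_add_le _ _) _)
  rw [mul_add] at hρT
  linarith

end Final

end RandomMatrixFunctions
end
-- Universality of the limiting eigenvalue distribution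
theorem theorem4p1 {Ω : Type*} [MeasurableSpace Ω] (P : Measure Ω) [IsProbabilityMeasure P]
    -- the matrix sizes `n_q(n)`, with `n_0 = n_m = n`
    (m : ℕ) (hm : 1 ≤ m) (N : ℕ → Fin (m + 1) → ℕ)
    (hN_first : ∀ n, N n 0 = n) (hN_last : ∀ n, N n (Fin.last m) = n)
    (hN_shape : ∀ q : Fin m, ∃ y : ℝ, 0 < y ∧
      Tendsto (fun n : ℕ => (n : ℝ) / (N n q.succ : ℝ)) atTop (𝓝 y))
    -- the matrix functions
    (F : (n : ℕ) → RandomMatrixFunctions.MatTuple (N n) → Matrix (Fin n) (Fin n) ℂ)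
    (hF_smooth : ∀ (n : ℕ) (a b : Fin n), ContDiff ℝ 3
      (fun u : RandomMatrixFunctions.Entry (N n) → ℂ =>
        F n (RandomMatrixFunctions.ofEntries u) a b))
    -- the (unnormalized) entries
    (X Y : (n : ℕ) → RandomMatrixFunctions.Entry (N n) → Ω → ℂ)
    (hX_meas : ∀ n e, Measurable (X n e)) (hY_meas : ∀ n e, Measurable (Y n e))
    (h_indep : ∀ n, iIndepFun (Sum.elim (X n) (Y n)) P)
    (hX_mean : ∀ n e, ∫ ω, X n e ω ∂P = 0)
    (hX_var : ∀ n e, ∫ ω, ‖X n e ω‖ ^ 2 ∂P = 1)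
    (hY_gauss : ∀ n e, HasGaussianLaw (Y n e) P)
    (hY_re : ∀ n e, ∫ ω, (Y n e ω).re ∂P = ∫ ω, (X n e ω).re ∂P)
    (hY_im : ∀ n e, ∫ ω, (Y n e ω).im ∂P = ∫ ω, (X n e ω).im ∂P)
    (hY_re_re : ∀ n e, ∫ ω, (Y n e ω).re ^ 2 ∂P = ∫ ω, (X n e ω).re ^ 2 ∂P)
    (hY_im_im : ∀ n e, ∫ ω, (Y n e ω).im ^ 2 ∂P = ∫ ω, (X n e ω).im ^ 2 ∂P)
    (hY_re_im : ∀ n e, ∫ ω, (Y n e ω).re * (Y n e ω).im ∂P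
      = ∫ ω, (X n e ω).re * (X n e ω).im ∂P)
    -- Lindeberg condition and rank condition
    (h_lindeberg : ∀ t : ℝ, 0 < t →
      Tendsto (fun n : ℕ => RandomMatrixFunctions.lindebergSum P n (X n) t) atTop (𝓝 0))
    (h_rank : RandomMatrixFunctions.RankCondition N F)
    -- the truncation levels
    (τ : ℕ → ℝ) (hτ_zero : Tendsto τ atTop (𝓝 0))
    (hτ_lindeberg : Tendsto
      (fun n : ℕ => RandomMatrixFunctions.lindebergSum P n (X n) (τ n) * (τ n ^ 4)⁻¹) atTop (𝓝 0))
    (hτ_lower : ∀ n : ℕ, 1 ≤ n → (n : ℝ) ^ (-(1 / 3 : ℝ)) ≤ τ n)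
    -- the derivative bounds for every shift `B = α I`
    (h_deriv : ∀ α : ℂ, RandomMatrixFunctions.DerivativeBounds P N F X Y τ (fun _ => α • 1))
    -- conditions (C0), (C1), (C2)
    (hX_C0 : RandomMatrixFunctions.CondC0 P
      (fun n ω => RandomMatrixFunctions.valueAt (F n) (fun e => X n e ω)))
    (hY_C0 : RandomMatrixFunctions.CondC0 P
      (fun n ω => RandomMatrixFunctions.valueAt (F n) (fun e => Y n e ω)))
    (hX_C1 : RandomMatrixFunctions.CondC1 P
      (fun n ω => RandomMatrixFunctions.valueAt (F n) (fun e => X n e ω)))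
    (hY_C1 : RandomMatrixFunctions.CondC1 P
      (fun n ω => RandomMatrixFunctions.valueAt (F n) (fun e => Y n e ω)))
    (hX_C2 : RandomMatrixFunctions.CondC2 P
      (fun n ω => RandomMatrixFunctions.valueAt (F n) (fun e => X n e ω)))
    (hY_C2 : RandomMatrixFunctions.CondC2 P
      (fun n ω => RandomMatrixFunctions.valueAt (F n) (fun e => Y n e ω))) :
    ∀ (f : BoundedContinuousFunction ℂ ℂ) (ε : ℝ), 0 < ε →
      Tendsto (fun n : ℕ => P {ω | ε <
        ‖(∫ w, f w ∂(RandomMatrixFunctions.spectralMeasure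
            (RandomMatrixFunctions.valueAt (F n) (fun e => X n e ω))))
          - ∫ w, f w ∂(RandomMatrixFunctions.spectralMeasure
            (RandomMatrixFunctions.valueAt (F n) (fun e => Y n e ω)))‖}) atTop (𝓝 0) := by
  intro f ε hε
  have hFc : ∀ n a b, Continuous fun u : RandomMatrixFunctions.Entry (N n) → ℂ =>
      F n (RandomMatrixFunctions.ofEntries u) a b := fun n a b => (hF_smooth n a b).continuous
  have hMX : ∀ n a b, Measurable fun ω =>
      RandomMatrixFunctions.valueAt (F n) (fun e => X n e ω) a b := fun n a b =>
    (RandomMatrixFunctions.measurable_valueAt (hFc n) a b).comp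
      (measurable_pi_lambda _ (hX_meas n))
  have hMY : ∀ n a b, Measurable fun ω =>
      RandomMatrixFunctions.valueAt (F n) (fun e => Y n e ω) a b := fun n a b =>
    (RandomMatrixFunctions.measurable_valueAt (hFc n) a b).comp
      (measurable_pi_lambda _ (hY_meas n))
  simp_rw [RandomMatrixFunctions.integral_spectralMeasure]
  refine RandomMatrixFunctions.tendsto_prob_mean_roots hMX hMY hX_C0 hY_C0 (fun α ε' hε' => ?_)
    f.continuous (fun c => f.norm_coe_le_norm c) hε
  exact RandomMatrixFunctions.tendsto_prob_logDetDiff hMX hMY hX_C0 hX_C1 hX_C2 hY_C0 hY_C1 hY_C2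
    α (fun w hw => RandomMatrixFunctions.tendsto_integral_abs_resTr_sub hN_first hN_shape hF_smooth
      hX_meas hY_meas h_indep hX_mean hX_var hY_gauss hY_re hY_im hY_re_re hY_im_im hY_re_im
      h_rank hτ_zero hτ_lindeberg hτ_lower h_deriv α hw) hε'
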